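/- Let $K$ be an algebraically closed field; all algebras and bimodules below are finite-dimensional over $K$, and $K$ acts centrally on bimodules. For an algebra $A$, let $\operatorname{mod}A$ be the category of finitely generated left $A$-modules. Choose orthogonal primitive idempotents $f_1,\dots,f_n$ of $A$ such that the modules $P_A(i)=Af_i$ form a complete irredundant list of the indecomposable projective $A$-modules, and put $S_A(i)=P_A(i)/\operatorname{rad}P_A(i)$. Let $\Delta_A(i)$ be the largest factor module of $P_A(i)$ all of whose composition factors are among the $S_A(j)$ with $j\le i$, and let $\overline\Delta_A(i)$ be the largest factor module of $\Delta_A(i)$ with Jordan–Hölder multiplicity $[\overline\Delta_A(i):S_A(i)]=1$. Let $\mathcal F(\overline\Delta_A)\subseteq\operatorname{mod}A$ be the full subcategory of the modules with a finite filtration whose factors are isomorphic to modules $\overline\Delta_A(j)$. The algebra $A$ (with this ordering of its simple modules) is $\overline\Delta$-filtered if every $P_A(i)$ has a filtration with factors among $\overline\Delta_A(i),\dots,\overline\Delta_A(n)$. A bocs $\mathcal B=(B,W,\varepsilon,\mu)$ consists of a basic algebra $B$ with $1=e_1+\dots+e_n$, where the $e_i$ are orthogonal primitive idempotents and the modules $P_B(i)=Be_i$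 are pairwise non-isomorphic, and a $B$-bimodule $W$ with a surjective $B$-bilinear counit $\varepsilon:W\to B$ and a coassociative counital $B$-bilinear comultiplication $\mu:W\to W\otimes_BW$. It is one-cyclic directed if $\operatorname{rad}_B(P_B(i),P_B(j))=0$ for $i<j$ and, for some integers $d_{ij}\ge0$, $\ker\varepsilon\cong\bigoplus_{i>j}(Be_i\otimes_Ke_jB)^{d_{ij}}$ as $B$-bimodules. The objects of the $K$-linear category $\operatorname{mod}\mathcal B$ are the finite-dimensional left $B$-modules. Its morphism spaces are $\operatorname{Hom}_{\mathcal B}(X,Y)=\operatorname{Hom}_B(W\otimes_BX,Y)$, the composite of $f:X\to Y$ and $g:Y\to Z$ is $g\circ(\operatorname{id}_W\otimes f)\circ(\mu\otimes\operatorname{id}_X)$, and the identity of $X$ is $w\otimes x\mapsto\varepsilon(w)x$. The right Burt–Butler algebra is $R=\operatorname{End}_{\mathcal B}(B)^{\mathrm{op}}$. There is a canonical algebra homomorphism $B\to R$ which sends $b$ to $(w\otimes x\mapsto\varepsilon(w)xb)$. **Theorem.** Let $\mathcal B=(B,W)$ be a one-cyclic directed bocs and $R$ its right Burt–Butler algebra.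 Then $R$ is finite-dimensional and has exactly $n$ simple modules up to isomorphism, and these can be labelled $S_R(1),\dots,S_R(n)$ (by idempotents as above) so that: 1. $R$ is a $\overline\Delta$-filtered algebra. 2. $B$ is a proper Borel subalgebra of $R$: the map $B\to R$ is injective, $\operatorname{rad}_B(P_B(i),P_B(j))=0$ for $i<j$, the functor $R\otimes_B-$ is exact, and $\overline\Delta_R(i)\cong R\otimes_BS_B(i)$ for all $i$. 3. $B$ is homological in $R$: for all finitely generated $B$-modules $X,Y$ the natural maps $\operatorname{Ext}^k_B(X,Y)\to\operatorname{Ext}^k_R(R\otimes_BX,R\otimes_BY)$ are surjective for $k\ge1$ and bijective for $k\ge2$. 4. There is a $K$-linear equivalence of categories $\mathcal F(\overline\Delta_R)\simeq\operatorname{mod}\mathcal B$. -/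

import Mathlib

open CategoryTheory MulOpposite
open scoped TensorProduct

universe v u u₁ u₂ u₃ u₄ u₅ u₆

noncomputable section

/-! ### Tensor products over a noncommutative ring

A right `B`-module is a `Bᵐᵒᵖ`-module; `op b • m` is `m b`. -/

/-- The additive subgroup of `M ⊗[ℤ] N` generated by all `(m b) ⊗ n - m ⊗ (b n)`. -/
def BTensor.rel (B : Type u₁) (M : Type u₂) (N : Type u₃) [Ring B] [AddCommGroup M]
    [Module Bᵐᵒᵖ M] [AddCommGroup N] [Module B N] : AddSubgroup (M ⊗[ℤ] N) :=
  AddSubgroup.closure {t | ∃ (m : M) (b : B) (n : N), t = (op b • m) ⊗ₜ[ℤ] n - m ⊗ₜ[ℤ] (b • n)}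

/-- The tensor product `M ⊗_B N` of a right `B`-module `M` and a left `B`-module `N`. -/
def BTensor (B : Type u₁) (M : Type u₂) (N : Type u₃) [Ring B] [AddCommGroup M]
    [Module Bᵐᵒᵖ M] [AddCommGroup N] [Module B N] : Type (max u₂ u₃) :=
  (M ⊗[ℤ] N) ⧸ BTensor.rel B M N

namespace BTensor

section Basic

variable {B : Type u₁} [Ring B] {M : Type u₂} [AddCommGroup M] [Module Bᵐᵒᵖ M]
  {N : Type u₃} [AddCommGroup N] [Module B N] {P : Type u₄} [AddCommGroup P]

instance : AddCommGroup (BTensor B M N) :=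
  inferInstanceAs (AddCommGroup ((M ⊗[ℤ] N) ⧸ rel B M N))

variable (B) in
/-- The pure tensor `m ⊗ n` in `M ⊗_B N`. -/
def tmul (m : M) (n : N) : BTensor B M N := QuotientAddGroup.mk' (rel B M N) (m ⊗ₜ[ℤ] n)

theorem tmul_add (m : M) (n n' : N) : tmul B m (n + n') = tmul B m n + tmul B m n' := by
  simp only [tmul, TensorProduct.tmul_add, map_add]; rfl

theorem add_tmul (m m' : M) (n : N) : tmul B (m + m') n = tmul B m n + tmul B m' n := by
  simp only [tmul, TensorProduct.add_tmul, map_add]; rfl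

theorem op_smul_tmul (b : B) (m : M) (n : N) : tmul B (op b • m) n = tmul B m (b • n) := by
  refine QuotientAddGroup.eq_iff_sub_mem.2 ?_
  exact AddSubgroup.subset_closure ⟨m, b, n, rfl⟩

@[elab_as_elim]
theorem induction {p : BTensor B M N → Prop} (t : BTensor B M N) (zero : p 0)
    (tmul : ∀ m n, p (tmul B m n)) (add : ∀ s t, p s → p t → p (s + t)) : p t := by
  obtain ⟨t, rfl⟩ := QuotientAddGroup.mk'_surjective (rel B M N) t
  induction t using TensorProduct.induction_on with
  | zero => exact zero
  | tmul m n => exact tmul m n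
  | add s t hs ht => exact add _ _ hs ht

/-- The universal property: a biadditive `B`-balanced map factors through `M ⊗_B N`. -/
def lift (f : M →+ N →+ P) (hf : ∀ (b : B) m n, f (op b • m) n = f m (b • n)) :
    BTensor B M N →+ P :=
  QuotientAddGroup.lift (rel B M N)
    (TensorProduct.liftAddHom f fun r m n => by simp)
    (by
      refine (AddSubgroup.closure_le (K := AddMonoidHom.ker _)).2 ?_
      rintro _ ⟨m, b, n, rfl⟩
      simp [AddMonoidHom.mem_ker, hf])

@[simp]
theorem lift_tmul (f : M →+ N →+ P) (hf : ∀ (b : B) m n, f (op b • m) n = f m (b • n))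
    (m : M) (n : N) : lift f hf (tmul B m n) = f m n := rfl

theorem addHom_ext {f g : BTensor B M N →+ P} (h : ∀ m n, f (tmul B m n) = g (tmul B m n)) :
    f = g := by
  ext t
  induction t using BTensor.induction with
  | zero => simp
  | tmul m n => exact h m n
  | add s t hs ht => simp [hs, ht]

/-- Construct a biadditive map. -/
def biadd (f : M → N → P) (h₁ : ∀ m m' n, f (m + m') n = f m n + f m' n)
    (h₂ : ∀ m n n', f m (n + n') = f m n + f m n') : M →+ N →+ P :=
  AddMonoidHom.mk' (fun m => AddMonoidHom.mk' (f m) (h₂ m)) fun m m' => by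
    ext n; exact h₁ m m' n

@[simp]
theorem biadd_apply (f : M → N → P) (h₁ : ∀ m m' n, f (m + m') n = f m n + f m' n)
    (h₂ : ∀ m n n', f m (n + n') = f m n + f m n') (m : M) (n : N) :
    biadd f h₁ h₂ m n = f m n := rfl

/-- `φ ⊗ ψ` for a right linear `φ` and a left linear `ψ`. -/
def map {M' : Type u₅} [AddCommGroup M'] [Module Bᵐᵒᵖ M']
    {N' : Type u₆} [AddCommGroup N'] [Module B N']
    (φ : M →+ M') (hφ : ∀ (b : B) m, φ (op b • m) = op b • φ m)
    (ψ : N →+ N') (hψ : ∀ (b : B) n, ψ (b • n) = b • ψ n) : BTensor B M N →+ BTensor B M' N' :=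
  lift (biadd (fun m n => tmul B (φ m) (ψ n)) (fun m m' n => by rw [map_add, add_tmul])
    (fun m n n' => by rw [map_add, tmul_add]))
    (fun b m n => by simp only [biadd_apply, hφ, hψ, op_smul_tmul])

@[simp]
theorem map_tmul {M' : Type u₅} [AddCommGroup M'] [Module Bᵐᵒᵖ M']
    {N' : Type u₆} [AddCommGroup N'] [Module B N']
    (φ : M →+ M') (hφ : ∀ (b : B) m, φ (op b • m) = op b • φ m)
    (ψ : N →+ N') (hψ : ∀ (b : B) n, ψ (b • n) = b • ψ n) (m : M) (n : N) :
    map φ hφ ψ hψ (tmul B m n) = tmul B (φ m) (ψ n) := rfl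

end Basic

section Left

variable {A : Type u₄} [Ring A] {B : Type u₁} [Ring B] {M : Type u₂} [AddCommGroup M]
  [Module Bᵐᵒᵖ M] [Module A M] [SMulCommClass A Bᵐᵒᵖ M] {N : Type u₃} [AddCommGroup N] [Module B N]

/-- For an `A`-`B`-bimodule `M`, the left action `a (m ⊗ n) = (a m) ⊗ n` on `M ⊗_B N`. -/
instance leftModule : Module A (BTensor B M N) where
  smul a := map (DistribSMul.toAddMonoidHom M a) (fun b m => smul_comm a (op b) m)
    (AddMonoidHom.id N) (fun _ _ => rfl)
  one_smul t := by
    change map _ _ _ _ t = t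
    induction t using BTensor.induction with
    | zero => simp
    | tmul m n => exact congrArg (fun x => tmul B x n) (one_smul _ m)
    | add s t hs ht => rw [map_add, hs, ht]
  mul_smul a a' t := by
    change map _ _ _ _ t = map _ _ _ _ (map _ _ _ _ t)
    induction t using BTensor.induction with
    | zero => simp
    | tmul m n => exact congrArg (fun x => tmul B x n) (mul_smul a a' m)
    | add s t hs ht => simp only [map_add, hs, ht]
  smul_zero a := map_zero _
  smul_add a := map_add _
  add_smul a a' t := by
    change map _ _ _ _ t = map _ _ _ _ t + map _ _ _ _ t
    induction t using BTensor.induction with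
    | zero => simp
    | tmul m n =>
      exact (congrArg (fun x => tmul B x n) (add_smul a a' m)).trans (add_tmul _ _ _)
    | add s t hs ht => simp only [map_add, hs, ht]; abel
  zero_smul t := by
    change map _ _ _ _ t = 0
    induction t using BTensor.induction with
    | zero => simp
    | tmul m n =>
      refine (congrArg (fun x => tmul B x n) (zero_smul A m)).trans ?_
      exact left_eq_add.1 ((congrArg (fun x => tmul B x n) (add_zero (0 : M)).symm).trans
        (add_tmul 0 0 n))
    | add s t hs ht => rw [map_add, hs, ht, add_zero]

@[simp]
theorem smul_tmul (a : A) (m : M) (n : N) : a • tmul B m n = tmul B (a • m) n := rfl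

variable {N' : Type u₅} [AddCommGroup N'] [Module B N']

variable (A M) in
/-- The `A`-linear map `id ⊗ ψ` for an `A`-`B`-bimodule `M`. -/
def lmap (ψ : N →ₗ[B] N') : BTensor B M N →ₗ[A] BTensor B M N' where
  toFun := map (AddMonoidHom.id M) (fun _ _ => rfl) ψ.toAddMonoidHom (fun b x => ψ.map_smul b x)
  map_add' := map_add _
  map_smul' a t := by
    induction t using BTensor.induction with
    | zero => simp
    | tmul m n => rfl
    | add s t hs ht => rw [smul_add, map_add, hs, ht, map_add, smul_add]

@[simp]
theorem lmap_tmul (ψ : N →ₗ[B] N') (m : M) (n : N) :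
    lmap A M ψ (tmul B m n) = tmul B m (ψ n) := rfl

theorem linearMap_ext {Q : Type u₅} [AddCommGroup Q] [Module A Q] {f g : BTensor B M N →ₗ[A] Q}
    (h : ∀ m n, f (tmul B m n) = g (tmul B m n)) : f = g :=
  LinearMap.toAddMonoidHom_injective (addHom_ext h)

end Left

section Right

variable {C : Type u₄} [Ring C] {B : Type u₁} [Ring B] {M : Type u₂} [AddCommGroup M]
  [Module Bᵐᵒᵖ M] {N : Type u₃} [AddCommGroup N] [Module B N] [Module Cᵐᵒᵖ N]
  [SMulCommClass B Cᵐᵒᵖ N]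

/-- For a `B`-`C`-bimodule `N`, the right action `(m ⊗ n) c = m ⊗ (n c)` on `M ⊗_B N`. -/
instance rightModule : Module Cᵐᵒᵖ (BTensor B M N) where
  smul c := map (AddMonoidHom.id M) (fun _ _ => rfl)
    (DistribSMul.toAddMonoidHom N c) (fun b n => (smul_comm b c n).symm)
  one_smul t := by
    change map _ _ _ _ t = t
    induction t using BTensor.induction with
    | zero => simp
    | tmul m n => exact congrArg (fun x => tmul B m x) (one_smul _ n)
    | add s t hs ht => rw [map_add, hs, ht]
  mul_smul a a' t := by
    change map _ _ _ _ t = map _ _ _ _ (map _ _ _ _ t)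
    induction t using BTensor.induction with
    | zero => simp
    | tmul m n => exact congrArg (fun x => tmul B m x) (mul_smul a a' n)
    | add s t hs ht => simp only [map_add, hs, ht]
  smul_zero a := map_zero _
  smul_add a := map_add _
  add_smul a a' t := by
    change map _ _ _ _ t = map _ _ _ _ t + map _ _ _ _ t
    induction t using BTensor.induction with
    | zero => simp
    | tmul m n =>
      exact (congrArg (fun x => tmul B m x) (add_smul a a' n)).trans (tmul_add _ _ _)
    | add s t hs ht => simp only [map_add, hs, ht]; abel
  zero_smul t := by
    change map _ _ _ _ t = 0
    induction t using BTensor.induction with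
    | zero => simp
    | tmul m n =>
      refine (congrArg (fun x => tmul B m x) (zero_smul Cᵐᵒᵖ n)).trans ?_
      exact left_eq_add.1 ((congrArg (fun x => tmul B m x) (add_zero (0 : N)).symm).trans
        (tmul_add m 0 0))
    | add s t hs ht => rw [map_add, hs, ht, add_zero]

theorem op_smul_tmul_right (c : C) (m : M) (n : N) :
    op c • tmul B m n = tmul B m (op c • n) := rfl

variable {P : Type u₅} [AddCommGroup P] [Module C P]

/-- For fixed `p`, the map `m ⊗ n ↦ m ⊗ (n ⊗ p)`. -/
def assocAux (p : P) : BTensor B M N →+ BTensor B M (BTensor C N P) :=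
  map (AddMonoidHom.id M) (fun _ _ => rfl)
    (AddMonoidHom.mk' (fun n => tmul C n p) (fun n n' => add_tmul n n' p)) (fun _ _ => rfl)

theorem assocAux_tmul (p : P) (m : M) (n : N) :
    assocAux p (tmul B m n) = tmul B m (tmul C n p) := rfl

theorem assocAux_add (p p' : P) (t : BTensor B M N) :
    (assocAux (p + p') t : BTensor B M (BTensor C N P)) = assocAux p t + assocAux p' t := by
  induction t using BTensor.induction with
  | zero => simp
  | tmul m n => rw [assocAux_tmul, assocAux_tmul, assocAux_tmul, tmul_add, tmul_add]
  | add s t hs ht => rw [map_add, hs, ht, map_add, map_add]; abel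

theorem assocAux_op_smul (c : C) (p : P) (t : BTensor B M N) :
    (assocAux p (op c • t) : BTensor B M (BTensor C N P)) = assocAux (c • p) t := by
  induction t using BTensor.induction with
  | zero => simp
  | tmul m n => rw [op_smul_tmul_right, assocAux_tmul, assocAux_tmul, op_smul_tmul]
  | add s t hs ht => rw [smul_add, map_add, hs, ht, map_add]

/-- The associativity map `(m ⊗ n) ⊗ p ↦ m ⊗ (n ⊗ p)`. -/
def assoc : BTensor C (BTensor B M N) P →+ BTensor B M (BTensor C N P) :=
  lift (biadd (fun t p => assocAux p t) (fun t t' p => map_add (assocAux p) t t')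
    (fun t p p' => assocAux_add p p' t)) (fun c t p => assocAux_op_smul c p t)

@[simp]
theorem assoc_tmul (m : M) (n : N) (p : P) :
    assoc (tmul C (tmul B m n) p) = tmul B m (tmul C n p) := rfl

end Right

section Unit

variable {B : Type u₁} [Ring B] {N : Type u₃} [AddCommGroup N] [Module B N]
  {M : Type u₂} [AddCommGroup M] [Module Bᵐᵒᵖ M]

variable (B N) in
/-- The canonical map `B ⊗_B N → N`, `b ⊗ n ↦ b n`. -/
def lid : BTensor B B N →+ N :=
  lift (biadd (fun b n => b • n) (fun b b' n => add_smul b b' n) (fun b n n' => smul_add b n n'))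
    (fun b b' n => by simp [mul_smul])

@[simp]
theorem lid_tmul (b : B) (n : N) : lid B N (tmul B b n) = b • n := rfl

variable (B M) in
/-- The canonical map `M ⊗_B B → M`, `m ⊗ b ↦ m b`. -/
def rid : BTensor B M B →+ M :=
  lift (biadd (fun m b => op b • m) (fun m m' b => smul_add _ m m')
    (fun m b b' => by rw [MulOpposite.op_add, add_smul]))
    (fun b m b' => by simp [mul_smul])

@[simp]
theorem rid_tmul (m : M) (b : B) : rid B M (tmul B m b) = op b • m := rfl

end Unit

end BTensor

/-! ### Modules over finite-dimensional algebras -/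

section Algebras

variable {A : Type u} [Ring A] {n : ℕ}

/-- The left ideal `A a`, for `a = eᵢ` the projective module `P(i) = A eᵢ`. -/
abbrev leftIdeal (a : A) : Ideal A := Ideal.span {a}

/-- Primitive idempotents: nonzero idempotents which are not the sum of two nonzero orthogonal
idempotents. -/
def IsPrimitiveIdempotent (a : A) : Prop :=
  IsIdempotentElem a ∧ a ≠ 0 ∧ ∀ f g : A, IsIdempotentElem f → IsIdempotentElem g →
    f * g = 0 → g * f = 0 → f + g = a → f = 0 ∨ g = 0

/-- `e₁, …, eₙ` are orthogonal primitive idempotents such that the modules `A eᵢ` form a complete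
irredundant list of the indecomposable projective `A`-modules. -/
structure IsBasicSystem (e : Fin n → A) : Prop where
  orthogonal : OrthogonalIdempotents e
  primitive : ∀ i, IsPrimitiveIdempotent (e i)
  irredundant : ∀ i j, Nonempty (leftIdeal (e i) ≃ₗ[A] leftIdeal (e j)) → i = j
  complete : ∀ f : A, IsPrimitiveIdempotent f → ∃ i, Nonempty (leftIdeal f ≃ₗ[A] leftIdeal (e i))

/-- The indecomposable projective module `P(i) = A eᵢ`. -/
def projMod (e : Fin n → A) (i : Fin n) : ModuleCat.{u} A := ModuleCat.of A (leftIdeal (e i))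

/-- The simple module `S(i) = P(i) / rad P(i)`. -/
def simpleMod (e : Fin n → A) (i : Fin n) : ModuleCat.{u} A :=
  ModuleCat.of A (projMod e i ⧸ Module.jacobson A (projMod e i))

/-- The Jordan-Hölder multiplicity `[X : T]`: the number of factors isomorphic to `T` in a
composition series of the module `X` of finite length.  (By the Jordan-Hölder theorem the set below
has exactly one element.) -/
def jhMult (A : Type u) [Ring A] (X : Type u₁) [AddCommGroup X] [Module A X]
    (T : Type u₂) [AddCommGroup T] [Module A T] : ℕ :=
  sSup {m | ∃ s : CompositionSeries (Submodule A X), s.head = ⊥ ∧ s.last = ⊤ ∧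
    m = Nat.card {k : Fin s.length // Nonempty
      ((s k.succ ⧸ (s k.castSucc).submoduleOf (s k.succ)) ≃ₗ[A] T)}}

/-- The kernel of `P(i) → Δ(i)`: the smallest submodule `U` of `P(i)` such that `P(i)/U` has only
composition factors `S(j)` with `j ≤ i`.  (These `U` are closed under intersections.) -/
def standardKer (e : Fin n → A) (i : Fin n) : Submodule A (projMod e i) :=
  sInf {U | ∀ j, jhMult A (projMod e i ⧸ U) (simpleMod e j) ≠ 0 → j ≤ i}

/-- The standard module `Δ(i)`. -/
def standardMod (e : Fin n → A) (i : Fin n) : ModuleCat.{u} A :=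
  ModuleCat.of A (projMod e i ⧸ standardKer e i)

/-- The kernel of `Δ(i) → Δ̄(i)`: the smallest submodule `V` of `Δ(i)` such that
`[Δ(i)/V : S(i)] = 1`.  (These `V` are closed under intersections.) -/
def properStandardKer (e : Fin n → A) (i : Fin n) : Submodule A (standardMod e i) :=
  sInf {V | jhMult A (standardMod e i ⧸ V) (simpleMod e i) = 1}

/-- The properly standard module `Δ̄(i)`. -/
def properStandardMod (e : Fin n → A) (i : Fin n) : ModuleCat.{u} A :=
  ModuleCat.of A (standardMod e i ⧸ properStandardKer e i)

/-- `X` has a `{Θ j | j ∈ J}`-filtration: a chain `0 = F m ⊆ ⋯ ⊆ F 0 = X` of submodules whose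
successive factors are isomorphic to modules `Θ j` with `j ∈ J`. -/
def HasFiltration (Θ : Fin n → ModuleCat.{u} A) (J : Set (Fin n)) (X : ModuleCat.{u} A) : Prop :=
  ∃ (m : ℕ) (F : Fin (m + 1) → Submodule A X), F 0 = ⊤ ∧ F (Fin.last m) = ⊥ ∧
    ∀ k : Fin m, F k.succ ≤ F k.castSucc ∧
      ∃ j ∈ J, Nonempty ((F k.castSucc ⧸ (F k.succ).submoduleOf (F k.castSucc)) ≃ₗ[A] Θ j)

/-- The category `F(Δ̄)`: the full subcategory of the finitely generated `A`-modules with a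
`Δ̄`-filtration. -/
abbrev FiltCat (e : Fin n → A) :=
  ObjectProperty.FullSubcategory fun X : ModuleCat.{u} A =>
    Module.Finite A X ∧ HasFiltration (properStandardMod e) Set.univ X

/-- The algebra `A`, with its simple modules ordered as `S(1), …, S(n)` by means of `e`, is a
`Δ̄`-filtered algebra. -/
structure IsProperlyFiltered (K : Type v) [Field K] [Algebra K A] (e : Fin n → A) : Prop where
  finiteDimensional : FiniteDimensional K A
  isBasicSystem : IsBasicSystem e
  filtration : ∀ i, HasFiltration (properStandardMod e) (Set.Ici i) (projMod e i)

/-- The radical `rad(X, Y)` of the module category: all `f : X → Y` such that `1 - g f` is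
invertible for every `g : Y → X`. -/
def radHom (X Y : ModuleCat.{u} A) : Set (X →ₗ[A] Y) :=
  {f | ∀ g : Y →ₗ[A] X, IsUnit ((1 : Module.End A X) - g ∘ₗ f)}

/-- `rad(P(i), P(j)) = 0` for `i < j`. -/
def IsOneCyclicAlgebra (e : Fin n → A) : Prop :=
  ∀ i j, i < j → radHom (projMod e i) (projMod e j) = {0}

end Algebras

/-! ### Induction along a ring homomorphism -/

section Induction

variable {B A : Type u} [Ring B] [Ring A]

/-- `A` as an `A`-`B`-bimodule, where `B` acts on the right through `φ : B → A`. -/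
def RightRestrict (_φ : B →+* A) : Type u := A

namespace RightRestrict

variable (φ : B →+* A)

instance : AddCommGroup (RightRestrict φ) := inferInstanceAs (AddCommGroup A)

instance : Module A (RightRestrict φ) := inferInstanceAs (Module A A)

/-- The right action `a b = a φ(b)`. -/
instance : Module Bᵐᵒᵖ (RightRestrict φ) := Module.compHom A (RingHom.op φ)

instance : SMulCommClass A Bᵐᵒᵖ (RightRestrict φ) where
  smul_comm a b x := (mul_assoc (a : A) (x : A) (φ b.unop)).symm

end RightRestrict

/-- The functor `A ⊗_B - : Mod B → Mod A`. -/
def inductionFunctor (φ : B →+* A) : ModuleCat.{u} B ⥤ ModuleCat.{u} A where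
  obj X := ModuleCat.of A (BTensor B (RightRestrict φ) X)
  map f := ModuleCat.ofHom (BTensor.lmap A (RightRestrict φ) f.hom)
  map_id _ := ModuleCat.hom_ext (BTensor.linearMap_ext fun _ _ => rfl)
  map_comp _ _ := ModuleCat.hom_ext (BTensor.linearMap_ext fun _ _ => rfl)

instance (φ : B →+* A) : (inductionFunctor φ).Additive where
  map_add {_ _ f g} := ModuleCat.hom_ext (BTensor.linearMap_ext (fun m x =>
    BTensor.tmul_add m (f.hom x) (g.hom x)))

variable {K : Type v} [Field K] [Algebra K B] [Algebra K A] {n : ℕ}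

/-- `B`, embedded into the `Δ̄`-filtered algebra `A` by `φ`, is a proper Borel subalgebra.
Here `P_B(i) = B eᵢ`, and `f` orders the simple `A`-modules. -/
structure IsProperBorel (e : Fin n → B) (f : Fin n → A) (φ : B →ₐ[K] A) : Prop where
  injective : Function.Injective φ
  oneCyclic : IsOneCyclicAlgebra e
  leftExact : Limits.PreservesFiniteLimits (inductionFunctor (φ : B →+* A))
  rightExact : Limits.PreservesFiniteColimits (inductionFunctor (φ : B →+* A))
  properStandard : ∀ i, Nonempty
    (properStandardMod f i ≅ (inductionFunctor (φ : B →+* A)).obj (simpleMod e i))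

/-- `B`, embedded into `A` by `φ` such that `A ⊗_B -` is exact, is homological: for all finitely
generated `B`-modules the natural maps `Extᵏ_B(X, Y) → Extᵏ_A(A ⊗_B X, A ⊗_B Y)` are surjective for
`k ≥ 1` and bijective for `k ≥ 2`. -/
def IsHomological (φ : B →ₐ[K] A) : Prop :=
  ∃ (_ : Limits.PreservesFiniteLimits (inductionFunctor (φ : B →+* A)))
    (_ : Limits.PreservesFiniteColimits (inductionFunctor (φ : B →+* A))),
    ∀ X Y : ModuleCat.{u} B, Module.Finite B X → Module.Finite B Y →
      (∀ k, 1 ≤ k → Function.Surjective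
        ((inductionFunctor (φ : B →+* A)).mapExtAddHom X Y k)) ∧
      (∀ k, 2 ≤ k → Function.Bijective
        ((inductionFunctor (φ : B →+* A)).mapExtAddHom X Y k))

end Induction

/-! ### Bocses -/

/-- A bocs `(B, W, ε, μ)` over `K`: a `B`-bimodule `W` on which `K` acts centrally, with a
surjective `B`-bilinear counit and a coassociative, counital, `B`-bilinear comultiplication. -/
structure Bocs (K : Type v) [Field K] (B : Type u) [Ring B] [Algebra K B] (W : Type u)
    [AddCommGroup W] [Module K W] [Module B W] [Module Bᵐᵒᵖ W] [SMulCommClass B Bᵐᵒᵖ W]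
    [IsScalarTower K B W] [IsScalarTower K Bᵐᵒᵖ W] where
  /-- The counit `ε`. -/
  counit : W →+ B
  counit_smul : ∀ (b : B) w, counit (b • w) = b * counit w
  counit_op_smul : ∀ (b : B) w, counit (op b • w) = counit w * b
  counit_surjective : Function.Surjective counit
  /-- The comultiplication `μ`. -/
  comul : W →+ BTensor B W W
  comul_smul : ∀ (b : B) w, comul (b • w) = b • comul w
  comul_op_smul : ∀ (b : B) w, comul (op b • w) = op b • comul w
  coassoc : ∀ w,
    BTensor.map (AddMonoidHom.id W) (fun _ _ => rfl) comul comul_smul (comul w) =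
      BTensor.assoc
        (BTensor.map comul comul_op_smul (AddMonoidHom.id W) (fun _ _ => rfl) (comul w))
  counit_comul : ∀ w, BTensor.lid B W
    (BTensor.map counit counit_op_smul (AddMonoidHom.id W) (fun _ _ => rfl) (comul w)) = w
  comul_counit : ∀ w, BTensor.rid B W
    (BTensor.map (AddMonoidHom.id W) (fun _ _ => rfl) counit counit_smul (comul w)) = w

namespace Bocs

variable {K : Type v} [Field K] {B : Type u} [Ring B] [Algebra K B] {W : Type u}
  [AddCommGroup W] [Module K W] [Module B W] [Module Bᵐᵒᵖ W] [SMulCommClass B Bᵐᵒᵖ W]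
  [IsScalarTower K B W] [IsScalarTower K Bᵐᵒᵖ W] (𝓑 : Bocs K B W)

/-- The kernel `W̄` of the counit, as a left `B`-module. -/
def kernel : Submodule B W where
  carrier := {w | 𝓑.counit w = 0}
  zero_mem' := map_zero _
  add_mem' {w w'} hw hw' := by
    change 𝓑.counit (w + w') = 0
    rw [map_add, hw, hw', add_zero]
  smul_mem' b w hw := by
    change 𝓑.counit (b • w) = 0
    rw [counit_smul, hw, mul_zero]

/-- The right action of `B` on `W̄`. -/
def kernelRightMul (b : B) (w : 𝓑.kernel) : 𝓑.kernel :=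
  ⟨op b • (w : W), by
    change 𝓑.counit (op b • (w : W)) = 0
    rw [counit_op_smul, show 𝓑.counit (w : W) = 0 from w.2, zero_mul]⟩

/-- The right ideal `a B`. -/
abbrev rightIdeal (a : B) : Submodule Bᵐᵒᵖ B := Submodule.span Bᵐᵒᵖ {a}

/-- The bocs `(B, W)` is one-cyclic directed with respect to `P_B(i) = B eᵢ`: `B` is basic with
`1 = e₁ + ⋯ + eₙ`, `rad(P_B(i), P_B(j)) = 0` for `i < j`, and `W̄` is isomorphic as a `B`-bimodule to
the direct sum over `i > j` of `d i j` copies of `B eᵢ ⊗_K eⱼ B` (so it is a projective bimodule). -/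
structure IsOneCyclicDirected {n : ℕ} (e : Fin n → B) : Prop where
  isBasicSystem : IsBasicSystem e
  sum_eq_one : ∑ i, e i = 1
  oneCyclic : IsOneCyclicAlgebra e
  kernel_iso : ∃ (d : Fin n → Fin n → ℕ)
    (θ : 𝓑.kernel ≃ₗ[B] ((p : {p : Fin n × Fin n // p.2 < p.1}) → Fin (d p.1.1 p.1.2) →
      (leftIdeal (e p.1.1) ⊗[K] rightIdeal (e p.1.2)))),
    ∀ (b : B) (w : 𝓑.kernel) p k, θ (𝓑.kernelRightMul b w) p k =
      LinearMap.lTensor (leftIdeal (e p.1.1))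
        (DistribSMul.toLinearMap K (rightIdeal (e p.1.2)) (op b)) (θ w p k)

section Morphisms

variable {X Y Z T : Type u} [AddCommGroup X] [Module B X] [AddCommGroup Y] [Module B Y]
  [AddCommGroup Z] [Module B Z] [AddCommGroup T] [Module B T]

/-- The unit morphism of `X`: the composite `W ⊗ X → B ⊗ X → X`. -/
def unitHom (X : Type u) [AddCommGroup X] [Module B X] : BTensor B W X →ₗ[B] X where
  toFun t := BTensor.lid B X
    (BTensor.map 𝓑.counit 𝓑.counit_op_smul (AddMonoidHom.id X) (fun _ _ => rfl) t)
  map_add' := by simp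
  map_smul' b t := by
    induction t using BTensor.induction with
    | zero => simp
    | tmul w x => simp [counit_smul, mul_smul]
    | add s t hs ht => simp only [smul_add, map_add, hs, ht]

@[simp]
theorem unitHom_tmul (w : W) (x : X) :
    𝓑.unitHom X (BTensor.tmul B w x) = 𝓑.counit w • x := rfl

/-- The composite `g f`, that is `W ⊗ X → W ⊗ W ⊗ X → W ⊗ Y → Z`. -/
def compHom (f : BTensor B W X →ₗ[B] Y) (g : BTensor B W Y →ₗ[B] Z) : BTensor B W X →ₗ[B] Z where
  toFun t := g (BTensor.lmap B W f (BTensor.assoc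
      (BTensor.map 𝓑.comul 𝓑.comul_op_smul (AddMonoidHom.id X) (fun _ _ => rfl) t)))
  map_add' := by simp
  map_smul' b t := by
    induction t using BTensor.induction with
    | zero => simp
    | tmul w x =>
      simp only [BTensor.smul_tmul, BTensor.map_tmul, comul_smul, AddMonoidHom.id_apply,
        RingHom.id_apply]
      generalize 𝓑.comul w = s
      induction s using BTensor.induction with
      | zero =>
        have : BTensor.tmul B (0 : BTensor B W W) x = 0 := by
          simpa using BTensor.add_tmul (B := B) (0 : BTensor B W W) 0 x
        simp [this]
      | tmul w w' => simp [← map_smul]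
      | add s t hs ht => simp only [smul_add, BTensor.add_tmul, map_add, hs, ht]
    | add s t hs ht => simp only [smul_add, map_add, hs, ht]

/-- The map `a ⊗ b ↦ g (a ⊗ f (b ⊗ x))` on `W ⊗ W`. -/
def pairing (f : BTensor B W X →ₗ[B] Y) (g : BTensor B W Y →ₗ[B] Z) (x : X) :
    BTensor B W W →+ Z :=
  BTensor.lift (BTensor.biadd (fun a b => g (BTensor.tmul B a (f (BTensor.tmul B b x))))
    (fun a a' b => by rw [BTensor.add_tmul, map_add])
    (fun a b b' => by rw [BTensor.add_tmul, map_add, BTensor.tmul_add, map_add]))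
    (fun b a a' => by
      simp only [BTensor.biadd_apply, BTensor.op_smul_tmul]
      rw [← BTensor.smul_tmul, map_smul])

theorem compHom_tmul (f : BTensor B W X →ₗ[B] Y) (g : BTensor B W Y →ₗ[B] Z) (w : W) (x : X) :
    𝓑.compHom f g (BTensor.tmul B w x) = pairing f g x (𝓑.comul w) := by
  change g (BTensor.lmap B W f (BTensor.assoc (BTensor.tmul B (𝓑.comul w) x))) = _
  generalize 𝓑.comul w = s
  induction s using BTensor.induction with
  | zero =>
    have : BTensor.tmul B (0 : BTensor B W W) x = 0 := by
      simpa using BTensor.add_tmul (B := B) (0 : BTensor B W W) 0 x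
    simp [this]
  | tmul w w' => rfl
  | add s t hs ht => simp only [BTensor.add_tmul, map_add, hs, ht]

theorem unitHom_compHom (f : BTensor B W X →ₗ[B] Y) : 𝓑.compHom (𝓑.unitHom X) f = f := by
  refine BTensor.linearMap_ext fun w x => ?_
  rw [compHom_tmul]
  conv_rhs => rw [← 𝓑.comul_counit w]
  generalize 𝓑.comul w = s
  induction s using BTensor.induction with
  | zero => 
    have : BTensor.tmul B (0 : W) x = 0 := by
      simpa using BTensor.add_tmul (B := B) (0 : W) 0 x
    simp [this]
  | tmul w w' => simp [pairing, BTensor.op_smul_tmul]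
  | add s t hs ht => simp only [BTensor.add_tmul, map_add, hs, ht]

theorem compHom_unitHom (f : BTensor B W X →ₗ[B] Y) : 𝓑.compHom f (𝓑.unitHom Y) = f := by
  refine BTensor.linearMap_ext fun w x => ?_
  rw [compHom_tmul]
  conv_rhs => rw [← 𝓑.counit_comul w]
  generalize 𝓑.comul w = s
  induction s using BTensor.induction with
  | zero => 
    have : BTensor.tmul B (0 : W) x = 0 := by
      simpa using BTensor.add_tmul (B := B) (0 : W) 0 x
    simp [this]
  | tmul w w' =>
    change 𝓑.counit w • f (BTensor.tmul B w' x) = f (BTensor.tmul B (𝓑.counit w • w') x)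
    rw [← map_smul, BTensor.smul_tmul]
  | add s t hs ht => simp only [BTensor.add_tmul, map_add, hs, ht]

/-- The map `a ⊗ (b ⊗ c) ↦ h (a ⊗ g (b ⊗ f (c ⊗ x)))` on `W ⊗ (W ⊗ W)`. -/
def pairing₃ (f : BTensor B W X →ₗ[B] Y) (g : BTensor B W Y →ₗ[B] Z) (h : BTensor B W Z →ₗ[B] T)
    (x : X) : BTensor B W (BTensor B W W) →+ T :=
  h.toAddMonoidHom.comp (BTensor.map (AddMonoidHom.id W) (fun _ _ => rfl) (pairing f g x)
    (fun b t => by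
      induction t using BTensor.induction with
      | zero => simp
      | tmul w w' => 
        simp only [BTensor.smul_tmul, pairing, BTensor.lift_tmul, BTensor.biadd_apply]
        rw [← BTensor.smul_tmul, map_smul]
      | add s t hs ht => simp only [smul_add, map_add, hs, ht]))

theorem compHom_assoc (f : BTensor B W X →ₗ[B] Y) (g : BTensor B W Y →ₗ[B] Z)
    (h : BTensor B W Z →ₗ[B] T) :
    𝓑.compHom (𝓑.compHom f g) h = 𝓑.compHom f (𝓑.compHom g h) := by
  refine BTensor.linearMap_ext fun w x => ?_
  rw [compHom_tmul, compHom_tmul]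
  trans pairing₃ f g h x
    (BTensor.map (AddMonoidHom.id W) (fun _ _ => rfl) 𝓑.comul 𝓑.comul_smul (𝓑.comul w))
  · generalize 𝓑.comul w = s
    induction s using BTensor.induction with
    | zero => simp
    | tmul a b =>
      change h (BTensor.tmul B a (𝓑.compHom f g (BTensor.tmul B b x))) =
        h (BTensor.tmul B a (pairing f g x (𝓑.comul b)))
      rw [compHom_tmul]
    | add s t hs ht => simp only [map_add, hs, ht]
  · rw [coassoc]
    generalize 𝓑.comul w = s
    induction s using BTensor.induction with
    | zero => simp
    | tmul a b =>
      change _ = 𝓑.compHom g h (BTensor.tmul B a (f (BTensor.tmul B b x)))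
      rw [compHom_tmul, BTensor.map_tmul]
      generalize 𝓑.comul a = s
      induction s using BTensor.induction with
      | zero => 
        have : BTensor.tmul B (0 : BTensor B W W) b = 0 := by
          simpa using BTensor.add_tmul (B := B) (0 : BTensor B W W) 0 b
        simp [this]
      | tmul a b => rfl
      | add s t hs ht => simp only [BTensor.add_tmul, map_add] at hs ht ⊢; rw [hs, ht]
    | add s t hs ht => simp only [map_add, hs, ht]

theorem add_compHom (f f' : BTensor B W X →ₗ[B] Y) (g : BTensor B W Y →ₗ[B] Z) :
    𝓑.compHom (f + f') g = 𝓑.compHom f g + 𝓑.compHom f' g := by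
  refine BTensor.linearMap_ext fun w x => ?_
  rw [LinearMap.add_apply, compHom_tmul, compHom_tmul, compHom_tmul]
  generalize 𝓑.comul w = s
  induction s using BTensor.induction with
  | zero => simp
  | tmul a b => simp [pairing, BTensor.tmul_add]
  | add s t hs ht => simp only [map_add, hs, ht]; abel

theorem smul_compHom [Module K Y] [IsScalarTower K B Y] [Module K Z] [IsScalarTower K B Z]
    (k : K) (f : BTensor B W X →ₗ[B] Y) (g : BTensor B W Y →ₗ[B] Z) :
    𝓑.compHom (k • f) g = k • 𝓑.compHom f g := by
  refine BTensor.linearMap_ext fun w x => ?_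
  rw [LinearMap.smul_apply, compHom_tmul, compHom_tmul]
  generalize 𝓑.comul w = s
  induction s using BTensor.induction with
  | zero => simp
  | tmul a b =>
    simp only [pairing, BTensor.lift_tmul, BTensor.biadd_apply, LinearMap.smul_apply]
    rw [← algebraMap_smul B k (f _), ← BTensor.op_smul_tmul, ← algebraMap_smul B k (g _),
      ← map_smul, BTensor.smul_tmul, algebraMap_smul,
      show op (algebraMap K B k) = algebraMap K Bᵐᵒᵖ k from rfl, algebraMap_smul]
  | add s t hs ht => simp only [map_add, hs, ht, smul_add]

end Morphisms

/-- The map `W ⊗ B → B`, `w ⊗ x ↦ ε(w) x b`: right multiplication by `b`, viewed as an endomorphism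
of `B` in the category `mod 𝓑`. -/
def rightMulHom (b : B) : BTensor B W B →ₗ[B] B :=
  LinearMap.toSpanSingleton B B b ∘ₗ 𝓑.unitHom B

theorem rightMulHom_tmul (b : B) (w : W) (x : B) :
    𝓑.rightMulHom b (BTensor.tmul B w x) = 𝓑.counit w * x * b := rfl

theorem rightMulHom_one : 𝓑.rightMulHom 1 = 𝓑.unitHom B :=
  BTensor.linearMap_ext fun w x => by rw [rightMulHom_tmul, mul_one]; rfl

theorem rightMulHom_mul (b b' : B) :
    𝓑.rightMulHom (b * b') = 𝓑.compHom (𝓑.rightMulHom b) (𝓑.rightMulHom b') :=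
  BTensor.linearMap_ext fun w x => by
    rw [rightMulHom_tmul, compHom_tmul]
    conv_lhs => rw [← 𝓑.comul_counit w]
    generalize 𝓑.comul w = s
    induction s using BTensor.induction with
    | zero => simp
    | tmul u v =>
      simp only [BTensor.map_tmul, AddMonoidHom.id_apply, BTensor.rid_tmul, counit_op_smul]
      change _ = 𝓑.counit u * (𝓑.counit v * x * b) * b'
      simp only [mul_assoc]
    | add s t hs ht => simp only [map_add, add_mul] at hs ht ⊢; rw [hs, ht]

theorem rightMulHom_zero : 𝓑.rightMulHom 0 = 0 :=
  BTensor.linearMap_ext fun w x => by rw [rightMulHom_tmul, mul_zero]; rfl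

theorem rightMulHom_add (b b' : B) :
    𝓑.rightMulHom (b + b') = 𝓑.rightMulHom b + 𝓑.rightMulHom b' :=
  BTensor.linearMap_ext fun w x => by rw [rightMulHom_tmul, mul_add]; rfl

theorem rightMulHom_algebraMap (k : K) (w : W) (x : B) :
    𝓑.rightMulHom (algebraMap K B k) (BTensor.tmul B w x) =
      algebraMap K B k • 𝓑.unitHom B (BTensor.tmul B w x) := by
  rw [rightMulHom_tmul, ← Algebra.commutes]; rfl

end Bocs

/-- An object of the category `mod 𝓑` of a bocs `𝓑 = (B, W)`: a finite-dimensional left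
`B`-module (for finite-dimensional `B` this is the same as a finitely generated one). -/
structure BocsMod {K : Type v} [Field K] {B : Type u} [Ring B] [Algebra K B] {W : Type u}
    [AddCommGroup W] [Module K W] [Module B W] [Module Bᵐᵒᵖ W] [SMulCommClass B Bᵐᵒᵖ W]
    [IsScalarTower K B W] [IsScalarTower K Bᵐᵒᵖ W] (𝓑 : Bocs K B W) where
  /-- The underlying `B`-module. -/
  obj : ModuleCat.{u} B
  finite : Module.Finite B obj

namespace BocsMod

variable {K : Type v} [Field K] {B : Type u} [Ring B] [Algebra K B] {W : Type u}
  [AddCommGroup W] [Module K W] [Module B W] [Module Bᵐᵒᵖ W] [SMulCommClass B Bᵐᵒᵖ W]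
  [IsScalarTower K B W] [IsScalarTower K Bᵐᵒᵖ W] (𝓑 : Bocs K B W)

/-- The category `mod 𝓑`, with `Hom(X, Y) = Hom_B(W ⊗_B X, Y)`. -/
instance : Category.{u} (BocsMod 𝓑) where
  Hom X Y := BTensor B W X.obj →ₗ[B] Y.obj
  id X := 𝓑.unitHom X.obj
  comp f g := 𝓑.compHom f g
  id_comp f := 𝓑.unitHom_compHom f
  comp_id f := 𝓑.compHom_unitHom f
  assoc f g h := 𝓑.compHom_assoc f g h

instance : Preadditive (BocsMod 𝓑) where
  homGroup X Y := inferInstanceAs (AddCommGroup (BTensor B W X.obj →ₗ[B] Y.obj))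
  add_comp _ _ _ f f' g := 𝓑.add_compHom f f' g
  comp_add _ _ _ _ _ _ := rfl

open scoped ModuleCat in
instance : Linear K (BocsMod 𝓑) where
  homModule X Y := inferInstanceAs (Module K (BTensor B W X.obj →ₗ[B] Y.obj))
  smul_comp _ _ _ k f g := 𝓑.smul_compHom k f g
  comp_smul _ _ _ _ _ _ := rfl

/-- The regular module `B` as an object of `mod 𝓑`. -/
def regular : BocsMod 𝓑 := ⟨ModuleCat.of B B, inferInstanceAs (Module.Finite B B)⟩

end BocsMod

namespace Bocs

variable {K : Type v} [Field K] {B : Type u} [Ring B] [Algebra K B] {W : Type u}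
  [AddCommGroup W] [Module K W] [Module B W] [Module Bᵐᵒᵖ W] [SMulCommClass B Bᵐᵒᵖ W]
  [IsScalarTower K B W] [IsScalarTower K Bᵐᵒᵖ W] (𝓑 : Bocs K B W)

/-- The right Burt-Butler algebra `R = End_𝓑(B)ᵒᵖ`.  (In `End` the product of `g` and `f` is the
composite `g f`.) -/
def RightBurtButler : Type u := (End (BocsMod.regular 𝓑))ᵐᵒᵖ

instance : Ring 𝓑.RightBurtButler := inferInstanceAs (Ring (End (BocsMod.regular 𝓑))ᵐᵒᵖ)

instance : Algebra K 𝓑.RightBurtButler :=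
  inferInstanceAs (Algebra K (End (BocsMod.regular 𝓑))ᵐᵒᵖ)

/-- The canonical embedding of `B` into `R`. -/
def toRightBurtButler : B →ₐ[K] 𝓑.RightBurtButler where
  toFun b := op (𝓑.rightMulHom b : BocsMod.regular 𝓑 ⟶ BocsMod.regular 𝓑)
  map_one' := congrArg op 𝓑.rightMulHom_one
  map_mul' b b' := congrArg op (𝓑.rightMulHom_mul b b')
  map_zero' := congrArg op 𝓑.rightMulHom_zero
  map_add' b b' := congrArg op (𝓑.rightMulHom_add b b')
  commutes' k := congrArg op (BTensor.linearMap_ext (𝓑.rightMulHom_algebraMap k))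

end Bocs

end

noncomputable section

/-! ### Primitive idempotents of a finite-dimensional algebra and their local corner rings -/

section PrimitiveIdempotents

variable {A : Type u} [Ring A]

/-! Write W̄ for the kernel of the counit. As left modules W ≅ W̄ ⊕ B, so W is finitely generated
projective, and a dual basis identifies R ⊗_B X with Hom_𝓑(B, X) ≅ Hom_B(W, X)
(`indToHom_bijective`). Restriction to W̄ then gives an exact sequence 0 → X → R ⊗_B X → Hom_B(W̄,
X) → 0 of B-modules. Since W̄ is a sum of bimodules B e_i ⊗_K e_j B with i > j, two things follow:
the cokernel Hom_B(W̄, X) is injective (`injective_kernelHom`), and for X supported in vertices up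
to c the e_c-part of R ⊗_B X is just e_c X. These facts, with exactness of induction, are collected
in `IsDirectedExtension`; apart from the bocs category itself, all claims are proved for any such
extension B → A.

Simple modules and proper standard modules: the e_i-part of A ⊗ S(i) is a line, so some primitive
summand f_i of e_i in A fixes its generator. On modules supported up to i, f_i and e_i act alike
(`smul_eq_map_smul`), and descending inductions on the vertex show that the f_i represent all
indecomposable projectives. Because multiplicities are dimensions of corner spaces
(`jhMult_eq_finrank`), A ⊗ S(i) is the largest quotient of A f_i with the properties that define the
proper standard module.

Filtrations: induction sends composition series to filtrations by the A ⊗ S(j). The projective A f_i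
is only a direct summand of A ⊗ B e_i, so summands of induced modules must be treated too, by
peeling off the highest vertex (`hasFiltration_of_retract`). Conversely, injectivity of the cokernel
of the unit shows that extensions of induced modules are induced (`exists_ind_equiv_of_exact`),
hence so is every filtered module.

Homologicality is formal: for an exact left adjoint whose unit is monic with injective cokernel, a
map between induced objects out of a subobject of a projective comes from below up to maps that
extend over the projective; dimension shifting does the rest. Finally Hom_𝓑(B, -) is fully faithful
on mod 𝓑, and its values are, up to isomorphism, the induced modules, that is, the filtered ones. -/

theorem mem_leftIdeal_iff {f : A} (hf : IsIdempotentElem f) {x : A} :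
    x ∈ leftIdeal f ↔ x * f = x := by
  rw [Ideal.mem_span_singleton']
  constructor
  · rintro ⟨a, rfl⟩
    rw [mul_assoc, hf.eq]
  · intro h
    exact ⟨x, h⟩

theorem self_mem_leftIdeal (f : A) : f ∈ leftIdeal f := Ideal.mem_span_singleton_self f

/-- The generator of `A f`. -/
def leftIdealGen (f : A) : leftIdeal f := ⟨f, self_mem_leftIdeal f⟩

theorem smul_leftIdealGen {f : A} (hf : IsIdempotentElem f) (x : leftIdeal f) :
    (x : A) • leftIdealGen f = x :=
  Subtype.ext ((mem_leftIdeal_iff hf).1 x.2)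

theorem leftIdeal_map_apply {f : A} (hf : IsIdempotentElem f) {M : Type u₁} [AddCommGroup M]
    [Module A M] (h : leftIdeal f →ₗ[A] M) (x : leftIdeal f) :
    h x = (x : A) • h (leftIdealGen f) := by
  rw [← map_smul, smul_leftIdealGen hf]

theorem smul_map_leftIdealGen {f : A} (hf : IsIdempotentElem f) {M : Type u₁} [AddCommGroup M]
    [Module A M] (h : leftIdeal f →ₗ[A] M) : f • h (leftIdealGen f) = h (leftIdealGen f) :=
  (leftIdeal_map_apply hf h (leftIdealGen f)).symm

/-- The map `A f → M`, `a ↦ a x`. -/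
def leftIdealLift (f : A) {M : Type u₁} [AddCommGroup M] [Module A M] (x : M) :
    leftIdeal f →ₗ[A] M :=
  (LinearMap.toSpanSingleton A M x).domRestrict (leftIdeal f)

@[simp]
theorem leftIdealLift_apply (f : A) {M : Type u₁} [AddCommGroup M] [Module A M] (x : M)
    (a : leftIdeal f) : leftIdealLift f x a = (a : A) • x := rfl

theorem eq_top_of_leftIdealGen_mem {f : A} (hf : IsIdempotentElem f)
    {U : Submodule A (leftIdeal f)} (h : leftIdealGen f ∈ U) : U = ⊤ := by
  refine eq_top_iff.2 fun x _ => ?_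
  rw [← smul_leftIdealGen hf x]
  exact U.smul_mem _ h

theorem leftIdeal_equiv {f g x y : A} (hf : IsIdempotentElem f) (hg : IsIdempotentElem g)
    (hx : x * g = x) (hy : y * f = y) (hxy : f * (x * y) = f) (hyx : g * (y * x) = g) :
    Nonempty (leftIdeal f ≃ₗ[A] leftIdeal g) := by
  refine ⟨LinearEquiv.ofLinearMap
    (leftIdealLift f (⟨x, (mem_leftIdeal_iff hg).2 hx⟩ : leftIdeal g))
    (leftIdealLift g (⟨y, (mem_leftIdeal_iff hf).2 hy⟩ : leftIdeal f)) ?_ ?_⟩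
  · ext a
    have := (mem_leftIdeal_iff hg).1 a.2
    change (a : A) * y * x = a
    rw [← this, mul_assoc, mul_assoc, hyx]
  · ext a
    have := (mem_leftIdeal_iff hf).1 a.2
    change (a : A) * x * y = a
    rw [← this, mul_assoc, mul_assoc, hxy]

variable {K : Type v} [Field K] [Algebra K A] [FiniteDimensional K A]

omit [FiniteDimensional K A] in
theorem commute_aeval {f x : A} (h : Commute f x) (p : Polynomial K) :
    Commute f (Polynomial.aeval x p) := by
  induction p using Polynomial.induction_on' with
  | add p q hp hq => rw [map_add]; exact hp.add_right hq
  | monomial n a =>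
    rw [Polynomial.aeval_monomial]
    exact Commute.mul_right (Algebra.commutes a f).symm (h.pow_right n)

/-- An element of the corner ring `f A f` of a primitive idempotent `f` is nilpotent or a unit. -/
theorem IsPrimitiveIdempotent.isNilpotent_or_exists_inv (K : Type v) [Field K] [Algebra K A]
    [FiniteDimensional K A] {f : A} (hf : IsPrimitiveIdempotent f)
    {x : A} (hx : f * x = x) (hx' : x * f = x) :
    IsNilpotent x ∨ ∃ y, f * y = y ∧ y * f = y ∧ y * x = f ∧ x * y = f := by
  -- Fitting splitting: an annihilating polynomial of x is X^n q with X not dividing q. A Bézout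
  -- identity between X^(n+1) and q gives complementary idempotents E and E', polynomials in x and
  -- so commuting with f; primitivity kills f E or f E'. The exponent n + 1 instead of n makes E a
  -- multiple of x even when n = 0.
  obtain ⟨p, hp, hpx⟩ : ∃ p : Polynomial K, p ≠ 0 ∧ Polynomial.aeval x p = 0 :=
    (Algebra.IsAlgebraic.isAlgebraic (R := K) x)
  obtain ⟨q, hpq, hq⟩ := Polynomial.exists_eq_pow_rootMultiplicity_mul_and_not_dvd p hp 0
  set n := Polynomial.rootMultiplicity 0 p
  rw [Polynomial.C_0, sub_zero] at hpq hq
  obtain ⟨a, b, hab⟩ : IsCoprime (Polynomial.X ^ (n + 1)) q :=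
    ((Polynomial.irreducible_X.coprime_iff_not_dvd).2 hq).pow_left
  have hfx : Commute f x := hx.trans hx'.symm
  set E := Polynomial.aeval x (a * Polynomial.X ^ (n + 1)) with hE
  set E' := Polynomial.aeval x (b * q) with hE'
  have hsum : E + E' = 1 := by rw [hE, hE', ← map_add, hab, map_one]
  have hEE' : E * E' = 0 := by
    rw [hE, hE', ← map_mul, show a * Polynomial.X ^ (n + 1) * (b * q) =
      a * Polynomial.X * b * (Polynomial.X ^ n * q) by ring, ← hpq, map_mul, hpx, mul_zero]
  have hE'E : E' * E = 0 := by
    rw [hE, hE', ← map_mul, mul_comm, map_mul]; exact hEE'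
  have hxE' : x ^ (n + 1) * E' = 0 := by
    rw [hE', show x ^ (n + 1) = Polynomial.aeval x (Polynomial.X ^ (n + 1) : Polynomial K) by simp,
      ← map_mul, show Polynomial.X ^ (n + 1) * (b * q) =
      Polynomial.X * b * (Polynomial.X ^ n * q) by ring, ← hpq, map_mul, hpx, mul_zero]
  have hfE : Commute f E := commute_aeval hfx _
  have hfE' : Commute f E' := commute_aeval hfx _
  have hff : f * f = f := hf.1
  have hEi : E * E = E := by
    have : E * (E + E') = E := by rw [hsum, mul_one]
    rwa [mul_add, hEE', add_zero] at this
  have hE'i : E' * E' = E' := by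
    have : E' * (E + E') = E' := by rw [hsum, mul_one]
    rwa [mul_add, hE'E, zero_add] at this
  have idem : ∀ a b : A, Commute f a → f * a * (f * b) = f * (a * b) := fun a b h => by
    rw [h.eq, mul_assoc, ← mul_assoc f f, hff, ← mul_assoc, ← h.eq, mul_assoc]
  rcases hf.2.2 (f * E) (f * E') (by rw [IsIdempotentElem, idem _ _ hfE, hEi])
    (by rw [IsIdempotentElem, idem _ _ hfE', hE'i]) (by rw [idem _ _ hfE, hEE', mul_zero])
    (by rw [idem _ _ hfE', hE'E, mul_zero]) (by rw [← mul_add, hsum, mul_one]) with h | h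
  · left
    refine ⟨n + 1, ?_⟩
    have h1 : f * E' = f := by
      have : f * (E + E') = f := by rw [hsum, mul_one]
      rwa [mul_add, h, zero_add] at this
    calc x ^ (n + 1) = x ^ (n + 1) * f := by rw [pow_succ, mul_assoc, hx']
      _ = x ^ (n + 1) * E' * f := by rw [← h1, mul_assoc, hfE'.eq, ← mul_assoc E', hE'i]
      _ = 0 := by rw [hxE', zero_mul]
  · right
    have h1 : f * E = f := by
      have : f * (E + E') = f := by rw [hsum, mul_one]
      rwa [mul_add, h, add_zero] at this
    have hE2 : E = Polynomial.aeval x (a * Polynomial.X ^ n) * x := by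
      rw [hE, pow_succ, ← mul_assoc, map_mul, Polynomial.aeval_X]
    have hE3 : E = x * Polynomial.aeval x (a * Polynomial.X ^ n) := by
      rw [hE, pow_succ', mul_left_comm, map_mul, Polynomial.aeval_X]
    set y := Polynomial.aeval x (a * Polynomial.X ^ n)
    refine ⟨f * y * f, by simp only [← mul_assoc, hff], by rw [mul_assoc, hff], ?_, ?_⟩
    · rw [mul_assoc, hx, mul_assoc, ← hE2, h1]
    · rw [← mul_assoc, ← mul_assoc, hx', ← hE3, ← hfE.eq, h1]

theorem not_isNilpotent_of_isIdempotentElem {f : A} (hf : IsIdempotentElem f) (h : f ≠ 0) :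
    ¬ IsNilpotent f := by
  rintro ⟨m, hm⟩
  apply h
  have := hf.pow_succ_eq m
  rw [← this, pow_succ, hm, zero_mul]

/-- The product x y is invertible in f A f, say with inverse c. Then y c x is a non-zero idempotent
of g A g, and in this local ring it can only be g; so x and y c give mutually inverse maps. -/
theorem IsPrimitiveIdempotent.equiv_of_not_isNilpotent (K : Type v) [Field K] [Algebra K A]
    [FiniteDimensional K A] {f g x y : A}
    (hf : IsPrimitiveIdempotent f) (hg : IsPrimitiveIdempotent g) (hfx : f * x = x)
    (hxg : x * g = x) (hgy : g * y = y) (hyf : y * f = y) (h : ¬ IsNilpotent (x * y)) :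
    Nonempty (leftIdeal f ≃ₗ[A] leftIdeal g) := by
  rcases hf.isNilpotent_or_exists_inv K (x := x * y) (by rw [← mul_assoc, hfx])
    (by rw [mul_assoc, hyf]) with h' | ⟨c, hfc, hcf, hcx, hxc⟩
  · exact absurd h' h
  have h1 : x * (y * c) = f := by rw [← mul_assoc, hxc]
  have h2 : IsIdempotentElem (y * c * x) := by
    change y * c * x * (y * c * x) = _
    rw [mul_assoc (y * c) x, ← mul_assoc x, h1, hfx]
  have h3 : y * c * x ≠ 0 := fun h0 => hf.2.1 <| by
    have : x * (y * c * x) * (y * c) = f := by rw [← mul_assoc x, h1, hfx, h1]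
    rw [← this, h0, mul_zero, zero_mul]
  have h4 : y * c * x = g := by
    rcases hg.isNilpotent_or_exists_inv K (x := y * c * x)
      (by rw [← mul_assoc, ← mul_assoc, hgy]) (by rw [mul_assoc, hxg]) with h' | ⟨d, -, -, hd, -⟩
    · exact absurd h' (not_isNilpotent_of_isIdempotentElem h2 h3)
    · have hgx : g * (y * c * x) = y * c * x := by rw [← mul_assoc, ← mul_assoc, hgy]
      rw [← hgx]
      nth_rw 1 [← hd]
      rw [mul_assoc, h2.eq, hd]
  refine leftIdeal_equiv hf.1 hg.1 hxg (y := y * c) (by rw [mul_assoc, hcf]) ?_ ?_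
  · rw [h1, hf.1.eq]
  · rw [h4, hg.1.eq]

variable {S : Type u₁} [AddCommGroup S] [Module A S]

theorem not_isNilpotent_of_smul_eq {x : A} {s : S} (hs : s ≠ 0) (h : x • s = s) :
    ¬ IsNilpotent x := by
  rintro ⟨m, hm⟩
  have : ∀ k : ℕ, x ^ k • s = s := fun k => by
    induction k with
    | zero => simp
    | succ k ih => rw [pow_succ, mul_smul, h, ih]
  exact hs (by rw [← this m, hm, zero_smul])

variable (A) in
theorem exists_smul_eq_of_isSimpleModule [IsSimpleModule A S] {s : S} (hs : s ≠ 0) (t : S) :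
    ∃ a : A, a • s = t :=
  IsSimpleModule.toSpanSingleton_surjective A hs t

theorem IsPrimitiveIdempotent.equiv_of_isSimpleModule (K : Type v) [Field K] [Algebra K A]
    [FiniteDimensional K A] {f g : A} (hf : IsPrimitiveIdempotent f)
    (hg : IsPrimitiveIdempotent g) [IsSimpleModule A S] {s t : S} (hs : f • s ≠ 0)
    (ht : g • t ≠ 0) : Nonempty (leftIdeal f ≃ₗ[A] leftIdeal g) := by
  obtain ⟨a, ha⟩ := exists_smul_eq_of_isSimpleModule A hs (g • t)
  obtain ⟨b, hb⟩ := exists_smul_eq_of_isSimpleModule A ht (f • s)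
  have hff : f * f = f := hf.1
  have hgg : g * g = g := hg.1
  refine hf.equiv_of_not_isNilpotent K hg (x := f * b * g) (y := g * a * f)
    (by simp only [← mul_assoc, hff]) (by rw [mul_assoc, hgg]) (by simp only [← mul_assoc, hgg])
    (by rw [mul_assoc, hff]) (not_isNilpotent_of_smul_eq hs ?_)
  simp only [mul_smul]
  rw [← mul_smul f f, hff, ha, ← mul_smul g g, hgg, ← mul_smul g g, hgg, hb, ← mul_smul, hff]

/-- Two distinct maximal submodules would write f as a sum of two commuting elements of f A f. Each
is nilpotent, since an invertible one would put f into a proper submodule; then f would be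
nilpotent. -/
theorem IsPrimitiveIdempotent.eq_of_isCoatom (K : Type v) [Field K] [Algebra K A]
    [FiniteDimensional K A] {f : A} (hf : IsPrimitiveIdempotent f)
    {N₁ N₂ : Submodule A (leftIdeal f)} (h₁ : IsCoatom N₁) (h₂ : IsCoatom N₂) : N₁ = N₂ := by
  by_contra hne
  have htop : leftIdealGen f ∈ N₁ ⊔ N₂ := by
    rw [(h₁.codisjoint_of_ne h₂ hne).eq_top]; trivial
  obtain ⟨y₁, hy₁, y₂, hy₂, hy⟩ := Submodule.mem_sup.1 htop
  have hff : f * f = f := hf.1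
  have hsum : f * (y₁ : A) + f * (y₂ : A) = f := by
    rw [← mul_add]
    conv_rhs => rw [← hff]
    exact congrArg (f * ·) (congrArg Subtype.val hy)
  have key : ∀ (N : Submodule A (leftIdeal f)) (y : leftIdeal f), IsCoatom N → y ∈ N →
      IsNilpotent (f * (y : A)) := by
    intro N y hN hyN
    rcases hf.isNilpotent_or_exists_inv K (x := f * (y : A)) (by rw [← mul_assoc, hff])
      (by rw [mul_assoc, (mem_leftIdeal_iff hf.1).1 y.2]) with h | ⟨c, -, -, hc, -⟩
    · exact h
    · refine absurd (eq_top_of_leftIdealGen_mem hf.1 ?_) hN.1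
      have : leftIdealGen f = (c * f) • y := Subtype.ext (by
        change f = c * f * y
        rw [mul_assoc, hc])
      rw [this]
      exact N.smul_mem _ hyN
  have hcomm : Commute (f * (y₁ : A)) (f * (y₂ : A)) := by
    have : f * (y₂ : A) = f - f * (y₁ : A) := by rw [eq_sub_iff_add_eq', hsum]
    rw [this]
    refine Commute.sub_right ?_ (Commute.refl _)
    change f * y₁ * f = f * (f * y₁)
    rw [mul_assoc, (mem_leftIdeal_iff hf.1).1 y₁.2, ← mul_assoc, hff]
  have := hcomm.isNilpotent_add (key _ _ h₁ hy₁) (key _ _ h₂ hy₂)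
  rw [hsum] at this
  exact not_isNilpotent_of_isIdempotentElem hf.1 hf.2.1 this

theorem IsPrimitiveIdempotent.jacobson_eq_of_isCoatom (K : Type v) [Field K] [Algebra K A]
    [FiniteDimensional K A] {f : A} (hf : IsPrimitiveIdempotent f)
    {N : Submodule A (leftIdeal f)} (h : IsCoatom N) : Module.jacobson A (leftIdeal f) = N :=
  le_antisymm (sInf_le h) (le_sInf fun _ h' => (hf.eq_of_isCoatom K h h').le)

theorem IsPrimitiveIdempotent.isCoatom_jacobson (K : Type v) [Field K] [Algebra K A]
    [FiniteDimensional K A] {f : A} (hf : IsPrimitiveIdempotent f) :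
    IsCoatom (Module.jacobson A (leftIdeal f)) := by
  have : Nontrivial (leftIdeal f) :=
    ⟨leftIdealGen f, 0, fun h => hf.2.1 (congrArg Subtype.val h)⟩
  have : Module.Finite A (leftIdeal f) :=
    Module.Finite.iff_fg.2 ⟨{f}, by simp [leftIdeal, Ideal.span]⟩
  obtain h | ⟨N, hN, -⟩ := eq_top_or_exists_le_coatom (⊥ : Submodule A (leftIdeal f))
  · exact absurd h bot_ne_top
  · rwa [hf.jacobson_eq_of_isCoatom K hN]

theorem IsPrimitiveIdempotent.isSimpleModule (K : Type v) [Field K] [Algebra K A]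
    [FiniteDimensional K A] {f : A} (hf : IsPrimitiveIdempotent f) :
    IsSimpleModule A (leftIdeal f ⧸ Module.jacobson A (leftIdeal f)) :=
  isSimpleModule_iff_isCoatom.2 (hf.isCoatom_jacobson K)

theorem IsPrimitiveIdempotent.jacobson_equiv (K : Type v) [Field K] [Algebra K A]
    [FiniteDimensional K A] {f : A} (hf : IsPrimitiveIdempotent f)
    [IsSimpleModule A S] {s : S} (hs : f • s ≠ 0) :
    Nonempty ((leftIdeal f ⧸ Module.jacobson A (leftIdeal f)) ≃ₗ[A] S) := by
  have h0 : leftIdealLift f s ≠ 0 := fun h => hs <| by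
    have := LinearMap.congr_fun h (leftIdealGen f)
    exact this
  have hsurj := LinearMap.surjective_of_ne_zero h0
  have hc : IsCoatom (leftIdealLift f s).ker := by
    rw [← isSimpleModule_iff_isCoatom]
    exact IsSimpleModule.congr ((leftIdealLift f s).quotKerEquivOfSurjective hsurj)
  exact ⟨(Submodule.quotEquivOfEq _ _ (hf.jacobson_eq_of_isCoatom K hc)).trans
    ((leftIdealLift f s).quotKerEquivOfSurjective hsurj)⟩

/-- Otherwise simplicity gives z bringing y s back to s. Then f z y fixes s, so it is invertible in
f A f; this makes y left invertible there, and no power of y could vanish. -/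
theorem IsPrimitiveIdempotent.smul_eq_zero_of_isNilpotent (K : Type v) [Field K] [Algebra K A]
    [FiniteDimensional K A] {f : A} (hf : IsPrimitiveIdempotent f)
    [IsSimpleModule A S] {y : A} (hfy : f * y = y) (hyf : y * f = y) (hy : IsNilpotent y) {s : S}
    (hs : f • s = s) : y • s = 0 := by
  by_contra hys
  obtain ⟨z, hz⟩ := exists_smul_eq_of_isSimpleModule A hys s
  have hs0 : s ≠ 0 := fun h => hys (by rw [h, smul_zero])
  have hff : f * f = f := hf.1
  rcases hf.isNilpotent_or_exists_inv K (x := f * z * y) (by simp only [← mul_assoc, hff])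
    (by rw [mul_assoc, hyf]) with h | ⟨c, -, -, hc, -⟩
  · refine not_isNilpotent_of_smul_eq hs0 ?_ h
    rw [mul_smul, mul_smul, hz, hs]
  · have h1 : ∀ k : ℕ, (c * (f * z)) ^ k * y ^ k * f = f := fun k => by
      induction k with
      | zero => simp
      | succ k ih =>
        rw [pow_succ, pow_succ', mul_assoc, mul_assoc, ← mul_assoc (c * (f * z)),
          ← mul_assoc (c * (f * z)), mul_assoc c, hc]
        rw [← mul_assoc]
        rcases k with _ | k
        · simp [hff]
        · rw [pow_succ' y, ← mul_assoc f y, hfy, ← pow_succ', ih]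
    obtain ⟨m, hm⟩ := hy
    have := h1 m
    rw [hm, mul_zero, zero_mul] at this
    exact hf.2.1 this.symm

/-- The residue field of the local algebra f A f is K: subtract an eigenvalue of left multiplication
by x on f A. The difference kills an eigenvector, so it is not invertible. -/
theorem IsPrimitiveIdempotent.exists_isNilpotent_sub (K : Type v) [Field K] [Algebra K A]
    [FiniteDimensional K A] [IsAlgClosed K] {f : A}
    (hf : IsPrimitiveIdempotent f) {x : A} (hx : f * x = x) (hx' : x * f = x) :
    ∃ c : K, IsNilpotent (x - c • f) := by
  have hff : f * f = f := hf.1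
  let V : Submodule K A := LinearMap.range (LinearMap.mulLeft K f)
  have hV : ∀ v ∈ V, f * v = v := by
    rintro _ ⟨w, rfl⟩
    change f * (f * w) = f * w
    rw [← mul_assoc, hff]
  let T : Module.End K V := (LinearMap.mulLeft K x).restrict (p := V) (q := V) fun v _ =>
    ⟨x * v, by change f * (x * v) = x * v; rw [← mul_assoc, hx]⟩
  have : Nontrivial V := ⟨⟨f, f, hff⟩, 0, fun h => hf.2.1 (congrArg Subtype.val h)⟩
  obtain ⟨c, hc⟩ := Module.End.exists_eigenvalue T
  obtain ⟨v, hv⟩ := hc.exists_hasEigenvector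
  have hv1 : x * (v : A) = c • (v : A) := congrArg Subtype.val hv.apply_eq_smul
  refine ⟨c, (hf.isNilpotent_or_exists_inv K (x := x - c • f) (by simp [mul_sub, hx, hff])
    (by simp [sub_mul, hx', hff])).resolve_right ?_⟩
  rintro ⟨d, -, -, hd, -⟩
  refine hv.2 (Subtype.ext ?_)
  rw [← hV v v.2, ← hd, mul_assoc, sub_mul, hv1, smul_mul_assoc, hV v v.2, sub_self, mul_zero]
  rfl

/-- Over an algebraically closed field, `f S` is at most one-dimensional for simple `S`. -/
theorem IsPrimitiveIdempotent.exists_eq_algebraMap_smul (K : Type v) [Field K] [Algebra K A]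
    [FiniteDimensional K A] [IsAlgClosed K] {f : A}
    (hf : IsPrimitiveIdempotent f) [IsSimpleModule A S] {s t : S} (hs : f • s = s) (hs0 : s ≠ 0)
    (ht : f • t = t) : ∃ c : K, t = algebraMap K A c • s := by
  obtain ⟨a, ha⟩ := exists_smul_eq_of_isSimpleModule A hs0 t
  have hff : f * f = f := hf.1
  obtain ⟨c, hc⟩ := hf.exists_isNilpotent_sub K (x := f * a * f)
    (by simp only [← mul_assoc, hff]) (by rw [mul_assoc, hff])
  refine ⟨c, ?_⟩
  have := hf.smul_eq_zero_of_isNilpotent K (S := S) (y := f * a * f - c • f)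
    (by simp [mul_sub, ← mul_assoc, hff]) (by simp [sub_mul, mul_assoc, hff]) hc hs
  rwa [sub_smul, mul_smul, mul_smul, hs, ha, ht, Algebra.smul_def, mul_smul, hs, sub_eq_zero] at this

/-- Turns the condition on radical maps into one on Peirce components. Right multiplication by e_i a
e_j is a radical map, because P(i) and P(j) are not isomorphic and so every composite back to P(i)
is nilpotent. -/
theorem IsBasicSystem.mul_mul_eq_zero (K : Type v) [Field K] [Algebra K A]
    [FiniteDimensional K A] {n : ℕ} {e : Fin n → A} (he : IsBasicSystem e)
    (h : IsOneCyclicAlgebra e) {i j : Fin n} (hij : i < j) (a : A) : e i * a * e j = 0 := by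
  have hi := he.primitive i
  have hj := he.primitive j
  have hii : e i * e i = e i := hi.1
  have hjj : e j * e j = e j := hj.1
  let F : leftIdeal (e i) →ₗ[A] leftIdeal (e j) :=
    leftIdealLift (e i) ⟨e i * a * e j, (mem_leftIdeal_iff hj.1).2 (by rw [mul_assoc, hjj])⟩
  have hF : F ∈ radHom (projMod e i) (projMod e j) := by
    intro (g : leftIdeal (e j) →ₗ[A] leftIdeal (e i))
    have hy1 : e j * (g (leftIdealGen (e j)) : A) = g (leftIdealGen (e j)) :=
      congrArg Subtype.val (smul_map_leftIdealGen hj.1 g)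
    have hy2 := (mem_leftIdeal_iff hi.1).1 (g (leftIdealGen (e j))).2
    set y : A := ((g (leftIdealGen (e j)) : leftIdeal (e i)) : A) with hy
    have hnil : IsNilpotent (e i * a * e j * y) := by
      by_contra hn
      exact hij.ne (he.irredundant i j (hi.equiv_of_not_isNilpotent K hj
        (by simp only [← mul_assoc, hii]) (by rw [mul_assoc, hjj]) hy1 hy2 hn))
    have hgF : ∀ z : leftIdeal (e i), (g (F z) : A) = z * (e i * a * e j * y) := by
      intro z
      rw [leftIdeal_map_apply hj.1 g]
      change (z : A) * (e i * a * e j) * y = _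
      rw [mul_assoc]
    refine IsNilpotent.isUnit_one_sub ?_
    obtain ⟨m, hm⟩ := hnil
    have hpow : ∀ k : ℕ, ∀ z : leftIdeal (e i),
        ((((g ∘ₗ F : Module.End A (leftIdeal (e i))) ^ k) z : leftIdeal (e i)) : A) =
          z * (e i * a * e j * y) ^ k := by
      intro k
      induction k with
      | zero => intro z; simp
      | succ k ih =>
        intro z
        rw [pow_succ, Module.End.mul_apply, ih, LinearMap.comp_apply, hgF, pow_succ', mul_assoc]
    refine ⟨m, LinearMap.ext fun z => Subtype.ext ?_⟩
    exact (hpow m z).trans (by rw [hm, mul_zero]; rfl)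
  rw [h i j hij] at hF
  have : F (leftIdealGen (e i)) = 0 := by rw [Set.mem_singleton_iff.1 hF]; rfl
  have h2 : e i * (e i * a * e j) = 0 := congrArg Subtype.val this
  rwa [← mul_assoc, ← mul_assoc, hii] at h2

end PrimitiveIdempotents

/-! ### Jordan–Hölder multiplicities as dimensions of corner spaces -/

section JordanHolder

variable {K : Type v} [Field K] {A : Type u} [Ring A] [Algebra K A]

/-- The `K`-subspace `f U` of a submodule `U`, for an idempotent `f`. -/
def cornerSubspace (K : Type v) [Field K] [Algebra K A] {X : Type u₁} [AddCommGroup X] [Module A X]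
    [Module K X] [IsScalarTower K A X] (f : A) (U : Submodule A X) : Submodule K X where
  carrier := {x | x ∈ U ∧ f • x = x}
  zero_mem' := ⟨U.zero_mem, smul_zero _⟩
  add_mem' {x y} hx hy := ⟨U.add_mem hx.1 hy.1, by rw [smul_add, hx.2, hy.2]⟩
  smul_mem' c x hx := ⟨U.smul_of_tower_mem c hx.1, by
    rw [← algebraMap_smul A c x, ← mul_smul, ← Algebra.commutes, mul_smul, hx.2]⟩

theorem smul_leftIdealGen_mk_ne_zero [FiniteDimensional K A] {f : A}
    (hf : IsPrimitiveIdempotent f) :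
    f • ((Module.jacobson A (leftIdeal f)).mkQ (leftIdealGen f)) ≠ 0 := by
  rw [← map_smul, show f • leftIdealGen f = leftIdealGen f from Subtype.ext hf.1]
  intro h
  exact (hf.isCoatom_jacobson K).1 (eq_top_of_leftIdealGen_mem hf.1
    ((Submodule.Quotient.mk_eq_zero _).1 h))

variable [FiniteDimensional K A] [IsAlgClosed K] {X : Type u₁} [AddCommGroup X] [Module A X]

open Classical in
-- Over an algebraically closed field, f cuts out a line from the top of A f and nothing from any
-- other simple module.
theorem finrank_cornerSubspace_of_covBy [Module K X] [IsScalarTower K A X]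
    [FiniteDimensional K X] {f : A}
    (hf : IsPrimitiveIdempotent f) {U₁ U₂ : Submodule A X} (h : U₁ ⋖ U₂) :
    Module.finrank K (cornerSubspace K f U₂) = Module.finrank K (cornerSubspace K f U₁) +
      if Nonempty ((U₂ ⧸ U₁.submoduleOf U₂) ≃ₗ[A] leftIdeal f ⧸ Module.jacobson A (leftIdeal f))
        then 1 else 0 := by
  have hs : IsSimpleModule A (U₂ ⧸ U₁.submoduleOf U₂) := (covBy_iff_quot_is_simple h.le).1 h
  have hff : f * f = f := hf.1
  by_cases hQ : ∃ q : U₂ ⧸ U₁.submoduleOf U₂, f • q ≠ 0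
  · obtain ⟨q, hq⟩ := hQ
    rw [if_pos (Nonempty.map LinearEquiv.symm (hf.jacobson_equiv K hq))]
    obtain ⟨x, rfl⟩ := Submodule.mkQ_surjective _ q
    rw [← map_smul] at hq
    set y : U₂ := f • x with hy
    have hfy : f • y = y := by rw [hy, ← mul_smul, hff]
    have hyU : (y : X) ∉ U₁ := fun h => hq ((Submodule.Quotient.mk_eq_zero _).2 h)
    have hspan : cornerSubspace K f U₂ = cornerSubspace K f U₁ ⊔ Submodule.span K {(y : X)} := by
      apply le_antisymm
      · rintro z ⟨hz, hfz⟩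
        obtain ⟨c, hc⟩ := hf.exists_eq_algebraMap_smul K
          (s := (U₁.submoduleOf U₂).mkQ y) (t := (U₁.submoduleOf U₂).mkQ ⟨z, hz⟩)
          (by rw [← map_smul, hfy]) hq
          (by rw [← map_smul]; exact congrArg _ (Subtype.ext hfz))
        rw [← map_smul, ← sub_eq_zero, ← map_sub] at hc
        have hmem : z - algebraMap K A c • (y : X) ∈ U₁ :=
          (Submodule.Quotient.mk_eq_zero (U₁.submoduleOf U₂)).1 hc
        rw [algebraMap_smul] at hmem
        refine Submodule.mem_sup.2 ⟨z - c • (y : X), ⟨hmem, ?_⟩, c • (y : X),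
          Submodule.smul_mem _ _ (Submodule.mem_span_singleton_self _), sub_add_cancel _ _⟩
        rw [smul_sub, hfz, ← algebraMap_smul A c, ← mul_smul, ← Algebra.commutes, mul_smul,
          show f • (y : X) = y from congrArg Subtype.val hfy]
      · refine sup_le (fun z hz => ⟨h.le hz.1, hz.2⟩) ?_
        rw [Submodule.span_singleton_le_iff_mem]
        exact ⟨y.2, congrArg Subtype.val hfy⟩
    have hinf : cornerSubspace K f U₁ ⊓ Submodule.span K {(y : X)} = ⊥ := by
      rw [eq_bot_iff]
      rintro z ⟨hz, hz'⟩
      obtain ⟨c, rfl⟩ := Submodule.mem_span_singleton.1 hz'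
      by_cases hc : c = 0
      · simp [hc]
      · exact absurd (by simpa [hc] using U₁.smul_of_tower_mem c⁻¹ hz.1) hyU
    have := Submodule.finrank_sup_add_finrank_inf_eq (cornerSubspace K f U₁)
      (Submodule.span K {(y : X)})
    rw [hinf, finrank_bot, ← hspan, add_zero, finrank_span_singleton (fun h0 => hyU (by
      rw [h0]; exact U₁.zero_mem))] at this
    exact this
  · push Not at hQ
    rw [if_neg, add_zero]
    · suffices cornerSubspace K f U₂ = cornerSubspace K f U₁ by rw [this]
      refine le_antisymm ?_ fun z hz => ⟨h.le hz.1, hz.2⟩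
      rintro z ⟨hz, hfz⟩
      refine ⟨?_, hfz⟩
      have := hQ ((U₁.submoduleOf U₂).mkQ ⟨z, hz⟩)
      rw [← map_smul, show f • (⟨z, hz⟩ : U₂) = ⟨z, hz⟩ from Subtype.ext hfz] at this
      exact (Submodule.Quotient.mk_eq_zero (U₁.submoduleOf U₂)).1 this
    · rintro ⟨φ⟩
      refine smul_leftIdealGen_mk_ne_zero (K := K) hf (φ.symm.injective ?_)
      rw [map_smul, hQ, map_zero]

theorem Fin.eq_add_sum_of_succ_eq {m : ℕ} (g : Fin (m + 1) → ℕ) (d : Fin m → ℕ)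
    (h : ∀ j, g j.succ = g j.castSucc + d j) : g (Fin.last m) = g 0 + ∑ j, d j := by
  induction m with
  | zero => simp
  | succ m ih =>
    rw [Fin.sum_univ_castSucc, ← add_assoc, ← Fin.succ_last, h]
    congr 1
    exact ih (fun j => g j.castSucc) (fun j => d j.castSucc) fun j => h j.castSucc

/-- Adding the jumps of dim f U along a composition series gives dim f X, whatever the series.
Together with the existence of a series, this makes the supremum in `jhMult` one over a singleton.
-/
theorem jhMult_eq_finrank [Module K X] [IsScalarTower K A X] [Module.Finite A X] {f : A}
    (hf : IsPrimitiveIdempotent f) :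
    jhMult A X (leftIdeal f ⧸ Module.jacobson A (leftIdeal f)) =
      Module.finrank K (cornerSubspace K f (⊤ : Submodule A X)) := by
  classical
  have : FiniteDimensional K X := Module.Finite.trans A X
  have : IsArtinianRing A := IsArtinianRing.of_finite K A
  have : IsNoetherianRing A := IsNoetherianRing.of_finite K A
  have key : ∀ s : CompositionSeries (Submodule A X), s.head = ⊥ → s.last = ⊤ →
      Nat.card {k : Fin s.length // Nonempty ((s k.succ ⧸ (s k.castSucc).submoduleOf (s k.succ))
        ≃ₗ[A] leftIdeal f ⧸ Module.jacobson A (leftIdeal f))} =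
      Module.finrank K (cornerSubspace K f (⊤ : Submodule A X)) := by
    intro s h0 h1
    have := Fin.eq_add_sum_of_succ_eq (fun j => Module.finrank K (cornerSubspace K f (s j))) _
      fun j => finrank_cornerSubspace_of_covBy hf (s.step j)
    have hbot : cornerSubspace K f (s 0) = ⊥ := by
      rw [eq_bot_iff]
      rintro x ⟨hx, -⟩
      rw [show s 0 = ⊥ from h0] at hx
      exact hx
    rw [show s (Fin.last _) = ⊤ from h1, hbot, finrank_bot, zero_add] at this
    rw [this, Nat.card_eq_fintype_card, Fintype.card_subtype, Finset.card_filter]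
  obtain ⟨s, h0, h1⟩ := exists_compositionSeries_of_isNoetherian_isArtinian A X
  have : {m | ∃ s : CompositionSeries (Submodule A X), s.head = ⊥ ∧ s.last = ⊤ ∧
      m = Nat.card {k : Fin s.length // Nonempty ((s k.succ ⧸ (s k.castSucc).submoduleOf (s k.succ))
        ≃ₗ[A] leftIdeal f ⧸ Module.jacobson A (leftIdeal f))}} =
      {Module.finrank K (cornerSubspace K f (⊤ : Submodule A X))} := by
    ext m
    constructor
    · rintro ⟨s, h0, h1, rfl⟩
      exact key s h0 h1
    · rintro rfl
      exact ⟨s, h0, h1, (key s h0 h1).symm⟩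
  rw [jhMult, this, csSup_singleton]

theorem jhMult_ne_zero_iff (K : Type v) [Field K] [Algebra K A] [FiniteDimensional K A]
    [IsAlgClosed K] [Module.Finite A X] {f : A} (hf : IsPrimitiveIdempotent f) :
    jhMult A X (leftIdeal f ⧸ Module.jacobson A (leftIdeal f)) ≠ 0 ↔ ∃ x : X, f • x ≠ 0 := by
  -- The multiplicity does not refer to K, so the K-structure that X inherits from A may be used.
  let : Module K X := Module.compHom X (algebraMap K A)
  have : IsScalarTower K A X := IsScalarTower.of_algebraMap_smul fun _ _ => rfl
  have : FiniteDimensional K X := Module.Finite.trans A X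
  have hff : f * f = f := hf.1
  rw [jhMult_eq_finrank (K := K) hf, Ne, Submodule.finrank_eq_zero, ← Ne, Submodule.ne_bot_iff]
  constructor
  · rintro ⟨x, hx, hx0⟩
    exact ⟨x, by rwa [hx.2]⟩
  · rintro ⟨x, hx⟩
    exact ⟨f • x, ⟨trivial, by rw [← mul_smul, hff]⟩, hx⟩

theorem jhMult_eq_one_iff (K : Type v) [Field K] [Algebra K A] [FiniteDimensional K A]
    [IsAlgClosed K] [Module.Finite A X] {f : A} (hf : IsPrimitiveIdempotent f) :
    jhMult A X (leftIdeal f ⧸ Module.jacobson A (leftIdeal f)) = 1 ↔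
      ∃ x : X, x ≠ 0 ∧ f • x = x ∧ ∀ y : X, f • y = y → ∃ c : K, y = algebraMap K A c • x := by
  let : Module K X := Module.compHom X (algebraMap K A)
  have : IsScalarTower K A X := IsScalarTower.of_algebraMap_smul fun _ _ => rfl
  rw [jhMult_eq_finrank (K := K) hf, finrank_eq_one_iff']
  constructor
  · rintro ⟨⟨x, hx⟩, hx0, h⟩
    refine ⟨x, fun h0 => hx0 (Subtype.ext h0), hx.2, fun y hy => ?_⟩
    obtain ⟨c, hc⟩ := h ⟨y, trivial, hy⟩
    exact ⟨c, (congrArg Subtype.val hc).symm⟩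
  · rintro ⟨x, hx0, hx, h⟩
    refine ⟨⟨x, trivial, hx⟩, fun h0 => hx0 (congrArg Subtype.val h0), fun y => ?_⟩
    obtain ⟨c, hc⟩ := h y y.2.2
    exact ⟨c, Subtype.ext hc.symm⟩

end JordanHolder

/-! ### Induced modules and directed extensions -/

section InducedModules

variable {B A : Type u} [Ring B] [Ring A] (φ : B →+* A)

/-- An element of `A`, viewed in the bimodule `A`. -/
def RightRestrict.mk (a : A) : RightRestrict φ := a

/-- An element of the bimodule `A`, viewed in `A`. -/
def RightRestrict.val {φ : B →+* A} (a : RightRestrict φ) : A := a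

theorem RightRestrict.op_smul_mk (b : B) (a : A) :
    op b • RightRestrict.mk φ a = RightRestrict.mk φ (a * φ b) := rfl

theorem RightRestrict.smul_mk (a a' : A) :
    a • RightRestrict.mk φ a' = RightRestrict.mk φ (a * a') := rfl

/-- The induced module `A ⊗_B X`. -/
abbrev IndMod (X : Type u₁) [AddCommGroup X] [Module B X] := BTensor B (RightRestrict φ) X

variable {X : Type u₁} [AddCommGroup X] [Module B X] {Y : Type u₂} [AddCommGroup Y] [Module B Y]
  {M : Type u₃} [AddCommGroup M] [Module A M] {N : Type u₄} [AddCommGroup N] [Module A N]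

variable (X) in
/-- The unit `X → A ⊗_B X`, `x ↦ 1 ⊗ x`. -/
def indMk : X →ₛₗ[φ] IndMod φ X where
  toFun x := BTensor.tmul B (RightRestrict.mk φ 1) x
  map_add' := BTensor.tmul_add _
  map_smul' b x := by
    rw [← BTensor.op_smul_tmul, BTensor.smul_tmul, RightRestrict.op_smul_mk,
      RightRestrict.smul_mk, one_mul, mul_one]

variable {φ}

theorem tmul_eq_smul_indMk (a : RightRestrict φ) (x : X) :
    BTensor.tmul B a x = a.val • indMk φ X x := by
  change _ = a.val • BTensor.tmul B (RightRestrict.mk φ 1) x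
  rw [BTensor.smul_tmul, RightRestrict.smul_mk, mul_one]
  rfl

@[elab_as_elim]
theorem ind_induction {p : IndMod φ X → Prop} (t : IndMod φ X) (zero : p 0)
    (smul : ∀ (a : A) x, p (a • indMk φ X x)) (add : ∀ s t, p s → p t → p (s + t)) : p t := by
  induction t using BTensor.induction with
  | zero => exact zero
  | tmul a x => rw [tmul_eq_smul_indMk]; exact smul a.val x
  | add s t hs ht => exact add s t hs ht

/-- The universal property of the induced module. -/
def indLift (h : X →ₛₗ[φ] M) : IndMod φ X →ₗ[A] M where
  toFun := BTensor.lift (BTensor.biadd (fun (a : RightRestrict φ) x => a.val • h x)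
    (fun a a' x => add_smul a.val a'.val (h x)) (fun a x x' => by rw [map_add, smul_add]))
    (fun b a x => by
      change (a.val * φ b : A) • h x = a.val • h (b • x)
      rw [map_smulₛₗ, mul_smul])
  map_add' := map_add _
  map_smul' a t := by
    induction t using BTensor.induction with
    | zero => rw [smul_zero, map_zero, smul_zero]
    | tmul a' x => exact mul_smul a a'.val (h x)
    | add s t hs ht => rw [smul_add, map_add, hs, ht, map_add, smul_add]

@[simp]
theorem indLift_indMk (h : X →ₛₗ[φ] M) (x : X) : indLift h (indMk φ X x) = h x :=
  one_smul A (h x)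

theorem ind_hom_ext {f g : IndMod φ X →ₗ[A] M} (h : ∀ x, f (indMk φ X x) = g (indMk φ X x)) :
    f = g := by
  ext t
  induction t using ind_induction with
  | zero => simp
  | smul a x => rw [map_smul, map_smul, h]
  | add s t hs ht => rw [map_add, map_add, hs, ht]

variable (φ) in
/-- The map `A ⊗_B X → A ⊗_B Y` induced by a `B`-linear map `X → Y`. -/
abbrev indMap (ψ : X →ₗ[B] Y) : IndMod φ X →ₗ[A] IndMod φ Y := BTensor.lmap A (RightRestrict φ) ψ

@[simp]
theorem indMap_indMk (ψ : X →ₗ[B] Y) (x : X) :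
    indMap φ ψ (indMk φ X x) = indMk φ Y (ψ x) := rfl

theorem indMap_surjective {ψ : X →ₗ[B] Y} (h : Function.Surjective ψ) :
    Function.Surjective (indMap φ ψ) := by
  intro t
  induction t using ind_induction with
  | zero => exact ⟨0, map_zero _⟩
  | smul a y =>
    obtain ⟨x, rfl⟩ := h y
    exact ⟨a • indMk φ X x, by rw [map_smul, indMap_indMk]⟩
  | add s t hs ht =>
    obtain ⟨s', rfl⟩ := hs
    obtain ⟨t', rfl⟩ := ht
    exact ⟨s' + t', map_add _ _ _⟩

variable (φ) in
/-- Isomorphic modules induce isomorphic modules. -/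
def indCongr (ψ : X ≃ₗ[B] Y) : IndMod φ X ≃ₗ[A] IndMod φ Y :=
  LinearEquiv.ofLinearMap (indMap φ ψ.toLinearMap) (indMap φ ψ.symm.toLinearMap)
    (ind_hom_ext fun y => by simp) (ind_hom_ext fun x => by simp)

instance [Module.Finite B X] : Module.Finite A (IndMod φ X) := by
  obtain ⟨s, hs⟩ := Module.Finite.fg_top (R := B) (M := X)
  classical
  refine ⟨⟨s.image (indMk φ X), eq_top_iff.2 fun t _ => ?_⟩⟩
  have key : ∀ x : X, indMk φ X x ∈ Submodule.span A (s.image (indMk φ X) : Set (IndMod φ X)) := by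
    intro x
    have : x ∈ Submodule.span B (s : Set X) := by rw [hs]; trivial
    induction this using Submodule.span_induction with
    | mem x h => exact Submodule.subset_span (by simpa using ⟨x, h, rfl⟩)
    | zero => rw [map_zero]; exact Submodule.zero_mem _
    | add x y _ _ hx hy => rw [map_add]; exact Submodule.add_mem _ hx hy
    | smul b x _ hx => rw [map_smulₛₗ]; exact Submodule.smul_mem _ _ hx
  induction t using ind_induction with
  | zero => exact Submodule.zero_mem _
  | smul a x => exact Submodule.smul_mem _ _ (key x)
  | add s t hs ht => exact Submodule.add_mem _ (hs trivial) (ht trivial)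

/-- An `A`-module, viewed as a `B`-module through `φ : B → A`. -/
def Res (_φ : B →+* A) (M : Type u₃) [AddCommGroup M] [Module A M] : Type u₃ := M

instance : AddCommGroup (Res φ M) := inferInstanceAs (AddCommGroup M)

instance : Module B (Res φ M) := Module.compHom M φ

variable (φ M) in
/-- The identity of `M`, as a semilinear map from the restriction of `M` to `M`. -/
def resId : Res φ M →ₛₗ[φ] M where
  toFun m := m
  map_add' _ _ := rfl
  map_smul' _ _ := rfl

/-- A semilinear map, as a `B`-linear map to the restriction. -/
def toRes (h : X →ₛₗ[φ] M) : X →ₗ[B] Res φ M where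
  toFun := h
  map_add' := h.map_add
  map_smul' := h.map_smulₛₗ

/-- A ring homomorphism `φ : B → A` together with orthogonal idempotents of `B`, ordered in such a
way that induction along `φ` is exact, the unit `X → A ⊗_B X` is injective with injective cokernel,
and `A ⊗_B X` only grows `X` in smaller vertices. -/
structure IsDirectedExtension {n : ℕ} (φ : B →+* A) (e : Fin n → B) : Prop where
  orthogonal : OrthogonalIdempotents e
  sum_eq_one : ∑ i, e i = 1
  directed : ∀ {i j : Fin n}, i < j → ∀ b, e i * b * e j = 0
  map_injective : ∀ {X Y : Type u} [AddCommGroup X] [Module B X] [AddCommGroup Y] [Module B Y]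
    (f : X →ₗ[B] Y), Function.Injective f → Function.Injective (indMap φ f)
  map_exact : ∀ {X Y Z : Type u} [AddCommGroup X] [Module B X] [AddCommGroup Y] [Module B Y]
    [AddCommGroup Z] [Module B Z] (f : X →ₗ[B] Y) (g : Y →ₗ[B] Z), Function.Injective f →
    Function.Exact f g → Function.Exact (indMap φ f) (indMap φ g)
  unit_injective : ∀ (X : Type u) [AddCommGroup X] [Module B X], Function.Injective (indMk φ X)
  injective_coker : ∀ (X : Type u) [AddCommGroup X] [Module B X],
    Module.Injective B (Res φ (IndMod φ X) ⧸ LinearMap.range (toRes (indMk φ X)))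
  support : ∀ (X : Type u) [AddCommGroup X] [Module B X] (c : Fin n),
    (∀ k, c < k → ∀ x : X, e k • x = 0) → ∀ t : IndMod φ X, ∃ x, φ (e c) • t = indMk φ X x

namespace IsDirectedExtension

variable {n : ℕ} {e : Fin n → B} (D : IsDirectedExtension φ e)
include D

theorem idem (i : Fin n) : e i * e i = e i := D.orthogonal.idem i

theorem mul_eq_zero {i j : Fin n} (h : i ≠ j) : e i * e j = 0 := D.orthogonal.ortho h

theorem sum_smul (x : X) : ∑ i, e i • x = x := by
  rw [← Finset.sum_smul, D.sum_eq_one, one_smul]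

theorem sum_map_smul (m : M) : ∑ i, φ (e i) • m = m := by
  rw [← Finset.sum_smul, ← map_sum, D.sum_eq_one, map_one, one_smul]

theorem exists_eq_indMk {X : Type u} [AddCommGroup X] [Module B X] {c : Fin n}
    (h : ∀ k, c < k → ∀ x : X, e k • x = 0) (t : IndMod φ X) :
    ∃ x, e c • x = x ∧ φ (e c) • t = indMk φ X x := by
  obtain ⟨x, hx⟩ := D.support X c h t
  refine ⟨e c • x, by rw [← mul_smul, D.idem], ?_⟩
  rw [map_smulₛₗ, ← hx, ← mul_smul, ← map_mul, D.idem]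

/-- X is also supported up to k, so `support` at k itself puts e_k t into 1 ⊗ e_k X, which is zero.
-/
theorem map_smul_eq_zero {X : Type u} [AddCommGroup X] [Module B X] {c : Fin n}
    (h : ∀ k, c < k → ∀ x : X, e k • x = 0) {k : Fin n} (hk : c < k) (t : IndMod φ X) :
    φ (e k) • t = 0 := by
  obtain ⟨x, hx, ht⟩ := D.exists_eq_indMk (c := k) (fun k' hk' => h k' (hk.trans hk')) t
  rw [ht, ← hx, h k hk, map_zero]

theorem smul_leftIdeal_eq_zero {i k : Fin n} (h : k < i) {b : B} (hb : b ∈ leftIdeal (e i)) :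
    e k * b = 0 := by
  rw [← (mem_leftIdeal_iff (D.idem i)).1 hb, ← mul_assoc]
  exact D.directed h b

/-- The kernel of the largest quotient of `P(i)` in which only `S(i)` occurs. -/
def cornerKer (i : Fin n) : Submodule B (leftIdeal (e i)) where
  carrier := {b | e i * (b : B) = 0}
  zero_mem' := mul_zero _
  add_mem' {b c} hb hc := by
    change e i * ((b : B) + c) = 0
    rw [mul_add, show e i * (b : B) = 0 from hb, show e i * (c : B) = 0 from hc, add_zero]
  smul_mem' c b hb := by
    change e i * (c * (b : B)) = 0
    nth_rw 1 [← one_mul (b : B)]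
    rw [← D.sum_eq_one, Finset.sum_mul, Finset.mul_sum, Finset.mul_sum]
    refine Finset.sum_eq_zero fun k _ => ?_
    rcases lt_trichotomy k i with h | rfl | h
    · rw [D.smul_leftIdeal_eq_zero h b.2, mul_zero, mul_zero]
    · rw [show e k * (b : B) = 0 from hb, mul_zero, mul_zero]
    · rw [← mul_assoc, ← mul_assoc, D.directed h, zero_mul]

/-- On modules supported in vertices up to `i`, elements of `A` act on the vertex `i` through the
corner ring `eᵢ B eᵢ`. -/
theorem exists_corner (i : Fin n) (a : A) : ∃ u : B, e i * u = u ∧ u * e i = u ∧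
    ∀ (M : Type u₃) [AddCommGroup M] [Module A M], (∀ k, i < k → ∀ m : M, φ (e k) • m = 0) →
      ∀ m : M, φ (e i) • m = m → φ (e i) • a • m = φ u • m := by
  -- The universal case: the quotient by `cornerKer` is a copy of e_i B e_i at the vertex i, so
  -- `support` makes the e_i-part of a · (1 ⊗ generator) come from some b in B. Sending the
  -- generator to m carries this identity over to every M.
  obtain ⟨q, hq⟩ := D.support (leftIdeal (e i) ⧸ D.cornerKer i) i (fun k hk x => by
    obtain ⟨x, rfl⟩ := Submodule.mkQ_surjective _ x
    rw [← map_smul]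
    refine (Submodule.Quotient.mk_eq_zero (D.cornerKer i)).2 ?_
    change e i * (e k * x) = 0
    rw [← mul_assoc, D.mul_eq_zero hk.ne, zero_mul])
    (a • indMk φ _ ((D.cornerKer i).mkQ (leftIdealGen (e i))))
  obtain ⟨b, rfl⟩ := Submodule.mkQ_surjective _ q
  have hb := (mem_leftIdeal_iff (D.idem i)).1 b.2
  refine ⟨e i * b, by rw [← mul_assoc, D.idem], by rw [mul_assoc, hb], ?_⟩
  intro M _ _ hM m hm
  let h₀ : leftIdeal (e i) →ₛₗ[φ] M :=
    { toFun := fun b => φ b • m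
      map_add' := fun b c => by
        rw [← add_smul, ← map_add]; rfl
      map_smul' := fun b c => by
        rw [← mul_smul, ← map_mul]; rfl }
  -- Directedness removes the components at vertices below i, the support of M those above.
  have hi : ∀ c : leftIdeal (e i), φ c • m = φ (e i * c) • m := fun c => by
    rw [← D.sum_map_smul (φ (c : B) • m), Finset.sum_eq_single i]
    · rw [map_mul, mul_smul]
    · intro k _ hk
      rcases lt_or_gt_of_ne hk with h | h
      · rw [← mul_smul, ← map_mul, D.smul_leftIdeal_eq_zero h c.2, map_zero, zero_smul]
      · exact hM k h _
    · simp
  let h₁ : (leftIdeal (e i) ⧸ D.cornerKer i) →ₛₗ[φ] M := (D.cornerKer i).liftQ h₀ (fun c hc => by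
    change φ (c : B) • m = 0
    rw [hi, show e i * (c : B) = 0 from hc, map_zero, zero_smul])
  have := congrArg (indLift h₁) hq
  rw [map_smul, map_smul, indLift_indMk, indLift_indMk] at this
  have e1 : h₁ ((D.cornerKer i).mkQ (leftIdealGen (e i))) = m := hm
  have e2 : h₁ ((D.cornerKer i).mkQ b) = φ (b : B) • m := rfl
  rw [e1, e2, hi] at this
  exact this

end IsDirectedExtension

end InducedModules

/-! ### Lifting the vertices of B to primitive idempotents of A -/

section Idempotents

variable {K : Type v} [Field K] {B A : Type u} [Ring B] [Ring A] [Algebra K B] [Algebra K A]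

/-- Among the idempotents below f that do not kill m, take g with dim g A minimal. If g splits, a
summand that does not kill m is again a candidate, so it generates the same right ideal and the
other summand vanishes. -/
theorem exists_isPrimitiveIdempotent_smul_ne_zero (K : Type v) [Field K] [Algebra K A]
    [FiniteDimensional K A] {M : Type u₁} [AddCommGroup M] [Module A M] {f : A}
    (hf : IsIdempotentElem f) {m : M} (hm : f • m ≠ 0) :
    ∃ g : A, IsPrimitiveIdempotent g ∧ f * g = g ∧ g * f = g ∧ g • m ≠ 0 := by
  let s : Set A := {g | IsIdempotentElem g ∧ f * g = g ∧ g * f = g ∧ g • m ≠ 0}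
  let r : A → ℕ := fun g => Module.finrank K (LinearMap.range (LinearMap.mulLeft K g))
  obtain ⟨g, ⟨hg, hfg, hgf, hgm⟩, hmin⟩ :=
    (measure r).wf.has_min s ⟨f, hf, hf.eq, hf.eq, hm⟩
  refine ⟨g, ⟨hg, fun h => hgm (by rw [h, zero_smul]), ?_⟩, hfg, hgf, hgm⟩
  have key : ∀ g₁ g₂ : A, IsIdempotentElem g₁ → IsIdempotentElem g₂ → g₁ * g₂ = 0 →
      g₂ * g₁ = 0 → g₁ + g₂ = g → g₁ • m ≠ 0 → g₂ = 0 := by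
    intro g₁ g₂ h₁ h₂ h₁₂ h₂₁ hsum hm₁
    have hgg₁ : g * g₁ = g₁ := by rw [← hsum, add_mul, h₁.eq, h₂₁, add_zero]
    have hg₁g : g₁ * g = g₁ := by rw [← hsum, mul_add, h₁.eq, h₁₂, add_zero]
    have hs : g₁ ∈ s := ⟨h₁, by rw [← hgg₁, ← mul_assoc, hfg], by
      rw [← hg₁g, mul_assoc, hgf], hm₁⟩
    have hle : LinearMap.range (LinearMap.mulLeft K g₁) ≤ LinearMap.range (LinearMap.mulLeft K g) := by
      rintro _ ⟨a, rfl⟩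
      exact ⟨g₁ * a, by simp [← mul_assoc, hgg₁]⟩
    have heq := Submodule.eq_of_le_of_finrank_le hle (not_lt.1 (hmin g₁ hs))
    have : g ∈ LinearMap.range (LinearMap.mulLeft K g₁) := by
      rw [heq]; exact ⟨g, hg.eq⟩
    obtain ⟨a, ha⟩ := this
    have ha' : g₁ * a = g := ha
    have : g₁ = g := by rw [← hg₁g, ← ha', ← mul_assoc, h₁.eq]
    rw [this] at hsum
    exact left_eq_add.1 hsum.symm
  intro g₁ g₂ h₁ h₂ h₁₂ h₂₁ hsum
  by_cases hm₁ : g₁ • m = 0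
  · left
    refine key g₂ g₁ h₂ h₁ h₂₁ h₁₂ (by rw [add_comm, hsum]) fun h => hgm ?_
    rw [← hsum, add_smul, hm₁, h, add_zero]
  · exact Or.inr (key g₁ g₂ h₁ h₂ h₁₂ h₂₁ hsum hm₁)

theorem smul_algebraMap_smul {M : Type u₁} [AddCommGroup M] [Module A M] (a : A) (c : K) (m : M) :
    a • algebraMap K A c • m = algebraMap K A c • a • m := by
  rw [← mul_smul, ← Algebra.commutes, mul_smul]

/-- The generator of the simple module `S(i)`. -/
def simpleGen {n : ℕ} (e : Fin n → B) (i : Fin n) : simpleMod e i :=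
  (Module.jacobson B (leftIdeal (e i))).mkQ (leftIdealGen (e i))

section Basic

variable [FiniteDimensional K B] {n : ℕ} {e : Fin n → B} (he : IsBasicSystem e)
include he

theorem IsBasicSystem.isSimpleModule (K : Type v) [Field K] [Algebra K B] [FiniteDimensional K B]
    (i : Fin n) : IsSimpleModule B (simpleMod e i) :=
  (he.primitive i).isSimpleModule K

theorem IsBasicSystem.smul_simpleGen (i : Fin n) : e i • simpleGen e i = simpleGen e i := by
  change e i • (Module.jacobson B (leftIdeal (e i))).mkQ (leftIdealGen (e i)) = _
  rw [← map_smul, show e i • leftIdealGen (e i) = leftIdealGen (e i) from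
    Subtype.ext (he.primitive i).1]
  rfl

theorem IsBasicSystem.simpleGen_ne_zero (K : Type v) [Field K] [Algebra K B]
    [FiniteDimensional K B] (i : Fin n) : simpleGen e i ≠ 0 := by
  rw [← he.smul_simpleGen i]
  exact smul_leftIdealGen_mk_ne_zero (K := K) (he.primitive i)

theorem IsBasicSystem.exists_smul_simpleGen (i : Fin n) (x : simpleMod e i) :
    ∃ b : B, b • simpleGen e i = x := by
  obtain ⟨b, rfl⟩ := Submodule.mkQ_surjective _ x
  refine ⟨(show leftIdeal (e i) from b).1, ?_⟩
  change (show leftIdeal (e i) from b).1 • (Module.jacobson B (leftIdeal (e i))).mkQ (leftIdealGen (e i)) = _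
  rw [← map_smul, smul_leftIdealGen (he.primitive i).1]
  rfl

theorem IsBasicSystem.smul_simpleMod_eq_zero (K : Type v) [Field K] [Algebra K B]
    [FiniteDimensional K B] {i j : Fin n} (h : j ≠ i) (x : simpleMod e i) : e j • x = 0 := by
  by_contra hx
  have := he.isSimpleModule K i
  refine h (he.irredundant j i ((he.primitive j).equiv_of_isSimpleModule K (he.primitive i)
    (t := simpleGen e i) hx ?_))
  rw [he.smul_simpleGen]
  exact he.simpleGen_ne_zero K i

theorem IsBasicSystem.exists_eq_algebraMap_smul_simpleGen [IsAlgClosed K] (i : Fin n)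
    {x : simpleMod e i} (hx : e i • x = x) : ∃ c : K, x = algebraMap K B c • simpleGen e i := by
  have := he.isSimpleModule K i
  exact (he.primitive i).exists_eq_algebraMap_smul K (he.smul_simpleGen i)
    (he.simpleGen_ne_zero K i) hx

/-- Every simple module is one of the `S(i)`. -/
theorem IsBasicSystem.exists_simpleMod_equiv (K : Type v) [Field K] [Algebra K B]
    [FiniteDimensional K B] (hsum : ∑ i, e i = 1) {S : Type u₁} [AddCommGroup S]
    [Module B S] [IsSimpleModule B S] : ∃ i, (∃ s : S, e i • s ≠ 0) ∧
      Nonempty (simpleMod e i ≃ₗ[B] S) := by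
  have := IsSimpleModule.nontrivial B S
  obtain ⟨s, hs⟩ := exists_ne (0 : S)
  have : ∃ i, e i • s ≠ 0 := by
    by_contra h
    push Not at h
    apply hs
    rw [← one_smul B s, ← hsum, Finset.sum_smul]
    exact Finset.sum_eq_zero fun i _ => h i
  obtain ⟨i, hi⟩ := this
  exact ⟨i, ⟨s, hi⟩, (he.primitive i).jacobson_equiv K hi⟩

end Basic

/-- The properly standard modules of a directed extension are `A ⊗_B S(i)`; this is their
generator. -/
def indGen {n : ℕ} (φ : B →+* A) (e : Fin n → B) (i : Fin n) : IndMod φ (simpleMod e i) :=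
  indMk φ (simpleMod e i) (simpleGen e i)

/-- The idempotents `f i` lift the vertices of `B` to `A`: `f i` is a primitive summand of `φ (e i)`
which acts as the identity on the generator of `A ⊗_B S(i)`. -/
structure IsVertexLift {n : ℕ} (φ : B →+* A) (e : Fin n → B) (f : Fin n → A) : Prop where
  primitive : ∀ i, IsPrimitiveIdempotent (f i)
  map_mul : ∀ i, φ (e i) * f i = f i
  mul_map : ∀ i, f i * φ (e i) = f i
  smul_gen : ∀ i, f i • indGen φ e i = indGen φ e i

variable {φ : B →+* A} (hφ : ∀ c : K, φ (algebraMap K B c) = algebraMap K A c) {n : ℕ}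
  {e : Fin n → B} (he : IsBasicSystem e) (D : IsDirectedExtension φ e)
  {f : Fin n → A}

namespace IsDirectedExtension

section

include he

theorem smul_indGen (i : Fin n) : φ (e i) • indGen φ e i = indGen φ e i := by
  rw [indGen, ← map_smulₛₗ, he.smul_simpleGen]

theorem exists_smul_indGen (i : Fin n) (t : IndMod φ (simpleMod e i)) :
    ∃ a : A, t = a • indGen φ e i := by
  induction t using ind_induction with
  | zero => exact ⟨0, (zero_smul _ _).symm⟩
  | smul a x =>
    obtain ⟨b, rfl⟩ := he.exists_smul_simpleGen i x
    exact ⟨a * φ b, by rw [map_smulₛₗ, mul_smul]; rfl⟩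
  | add s t hs ht =>
    obtain ⟨a, rfl⟩ := hs
    obtain ⟨b, rfl⟩ := ht
    exact ⟨a + b, (add_smul _ _ _).symm⟩

include D

theorem indGen_ne_zero (K : Type v) [Field K] [Algebra K B] [FiniteDimensional K B] (i : Fin n) :
    indGen φ e i ≠ 0 := by
  rw [indGen, ← map_zero (indMk φ (simpleMod e i))]
  exact fun h => he.simpleGen_ne_zero K i (D.unit_injective _ h)

theorem map_smul_ind_simpleMod_eq_zero (K : Type v) [Field K] [Algebra K B] [FiniteDimensional K B]
    {i k : Fin n} (h : i < k) (t : IndMod φ (simpleMod e i)) : φ (e k) • t = 0 :=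
  D.map_smul_eq_zero (fun _ hk x => he.smul_simpleMod_eq_zero K hk.ne' x) h t

include hφ in
-- By `support` this component lies in 1 ⊗ e_i S(i), and e_i S(i) is a line. This is the source of
-- multiplicity one in the proper standard modules.
theorem exists_eq_algebraMap_smul_indGen [FiniteDimensional K B] [IsAlgClosed K] {i : Fin n}
    (t : IndMod φ (simpleMod e i)) :
    ∃ c : K, φ (e i) • t = algebraMap K A c • indGen φ e i := by
  obtain ⟨x, hx, ht⟩ := D.exists_eq_indMk (c := i)
    (fun _ hk x => he.smul_simpleMod_eq_zero K hk.ne' x) t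
  obtain ⟨c, rfl⟩ := he.exists_eq_algebraMap_smul_simpleGen (K := K) i hx
  exact ⟨c, by rw [ht, map_smulₛₗ, hφ]; rfl⟩

include hφ in
-- The idempotent φ(e i) need not stay primitive in A; choose a primitive summand that does not kill
-- the generator of A ⊗ S(i). It acts on the generator by a scalar, and a non-zero idempotent scalar
-- is 1.
theorem exists_isVertexLift [FiniteDimensional K B] [FiniteDimensional K A] [IsAlgClosed K] :
    ∃ f : Fin n → A, IsVertexLift φ e f := by
  have : ∀ i, ∃ g : A, IsPrimitiveIdempotent g ∧ φ (e i) * g = g ∧ g * φ (e i) = g ∧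
      g • indGen φ e i = indGen φ e i := by
    intro i
    obtain ⟨g, hg, h₁, h₂, h₃⟩ := exists_isPrimitiveIdempotent_smul_ne_zero K (f := φ (e i))
      (m := indGen φ e i) (by rw [IsIdempotentElem, ← map_mul, D.idem]) (by
        rw [smul_indGen he]; exact D.indGen_ne_zero he K i)
    refine ⟨g, hg, h₁, h₂, ?_⟩
    obtain ⟨c, hc⟩ := D.exists_eq_algebraMap_smul_indGen hφ he (g • indGen φ e i)
    rw [← mul_smul, h₁] at hc
    have hgg : algebraMap K A c • g • indGen φ e i - (1 : A) • g • indGen φ e i = 0 := by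
      rw [← smul_algebraMap_smul, ← hc, ← mul_smul, hg.1.eq, one_smul, sub_self]
    rw [← sub_smul, ← map_one (algebraMap K A), ← map_sub] at hgg
    have hc1 : c - 1 = 0 := by
      by_contra h0
      apply h₃
      have := congrArg (algebraMap K A (c - 1)⁻¹ • ·) hgg
      rwa [← mul_smul, ← map_mul, inv_mul_cancel₀ h0, map_one, one_smul, smul_zero] at this
    rw [hc, sub_eq_zero.1 hc1, map_one, one_smul]
  choose f hf using this
  exact ⟨f, fun i => (hf i).1, fun i => (hf i).2.1, fun i => (hf i).2.2.1, fun i => (hf i).2.2.2⟩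

variable (hf : IsVertexLift φ e f)
include hf

/-- The complement of f i in φ(e i) is invisible on modules supported up to i. There f i acts on the
vertex i through some u in e_i B e_i; since u fixes the generator of S(i) it is not nilpotent, hence
invertible, and an action that is both idempotent and invertible is the identity. -/
theorem smul_eq_map_smul (K : Type v) [Field K] [Algebra K B] [FiniteDimensional K B]
    {i : Fin n} {M : Type u} [AddCommGroup M] [Module A M]
    (hM : ∀ k, i < k → ∀ m : M, φ (e k) • m = 0) (m : M) : f i • m = φ (e i) • m := by
  obtain ⟨u, h₁, h₂, hu⟩ := D.exists_corner i (f i)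
  have hgen : u • simpleGen e i = simpleGen e i := by
    refine D.unit_injective _ ?_
    rw [map_smulₛₗ]
    have := hu (IndMod φ (simpleMod e i))
      (fun k hk t => D.map_smul_ind_simpleMod_eq_zero he K hk t) (indGen φ e i)
      (smul_indGen he i)
    rw [hf.smul_gen, smul_indGen he] at this
    exact this.symm
  obtain ⟨c, -, -, hc, -⟩ := ((he.primitive i).isNilpotent_or_exists_inv K h₁ h₂).resolve_left
    (not_isNilpotent_of_smul_eq (he.simpleGen_ne_zero K i) hgen)
  have key : ∀ m : M, φ (e i) • m = m → f i • m = φ u • m := fun m hm => by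
    rw [← hu M hM m hm, ← mul_smul (φ (e i)), hf.map_mul]
  have key' : ∀ m : M, φ (e i) • m = m → f i • m = m := fun m hm => by
    have h3 : φ u • φ u • m = φ u • m := by
      rw [← key m hm, ← key (f i • m) (by rw [← mul_smul, hf.map_mul]), ← mul_smul,
        (hf.primitive i).1.eq]
    have h4 := congrArg (fun z => φ c • z) h3
    simp only [← mul_smul, ← map_mul] at h4
    rw [← mul_assoc, hc, h₁, hm] at h4
    rw [key m hm, h4]
  rw [← key' (φ (e i) • m) (by rw [← mul_smul, ← map_mul, D.idem]), ← mul_smul, hf.mul_map]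

/-- Descending induction on the vertex: once all higher φ(e k') act as zero, f k and φ(e k) agree on
M. -/
theorem map_smul_eq_zero_of_smul_eq_zero (K : Type v) [Field K] [Algebra K B]
    [FiniteDimensional K B] {i : Fin n} {M : Type u} [AddCommGroup M] [Module A M]
    (hM : ∀ k, i < k → ∀ m : M, f k • m = 0) : ∀ k, i < k → ∀ m : M, φ (e k) • m = 0 := by
  intro k
  induction k using WellFoundedGT.induction with
  | ind k ih =>
    intro hk m
    rw [← D.smul_eq_map_smul he hf K (fun k' hk' => ih k' hk' (hk.trans hk')), hM k hk]

/-- If all f i killed M, the same descending induction would kill every φ(e k), hence M. Applied to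
simple modules this gives completeness of the list A f i. -/
theorem exists_smul_ne_zero (K : Type v) [Field K] [Algebra K B] [FiniteDimensional K B]
    {M : Type u} [AddCommGroup M] [Module A M] {m : M} (hm : m ≠ 0) :
    ∃ i, ∃ m : M, f i • m ≠ 0 := by
  by_contra h
  push Not at h
  refine hm ?_
  rw [← D.sum_map_smul m]
  refine Finset.sum_eq_zero fun k hk => ?_
  clear hk
  induction k using WellFoundedGT.induction generalizing m with
  | ind k ih =>
    rw [← D.smul_eq_map_smul he hf K (fun k' hk' m => ?_), h]
    by_cases h0 : m = 0
    · rw [h0, smul_zero]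
    · exact ih k' hk' h0

theorem isBasicSystem (K : Type v) [Field K] [Algebra K B] [FiniteDimensional K B] [Algebra K A]
    [FiniteDimensional K A] : IsBasicSystem f where
  orthogonal := by
    refine ⟨fun i => (hf.primitive i).1, fun i j hij => ?_⟩
    change f i * f j = 0
    rw [← hf.mul_map i, ← hf.map_mul j, mul_assoc, ← mul_assoc (φ (e i)), ← map_mul,
      D.mul_eq_zero hij, map_zero, zero_mul, mul_zero]
  primitive := hf.primitive
  irredundant := by
    -- For i < j an isomorphism would yield a non-zero map from A f_j to A ⊗ S(i), but the image of
    -- f_j lies in the e_j-component, which is zero.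
    have key : ∀ i j, Nonempty (leftIdeal (f i) ≃ₗ[A] leftIdeal (f j)) → j ≤ i := by
      rintro i j ⟨h⟩
      by_contra hij
      rw [not_le] at hij
      let F := leftIdealLift (f i) (indGen φ e i) ∘ₗ h.symm.toLinearMap
      have h0 : F (leftIdealGen (f j)) = 0 := by
        have hF : (φ (e j) * f j) • F (leftIdealGen (f j)) = F (leftIdealGen (f j)) := by
          rw [hf.map_mul]
          exact smul_map_leftIdealGen (hf.primitive j).1 F
        rw [← hF, mul_smul]
        exact D.map_smul_ind_simpleMod_eq_zero he K hij _
      have h1 : F (h (leftIdealGen (f i))) = 0 := by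
        rw [leftIdeal_map_apply (hf.primitive j).1, h0, smul_zero]
      have h2 : F (h (leftIdealGen (f i))) = indGen φ e i := by
        change leftIdealLift (f i) (indGen φ e i) (h.symm (h (leftIdealGen (f i)))) = _
        rw [h.symm_apply_apply]
        exact hf.smul_gen i
      exact D.indGen_ne_zero he K i (h2.symm.trans h1)
    exact fun i j h => le_antisymm (key j i (h.map LinearEquiv.symm)) (key i j h)
  complete := by
    intro g hg
    have := hg.isSimpleModule K
    have hne := smul_leftIdealGen_mk_ne_zero (K := K) hg
    obtain ⟨i, m, hm⟩ := D.exists_smul_ne_zero he hf K hne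
    exact ⟨i, hg.equiv_of_isSimpleModule K (hf.primitive i) hne hm⟩

end

end IsDirectedExtension

end Idempotents

/-! ### Identification of the proper standard modules with A ⊗ S(i) -/

section ProperStandard

variable {K : Type v} [Field K] [IsAlgClosed K] {B A : Type u} [Ring B] [Ring A] [Algebra K B]
  [Algebra K A] [FiniteDimensional K A] {n : ℕ}

theorem jhMult_simpleMod_ne_zero_iff (K : Type v) [Field K] [IsAlgClosed K] [Algebra K A]
    [FiniteDimensional K A] {f : Fin n → A} (hf : IsBasicSystem f)
    {X : Type u₁} [AddCommGroup X] [Module A X] [Module.Finite A X] (i : Fin n) :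
    jhMult A X (simpleMod f i) ≠ 0 ↔ ∃ x : X, f i • x ≠ 0 :=
  jhMult_ne_zero_iff K (hf.primitive i)

theorem jhMult_simpleMod_eq_one_iff (K : Type v) [Field K] [IsAlgClosed K] [Algebra K A]
    [FiniteDimensional K A] {f : Fin n → A} (hf : IsBasicSystem f)
    {X : Type u₁} [AddCommGroup X] [Module A X] [Module.Finite A X] (i : Fin n) :
    jhMult A X (simpleMod f i) = 1 ↔
      ∃ x : X, x ≠ 0 ∧ f i • x = x ∧ ∀ y : X, f i • y = y → ∃ c : K, y = algebraMap K A c • x :=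
  jhMult_eq_one_iff K (hf.primitive i)

instance (a : A) : Module.Finite A (leftIdeal a) :=
  Module.Finite.iff_fg.2 ⟨{a}, by simp [leftIdeal, Ideal.span]⟩

instance (f : Fin n → A) (i : Fin n) : Module.Finite A (projMod f i) :=
  inferInstanceAs (Module.Finite A (leftIdeal (f i)))

instance (f : Fin n → A) (i : Fin n) : Module.Finite A (standardMod f i) :=
  inferInstanceAs (Module.Finite A (projMod f i ⧸ standardKer f i))

/-- Puts the condition under the infimum into a form visibly stable under intersections, so that the
infimum satisfies it as well. -/
theorem mem_standardKer_set_iff (K : Type v) [Field K] [IsAlgClosed K] [Algebra K A]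
    [FiniteDimensional K A] {f : Fin n → A} (hf : IsBasicSystem f) (i : Fin n)
    (U : Submodule A (projMod f i)) :
    (∀ j, jhMult A (projMod f i ⧸ U) (simpleMod f j) ≠ 0 → j ≤ i) ↔
      ∀ j, i < j → ∀ x : projMod f i, f j • x ∈ U := by
  refine forall_congr' fun j => ?_
  rw [jhMult_simpleMod_ne_zero_iff K hf, ← not_le, ← not_imp_not, not_exists]
  refine imp_congr Iff.rfl ?_
  simp only [not_not]
  rw [U.mkQ_surjective.forall]
  refine forall_congr' fun x => ?_
  rw [← map_smul]
  exact Submodule.Quotient.mk_eq_zero U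

theorem smul_mem_standardKer (K : Type v) [Field K] [IsAlgClosed K] [Algebra K A]
    [FiniteDimensional K A] {f : Fin n → A} (hf : IsBasicSystem f) (i : Fin n) :
    ∀ j, i < j → ∀ x : projMod f i, f j • x ∈ standardKer f i := by
  intro j hj x
  refine Submodule.mem_sInf.2 fun U hU => ?_
  exact (mem_standardKer_set_iff K hf i U).1 hU j hj x

variable [FiniteDimensional K B] {φ : B →+* A}
  (hφ : ∀ c : K, φ (algebraMap K B c) = algebraMap K A c)
  {e : Fin n → B} (he : IsBasicSystem e) (D : IsDirectedExtension φ e)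
  {f : Fin n → A} (hf : IsVertexLift φ e f)

namespace IsDirectedExtension

/-- The projection of `P(i)` onto `A ⊗_B S(i)`. -/
def projToInd (φ : B →+* A) (e : Fin n → B) (f : Fin n → A) (i : Fin n) :
    projMod f i →ₗ[A] IndMod φ (simpleMod e i) :=
  leftIdealLift (f i) (indGen φ e i)

include he hf

theorem projToInd_surjective (i : Fin n) : Function.Surjective (projToInd φ e f i) := by
  intro t
  obtain ⟨a, rfl⟩ := exists_smul_indGen he i t
  exact ⟨a • leftIdealGen (f i), ((leftIdealLift (f i) (indGen φ e i)).map_smul a _).trans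
    (congrArg (a • ·) (hf.smul_gen i))⟩

omit [IsAlgClosed K] [FiniteDimensional K A] in
include hφ D in
/-- A quotient of `P(i)` supported in the vertices up to `i`, on which `f i` has rank one, is a
quotient of `A ⊗_B S(i)`. -/
theorem exists_indLift_eq {i : Fin n} {M : Type u} [AddCommGroup M] [Module A M]
    (hM : ∀ k, i < k → ∀ m : M, f k • m = 0) {x : M} (hx0 : x ≠ 0) (hx : f i • x = x)
    (h : ∀ y : M, f i • y = y → ∃ c : K, y = algebraMap K A c • x) :
    ∃ F : IndMod φ (simpleMod e i) →ₗ[A] M, F (indGen φ e i) = x := by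
  have hM' := D.map_smul_eq_zero_of_smul_eq_zero he hf K hM
  have hact := D.smul_eq_map_smul he hf K hM'
  have hex : φ (e i) • x = x := by rw [← hact, hx]
  let h₀ : leftIdeal (e i) →ₛₗ[φ] M :=
    { toFun := fun b => φ b • x
      map_add' := fun b c => by
        rw [← add_smul, ← map_add]; rfl
      map_smul' := fun b c => by
        rw [← mul_smul, ← map_mul]; rfl }
  -- B e_i has no components below the vertex i and M none above, so b x is concentrated at i, where
  -- M is the line through x.
  have hscal : ∀ b : leftIdeal (e i), ∃ c : K, h₀ b = algebraMap K A c • x := by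
    intro b
    refine h _ ?_
    rw [hact, ← D.sum_map_smul (h₀ b), ]
    rw [Finset.smul_sum]
    refine Finset.sum_congr rfl fun k _ => ?_
    rcases lt_trichotomy k i with hk | rfl | hk
    · have : φ (e k) • h₀ b = 0 := by
        change φ (e k) • φ (b : B) • x = 0
        rw [← mul_smul, ← map_mul, D.smul_leftIdeal_eq_zero hk b.2, map_zero, zero_smul]
      rw [this, smul_zero]
    · rw [← mul_smul, ← map_mul, D.idem]
    · rw [hM' k hk, smul_zero]
  have hgen : h₀ (leftIdealGen (e i)) = x := hex
  -- With image a line, the kernel is maximal, hence equal to the radical of P_B(i), and the map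
  -- descends to S(i).
  have hker : IsCoatom (LinearMap.ker h₀) := by
    refine ⟨fun h => hx0 ?_, fun U hU => ?_⟩
    · rw [← hgen]
      have : leftIdealGen (e i) ∈ LinearMap.ker h₀ := by rw [h]; trivial
      exact this
    · obtain ⟨b, hbU, hb⟩ := SetLike.exists_of_lt hU
      obtain ⟨c, hc⟩ := hscal b
      have hc0 : c ≠ 0 := fun h0 => hb (by
        rw [LinearMap.mem_ker, hc, h0, map_zero, zero_smul])
      refine eq_top_of_leftIdealGen_mem (D.idem i) ?_
      have hmem : b - algebraMap K B c • leftIdealGen (e i) ∈ U := hU.le (by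
        rw [LinearMap.mem_ker, map_sub, map_smulₛₗ, hgen, hc, hφ, sub_self])
      have h2 : algebraMap K B c • leftIdealGen (e i) ∈ U := by
        have := U.sub_mem hbU hmem
        rwa [sub_sub_cancel] at this
      have h3 := U.smul_mem (algebraMap K B c⁻¹) h2
      rwa [← mul_smul, ← map_mul, inv_mul_cancel₀ hc0, map_one, one_smul] at h3
  have hjac := (he.primitive i).jacobson_eq_of_isCoatom K hker
  let h₁ : simpleMod e i →ₛₗ[φ] M := (Module.jacobson B (leftIdeal (e i))).liftQ h₀ hjac.le
  exact ⟨indLift h₁, (indLift_indMk h₁ _).trans hgen⟩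

include hφ D

/-- A ⊗ S(i) is a quotient of P(i) with both defining properties, and by `exists_indLift_eq` it maps
onto every other such quotient. So it is the largest one. -/
theorem nonempty_properStandardMod_equiv (i : Fin n) :
    Nonempty (properStandardMod f i ≃ₗ[A] IndMod φ (simpleMod e i)) := by
  have hbs := D.isBasicSystem he hf K
  have hle : standardKer f i ≤ LinearMap.ker (projToInd φ e f i) := by
    refine sInf_le ((mem_standardKer_set_iff K hbs _ _).2 fun j hj x => ?_)
    rw [LinearMap.mem_ker, map_smul, ← hf.mul_map, mul_smul,
      D.map_smul_ind_simpleMod_eq_zero he K hj, smul_zero]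
  let p : standardMod f i →ₗ[A] IndMod φ (simpleMod e i) :=
    (standardKer f i).liftQ (projToInd φ e f i) hle
  have hp : Function.Surjective p := by
    intro t
    obtain ⟨a, rfl⟩ := projToInd_surjective he hf i t
    exact ⟨(standardKer f i).mkQ a, rfl⟩
  have hpker : properStandardKer f i = LinearMap.ker p := by
    apply le_antisymm
    · refine sInf_le ?_
      let E := p.quotKerEquivOfSurjective hp
      rw [Set.mem_ofPred_eq, jhMult_simpleMod_eq_one_iff K hbs]
      refine ⟨E.symm (indGen φ e i), ?_, ?_, ?_⟩
      · exact fun h => D.indGen_ne_zero he K i (E.symm.map_eq_zero_iff.1 h)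
      · rw [← map_smul, hf.smul_gen]
      · intro y hy
        obtain ⟨c, hc⟩ := D.exists_eq_algebraMap_smul_indGen hφ he (E y)
        refine ⟨c, E.injective ?_⟩
        rw [map_smul, E.apply_symm_apply, ← hc, ← map_smul]
        rw [← hy, ← mul_smul, hf.map_mul]
    · refine le_sInf fun V hV => ?_
      rw [Set.mem_ofPred_eq, jhMult_simpleMod_eq_one_iff K hbs] at hV
      obtain ⟨x, hx0, hx, hV⟩ := hV
      let q : projMod f i →ₗ[A] (standardMod f i ⧸ V) := V.mkQ ∘ₗ (standardKer f i).mkQ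
      have hq : Function.Surjective q := V.mkQ_surjective.comp (standardKer f i).mkQ_surjective
      have hgen : ∀ a : leftIdeal (f i), q a = (a : A) • q (leftIdealGen (f i)) :=
        fun a => leftIdeal_map_apply (hf.primitive i).1 q a
      have hfq : f i • q (leftIdealGen (f i)) = q (leftIdealGen (f i)) :=
        smul_map_leftIdealGen (hf.primitive i).1 q
      have hsupp : ∀ k, i < k → ∀ m : standardMod f i ⧸ V, f k • m = 0 := by
        intro k hk m
        obtain ⟨a, rfl⟩ := hq m
        rw [← map_smul]
        have := smul_mem_standardKer K hbs i k hk a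
        have h0 : (standardKer f i).mkQ (f k • a) = 0 := (Submodule.Quotient.mk_eq_zero _).2 this
        exact (congrArg V.mkQ h0).trans (map_zero V.mkQ)
      have hq0 : q (leftIdealGen (f i)) ≠ 0 := by
        intro h0
        obtain ⟨a, rfl⟩ := hq x
        exact hx0 (by rw [hgen a, h0, smul_zero])
      obtain ⟨c, hc⟩ := hV _ hfq
      have hc0 : c ≠ 0 := by
        rintro rfl
        rw [map_zero, zero_smul] at hc
        exact hq0 hc
      obtain ⟨F, hF⟩ := D.exists_indLift_eq (K := K) hφ he hf hsupp hq0 hfq fun y hy => by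
        obtain ⟨d, hd⟩ := hV y hy
        refine ⟨d * c⁻¹, ?_⟩
        rw [hc, ← mul_smul, ← map_mul, inv_mul_cancel_right₀ hc0, hd]
      intro y hy
      obtain ⟨a, rfl⟩ := (standardKer f i).mkQ_surjective y
      have h1 : projToInd φ e f i a = 0 := hy
      have h2 : (show leftIdeal (f i) from a).1 • indGen φ e i = 0 := h1
      have h3 : q a = 0 := by
        rw [hgen a, ← hF, ← map_smul, h2, map_zero]
      exact (Submodule.Quotient.mk_eq_zero V).1 h3
  exact ⟨(Submodule.quotEquivOfEq _ _ hpker).trans (p.quotKerEquivOfSurjective hp)⟩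

end IsDirectedExtension

end ProperStandard

/-! ### Calculus of filtrations -/

section Filtrations

variable {A : Type u} [Ring A] {n : ℕ} {Θ : Fin n → ModuleCat.{u} A} {J : Set (Fin n)}

theorem nonempty_subquotient_equiv {X : Type u₁} [AddCommGroup X] [Module A X] {Y : Type u₂}
    [AddCommGroup Y] [Module A Y] (i : X →ₗ[A] Y) (hi : Function.Injective i)
    (U V : Submodule A X) {U' V' : Submodule A Y} (hU : U.map i = U') (hV : V.map i = V') :
    Nonempty ((V' ⧸ U'.submoduleOf V') ≃ₗ[A] (V ⧸ U.submoduleOf V)) := by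
  subst hU hV
  refine ⟨(Submodule.Quotient.equiv _ _ (V.equivMapOfInjective i hi) ?_).symm⟩
  ext ⟨y, hy⟩
  constructor
  · rintro ⟨⟨x, hx⟩, hxU, h⟩
    exact ⟨x, hxU, congrArg Subtype.val h⟩
  · rintro ⟨x, hxU, rfl⟩
    obtain ⟨x', hx', h⟩ := hy
    obtain rfl := hi h
    exact ⟨⟨x', hx'⟩, hxU, rfl⟩

theorem HasFiltration.of_subsingleton (X : ModuleCat.{u} A) [Subsingleton X] :
    HasFiltration Θ J X :=
  ⟨0, fun _ => ⊤, rfl, Subsingleton.elim _ _, fun k => k.elim0⟩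

theorem HasFiltration.of_quotient {X : ModuleCat.{u} A} {N : Submodule A X}
    (h : HasFiltration Θ J (ModuleCat.of A N)) {j : Fin n} (hj : j ∈ J)
    (hN : Nonempty ((X ⧸ N) ≃ₗ[A] Θ j)) : HasFiltration Θ J X := by
  obtain ⟨m, F, h0, h1, hF⟩ := h
  refine ⟨m + 1, Fin.cons ⊤ fun k => (F k).map N.subtype, rfl, ?_, fun k => ?_⟩
  · rw [← Fin.succ_last, Fin.cons_succ, h1]
    exact Submodule.map_bot N.subtype
  · refine Fin.cases ?_ (fun k => ?_) k
    · refine ⟨le_top, j, hj, ?_⟩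
      obtain ⟨E⟩ := hN
      obtain ⟨E'⟩ := nonempty_subquotient_equiv (A := A) LinearMap.id Function.injective_id
        N ⊤ (Submodule.map_id N) (Submodule.map_id _)
      have hFN : (F 0).map N.subtype = N := by
        rw [h0]
        exact Submodule.map_subtype_top N
      rw [Fin.castSucc_zero, Fin.cons_zero, Fin.cons_succ, hFN]
      exact ⟨(Submodule.Quotient.equiv (N.submoduleOf ⊤) N Submodule.topEquiv (by
        ext x
        constructor
        · rintro ⟨y, hy, rfl⟩
          exact hy
        · intro hx
          exact ⟨⟨x, trivial⟩, hx, rfl⟩)).trans E⟩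
    · obtain ⟨hle, j', hj', ⟨E⟩⟩ := hF k
      rw [← Fin.succ_castSucc, Fin.cons_succ, Fin.cons_succ]
      refine ⟨Submodule.map_mono hle, j', hj', ?_⟩
      obtain ⟨E'⟩ := nonempty_subquotient_equiv N.subtype N.injective_subtype
        (F k.succ) (F k.castSucc) rfl rfl
      exact ⟨E'.trans E⟩

/-- Recursion on the length of the chain: its first step gives the top factor, and the remaining
steps, intersected with F 1, filter F 1. Later arguments use this instead of explicit chains. -/
theorem HasFiltration.induction {P : ModuleCat.{u} A → Prop}
    (zero : ∀ X : ModuleCat.{u} A, Subsingleton X → P X)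
    (quotient : ∀ (X : ModuleCat.{u} A) (N : Submodule A X) (j : Fin n), j ∈ J →
      Nonempty ((X ⧸ N) ≃ₗ[A] Θ j) → P (ModuleCat.of A N) → P X)
    {X : ModuleCat.{u} A} (h : HasFiltration Θ J X) : P X := by
  obtain ⟨m, F, h0, h1, hF⟩ := h
  induction m generalizing X with
  | zero =>
    refine zero X ((Submodule.subsingleton_iff A).1 (subsingleton_of_bot_eq_top ?_))
    rw [← h0, ← h1]
    rfl
  | succ m ih =>
    have hanti : Antitone F := Fin.antitone_iff_succ_le.2 fun k => (hF k).1
    have hmap : ∀ k : Fin (m + 1), ((F k.succ).submoduleOf (F 1)).map (F 1).subtype = F k.succ :=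
      fun k => by
        rw [Submodule.submoduleOf, Submodule.map_comap_subtype]
        exact inf_eq_right.2 (hanti (Fin.succ_le_succ_iff.2 (Fin.zero_le k)))
    obtain ⟨-, j, hj, ⟨E⟩⟩ := hF 0
    refine quotient X (F 1) j hj ?_ (ih (X := ModuleCat.of A (F 1))
      (fun k => (F k.succ).submoduleOf (F 1)) ?_ ?_ fun k => ?_)
    · rw [Fin.castSucc_zero, h0] at E
      refine ⟨(Submodule.Quotient.equiv ((F 1).submoduleOf ⊤) (F 1) Submodule.topEquiv ?_).symm.trans
        E⟩
      ext x
      constructor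
      · rintro ⟨y, hy, rfl⟩
        exact hy
      · intro hx
        exact ⟨⟨x, trivial⟩, hx, rfl⟩
    · exact Submodule.submoduleOf_self _
    · rw [Fin.succ_last, h1]
      exact (LinearMap.ker_eq_bot (f := (F 1).subtype)).2 (F 1).injective_subtype
    · obtain ⟨hle, j', hj', ⟨E⟩⟩ := hF k.succ
      refine ⟨Submodule.comap_mono hle, j', hj', ?_⟩
      obtain ⟨E'⟩ := nonempty_subquotient_equiv (F 1).subtype (F 1).injective_subtype
        ((F k.succ.succ).submoduleOf (F 1)) ((F k.castSucc.succ).submoduleOf (F 1))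
        (hmap _) (hmap _)
      rw [Fin.succ_castSucc] at E'
      exact ⟨E'.symm.trans E⟩

theorem HasFiltration.of_equiv {X Y : ModuleCat.{u} A} (h : HasFiltration Θ J X)
    (E : X ≃ₗ[A] Y) : HasFiltration Θ J Y := by
  suffices ∀ Y : ModuleCat.{u} A, (X ≃ₗ[A] Y) → HasFiltration Θ J Y from this Y E
  clear E Y
  refine h.induction (P := fun X => ∀ Y : ModuleCat.{u} A, (X ≃ₗ[A] Y) → HasFiltration Θ J Y)
    (fun X _ Y E => ?_) (fun X N j hj hN ih Y E => ?_)
  · have := E.symm.injective.subsingleton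
    exact .of_subsingleton Y
  · refine HasFiltration.of_quotient (N := N.map E.toLinearMap) (ih (ModuleCat.of A _)
      (N.equivMapOfInjective E.toLinearMap E.injective)) hj ?_
    obtain ⟨E'⟩ := hN
    exact ⟨(Submodule.Quotient.equiv N _ E rfl).symm.trans E'⟩

/-- Pull the filtration of Q back along p, peeling off one top factor at a time, until only the
kernel is left. -/
theorem HasFiltration.of_ker {X Q : ModuleCat.{u} A} (p : X →ₗ[A] Q) (hp : Function.Surjective p)
    (hQ : HasFiltration Θ J Q) (h : HasFiltration Θ J (ModuleCat.of A (LinearMap.ker p))) :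
    HasFiltration Θ J X := by
  refine hQ.induction (P := fun Q => ∀ (X : ModuleCat.{u} A) (p : X →ₗ[A] Q),
    Function.Surjective p → HasFiltration Θ J (ModuleCat.of A (LinearMap.ker p)) →
    HasFiltration Θ J X) (fun Q _ X p hp h => ?_) (fun Q N j hj hN ih X p hp h => ?_) X p hp h
  · have : LinearMap.ker p = ⊤ := eq_top_iff.2 fun x _ => Subsingleton.elim (p x) 0
    refine h.of_equiv (Y := X) ((LinearEquiv.ofEq _ _ this).trans Submodule.topEquiv)
  · let p' : N.comap p →ₗ[A] N := p.restrict fun _ hx => hx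
    refine HasFiltration.of_quotient (N := N.comap p) (ih (ModuleCat.of A (N.comap p)) p' ?_
      (h.of_equiv (Y := ModuleCat.of A (LinearMap.ker p')) ?_)) hj ?_
    · rintro ⟨y, hy⟩
      obtain ⟨x, rfl⟩ := hp y
      exact ⟨⟨x, hy⟩, rfl⟩
    · refine LinearEquiv.ofBijective
        (LinearMap.codRestrict (LinearMap.ker p')
          (LinearMap.codRestrict (N.comap p) (LinearMap.ker p).subtype fun x => ?_) fun x => ?_) ?_
      · rw [Submodule.mem_comap, show p ((LinearMap.ker p).subtype x) = 0 from x.2]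
        exact N.zero_mem
      · exact Subtype.ext x.2
      · refine ⟨fun x y h => Subtype.ext (congrArg (fun z => z.1.1) h), fun y => ?_⟩
        exact ⟨⟨y.1.1, congrArg Subtype.val y.2⟩, rfl⟩
    · obtain ⟨E⟩ := hN
      have hs : Function.Surjective (N.mkQ ∘ₗ p) := N.mkQ_surjective.comp hp
      have hk : LinearMap.ker (N.mkQ ∘ₗ p) = N.comap p := by
        rw [LinearMap.ker_comp, Submodule.ker_mkQ]
      exact ⟨((Submodule.quotEquivOfEq _ _ hk.symm).trans
        ((N.mkQ ∘ₗ p).quotKerEquivOfSurjective hs)).trans E⟩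

end Filtrations

/-! ### Filtered modules versus induced modules -/

section InducedFiltrations

variable {B A : Type u} [Ring B] [Ring A] {n : ℕ} {φ : B →+* A} {e : Fin n → B}
  {Θ : Fin n → ModuleCat.{u} A} {J : Set (Fin n)}

instance {X : Type u₁} [AddCommGroup X] [Module B X] [Subsingleton X] :
    Subsingleton (IndMod φ X) := by
  refine subsingleton_of_forall_eq 0 fun t => ?_
  induction t using ind_induction with
  | zero => rfl
  | smul a x => rw [Subsingleton.elim x 0, map_zero, smul_zero]
  | add s t hs ht => rw [hs, ht, add_zero]

theorem finite_isFiniteLength (K : Type v) [Field K] [Algebra K B] [FiniteDimensional K B]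
    (X : Type u₁) [AddCommGroup X] [Module B X] [Module.Finite B X] : IsFiniteLength B X := by
  have : IsArtinianRing B := IsArtinianRing.of_finite K B
  have : IsNoetherianRing B := IsNoetherianRing.of_finite K B
  exact isFiniteLength_iff_isNoetherian_isArtinian.2 ⟨inferInstance, inferInstance⟩

namespace IsDirectedExtension

variable (he : IsBasicSystem e) (D : IsDirectedExtension φ e)
  (hΘ : ∀ j, Nonempty (Θ j ≃ₗ[A] IndMod φ (simpleMod e j)))
include he D hΘ

/-- Exactness of induction turns a composition series of X into a filtration; a factor S(j) occurs
only if e_j acts non-trivially on X. -/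
theorem hasFiltration_of_isFiniteLength (K : Type v) [Field K] [Algebra K B]
    [FiniteDimensional K B] {X : Type u} [AddCommGroup X] [Module B X] (hX : IsFiniteLength B X)
    (hJ : ∀ j, j ∉ J → ∀ x : X, e j • x = 0) : HasFiltration Θ J (ModuleCat.of A (IndMod φ X)) := by
  induction hX with
  | @of_subsingleton X _ _ _ =>
    have : Subsingleton (ModuleCat.of A (IndMod φ X)) := inferInstanceAs (Subsingleton (IndMod φ X))
    exact .of_subsingleton _
  | @of_simple_quotient X _ _ N _ _ ih =>
    obtain ⟨j, ⟨s, hs⟩, ⟨E⟩⟩ := he.exists_simpleMod_equiv K D.sum_eq_one (S := X ⧸ N)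
    have hj : j ∈ J := by
      by_contra hj
      obtain ⟨x, rfl⟩ := N.mkQ_surjective s
      exact hs (by rw [← map_smul, hJ j hj, map_zero])
    have hinj := D.map_injective N.subtype N.injective_subtype
    have hex := D.map_exact N.subtype N.mkQ N.injective_subtype
      (LinearMap.exact_subtype_mkQ N)
    have hsurj := indMap_surjective (φ := φ) N.mkQ_surjective
    refine HasFiltration.of_quotient (N := LinearMap.range (indMap φ N.subtype))
      ((ih fun j hj x => Subtype.ext (hJ j hj x)).of_equiv (Y := ModuleCat.of A _)
        (LinearEquiv.ofInjective _ hinj)) hj ?_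
    obtain ⟨E'⟩ := hΘ j
    exact ⟨(((Submodule.quotEquivOfEq _ _ (LinearMap.exact_iff.1 hex).symm).trans
      ((indMap φ N.mkQ).quotKerEquivOfSurjective hsurj)).trans (indCongr φ E.symm)).trans E'.symm⟩

/-- A direct summand of an induced module has a filtration by the modules `A ⊗_B S(j)`. -/
theorem hasFiltration_of_retract (K : Type v) [Field K] [Algebra K B] [FiniteDimensional K B]
    (c : ℕ) {X : Type u} [AddCommGroup X] [Module B X] [Module.Finite B X]
    (hc : ∀ k : Fin n, c ≤ k → ∀ x : X, e k • x = 0) (hJ : ∀ j, j ∉ J → ∀ x : X, e j • x = 0)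
    {N : Type u} [AddCommGroup N] [Module A N] (s : N →ₗ[A] IndMod φ X)
    (r : IndMod φ X →ₗ[A] N) (hrs : ∀ x, r (s x) = x) :
    HasFiltration Θ J (ModuleCat.of A N) := by
  -- Induction on a bound for the support of X, peeling off its highest vertex i = c.
  induction c generalizing X N with
  | zero =>
    have : Subsingleton X := subsingleton_of_forall_eq 0 fun x => by
      rw [← D.sum_smul x]
      exact Finset.sum_eq_zero fun k _ => hc k (Nat.zero_le _) x
    have : Subsingleton (ModuleCat.of A N) :=
      (Function.LeftInverse.injective hrs).subsingleton
    exact .of_subsingleton _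
  | succ c ih =>
    by_cases hcn : n ≤ c
    · exact ih (fun k hk => absurd k.2 (not_lt.2 (hcn.trans hk))) hJ s r hrs
    obtain ⟨i, rfl⟩ : ∃ i : Fin n, (i : ℕ) = c := ⟨⟨c, not_le.1 hcn⟩, rfl⟩
    have hsupp : ∀ k, i < k → ∀ x : X, e k • x = 0 := fun k hk => hc k (Nat.succ_le_of_lt hk)
    -- This is e_i X. Because i is the highest vertex of X, directedness makes it a submodule.
    let Y : Submodule B X :=
      { carrier := {x | e i • x = x}
        zero_mem' := smul_zero _
        add_mem' := fun {x y} hx hy => by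
          change e i • (x + y) = x + y
          rw [smul_add, show e i • x = x from hx, show e i • y = y from hy]
        smul_mem' := fun b x hx => by
          change e i • b • x = b • x
          conv_rhs => rw [← D.sum_smul (b • x)]
          symm
          refine Finset.sum_eq_single i (fun k _ hk => ?_) fun h => absurd (Finset.mem_univ i) h
          rcases lt_or_gt_of_ne hk with h | h
          · rw [← show e i • x = x from hx, ← mul_smul, ← mul_smul,
              D.directed h, zero_smul]
          · exact hsupp k h _ }
    have hβα := D.map_exact Y.subtype Y.mkQ Y.injective_subtype (LinearMap.exact_subtype_mkQ Y)
    have hα := D.map_injective Y.subtype Y.injective_subtype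
    have hβ := indMap_surjective (φ := φ) Y.mkQ_surjective
    let p := (indMap φ Y.mkQ) ∘ₗ s
    -- The part of Y fixed by the projection s r. By `support`, r(1 ⊗ y) with y in Y is already r(1
    -- ⊗ y') for some y' in Y'. Hence ker p is a copy of A ⊗ Y', while N / ker p is a retract of A ⊗
    -- (X / Y), in which the vertex i no longer occurs.
    let Y' : Submodule B Y :=
      { carrier := {y | s (r (indMk φ X y)) = indMk φ X y}
        zero_mem' := by
          change s (r (indMk φ X 0)) = indMk φ X 0
          rw [(indMk φ X).map_zero, r.map_zero, s.map_zero]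
        add_mem' := fun {x y} hx hy => by
          change s (r (indMk φ X (x + y))) = indMk φ X (x + y)
          simp only [map_add]
          rw [show s (r (indMk φ X x)) = _ from hx, show s (r (indMk φ X y)) = _ from hy]
        smul_mem' := fun b x hx => by
          change s (r (indMk φ X (b • x))) = indMk φ X (b • x)
          rw [map_smulₛₗ, map_smul, map_smul, show s (r (indMk φ X x)) = _ from hx] }
    let incl : Y' →ₗ[B] X := Y.subtype ∘ₗ Y'.subtype
    have hincl : Function.Injective incl := Y.injective_subtype.comp Y'.injective_subtype
    let θ := r ∘ₗ indMap φ incl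
    have hsθ : ∀ t, s (θ t) = indMap φ incl t := fun t => LinearMap.congr_fun
      (f := s ∘ₗ θ) (g := indMap φ incl) (ind_hom_ext fun y => y.2) t
    have hY : ∀ y : Y, ∃ y' : Y', r (indMk φ X y) = θ (indMk φ Y' y') := by
      intro y
      have hy : e i • (y : X) = y := y.2
      obtain ⟨x, hx, ht⟩ := D.exists_eq_indMk hsupp (s (r (indMk φ X y)))
      rw [← map_smul, ← map_smul, ← map_smulₛₗ, hy] at ht
      refine ⟨⟨⟨x, hx⟩, ?_⟩, ?_⟩
      · change s (r (indMk φ X x)) = indMk φ X x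
        rw [← ht, hrs]
      · change _ = r (indMk φ X x)
        rw [← ht, hrs]
    have hY' : ∀ t : IndMod φ Y, ∃ t', r (indMap φ Y.subtype t) = θ t' := by
      intro t
      induction t using ind_induction with
      | zero => exact ⟨0, by simp only [map_zero]⟩
      | smul a y =>
        obtain ⟨y', hy'⟩ := hY y
        exact ⟨a • indMk φ Y' y', by rw [map_smul, map_smul, map_smul, ← hy']; rfl⟩
      | add t₁ t₂ h₁ h₂ =>
        obtain ⟨t₁', h₁⟩ := h₁
        obtain ⟨t₂', h₂⟩ := h₂
        exact ⟨t₁' + t₂', by simp only [map_add, h₁, h₂]⟩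
    have hθ : Function.Injective θ := fun t t' h => D.map_injective incl hincl (by
      rw [← hsθ, ← hsθ, h])
    have hpθ : ∀ t, p (θ t) = 0 := fun t => by
      change indMap φ Y.mkQ (s (θ t)) = 0
      rw [hsθ]
      refine LinearMap.congr_fun (f := indMap φ Y.mkQ ∘ₗ indMap φ incl) (g := 0)
        (ind_hom_ext fun y => ?_) t
      change indMk φ _ (Y.mkQ ((y : Y) : X)) = 0
      rw [show Y.mkQ ((y : Y) : X) = 0 from (Submodule.Quotient.mk_eq_zero Y).2 (y : Y).2, map_zero]
    have hker : LinearMap.range θ = LinearMap.ker p := by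
      apply le_antisymm
      · rintro _ ⟨t, rfl⟩
        exact hpθ t
      · intro x hx
        obtain ⟨t, ht⟩ := (hβα (s x)).1 hx
        obtain ⟨t', ht'⟩ := hY' t
        exact ⟨t', by rw [← ht', ht, hrs]⟩
    have : IsNoetherian B X :=
      (isFiniteLength_iff_isNoetherian_isArtinian.1 (finite_isFiniteLength K X)).1
    have hfin : Module.Finite B Y' := inferInstance
    have hZ : ∀ y ∈ Y, ((LinearMap.ker p).mkQ ∘ₗ r) (indMk φ X y) = 0 := by
      intro y hy
      obtain ⟨y', h⟩ := hY ⟨y, hy⟩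
      change (LinearMap.ker p).mkQ (r (indMk φ X y)) = 0
      rw [show r (indMk φ X y) = _ from h]
      exact (Submodule.Quotient.mk_eq_zero _).2 (hpθ _)
    let r' : IndMod φ (X ⧸ Y) →ₗ[A] N ⧸ LinearMap.ker p :=
      indLift (Y.liftQ (((LinearMap.ker p).mkQ ∘ₗ r).comp (indMk φ X)) hZ)
    have hr' : ∀ t, r' (indMap φ Y.mkQ t) = (LinearMap.ker p).mkQ (r t) := fun t =>
      LinearMap.congr_fun (f := r' ∘ₗ indMap φ Y.mkQ) (g := (LinearMap.ker p).mkQ ∘ₗ r)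
        (ind_hom_ext fun x => indLift_indMk _ _) t
    refine HasFiltration.of_ker (X := ModuleCat.of A N) (Q := ModuleCat.of A (N ⧸ LinearMap.ker p))
      (LinearMap.ker p).mkQ (LinearMap.ker p).mkQ_surjective ?_ ?_
    · refine ih (X := X ⧸ Y) (fun k hk z => ?_) (fun j hj z => ?_)
        ((LinearMap.ker p).liftQ p le_rfl) r' fun z => ?_
      · obtain ⟨x, rfl⟩ := Y.mkQ_surjective z
        rw [← map_smul]
        rcases hk.eq_or_lt with h | h
        · obtain rfl : i = k := Fin.ext h
          refine (Submodule.Quotient.mk_eq_zero Y).2 ?_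
          change e i • e i • x = e i • x
          rw [← mul_smul, D.idem]
        · rw [hsupp k h, map_zero]
      · obtain ⟨x, rfl⟩ := Y.mkQ_surjective z
        rw [← map_smul, hJ j hj, map_zero]
      · obtain ⟨x, rfl⟩ := (LinearMap.ker p).mkQ_surjective z
        change r' (indMap φ Y.mkQ (s x)) = _
        rw [hr', hrs]
    · refine (D.hasFiltration_of_isFiniteLength he hΘ K (finite_isFiniteLength K Y')
        (J := J) fun j hj y => hincl ?_).of_equiv (Y := ModuleCat.of A _) ?_
      · rw [map_smul, hJ j hj, map_zero]
      · exact ((LinearEquiv.ofInjective θ hθ).trans (LinearEquiv.ofEq _ _ hker)).trans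
          (LinearEquiv.ofEq _ _ (Submodule.ker_mkQ _).symm)

omit he hΘ in
/-- The restriction of an `A`-linear map to `B`. -/
def resMap {M N : Type u} [AddCommGroup M] [Module A M] [AddCommGroup N] [Module A N]
    (φ : B →+* A) (h : M →ₗ[A] N) : Res φ M →ₗ[B] Res φ N where
  toFun := h
  map_add' := h.map_add
  map_smul' b m := h.map_smul (φ b) m

omit he hΘ in
/-- Extensions of induced modules are induced. -/
theorem exists_ind_equiv_of_exact {X' S M : Type u} [AddCommGroup X'] [Module B X']
    [Module.Finite B X'] [AddCommGroup S] [Module B S] [Module.Finite B S]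
    [AddCommGroup M] [Module A M] (i : IndMod φ X' →ₗ[A] M) (p : M →ₗ[A] IndMod φ S)
    (hi : Function.Injective i) (hip : Function.Exact i p) (hp : Function.Surjective p) :
    ∃ (X : Type u) (_ : AddCommGroup X) (_ : Module B X), Module.Finite B X ∧
      Nonempty (IndMod φ X ≃ₗ[A] M) := by
  -- The projection of A ⊗ X' onto the cokernel of its unit extends over i to a B-linear map g on M.
  -- The part of ker g lying over 1 ⊗ S is an extension X of S by X', and comparing the two exact
  -- sequences gives A ⊗ X ≅ M.
  obtain ⟨g, hg⟩ := (D.injective_coker X').out (resMap φ i) hi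
    (LinearMap.range (toRes (indMk φ X'))).mkQ
  let pR := resMap φ p
  let X : Submodule B (Res φ M) := LinearMap.ker g ⊓ (LinearMap.range (toRes (indMk φ S))).comap pR
  let ι : X →ₛₗ[φ] M := (resId φ M).comp X.subtype
  have hηS : Function.Injective (toRes (indMk φ S)) := D.unit_injective S
  let b : X →ₗ[B] S := (LinearEquiv.ofInjective (toRes (indMk φ S)) hηS).symm.toLinearMap ∘ₗ
    pR.restrict fun x hx => hx.2
  have hb : ∀ x : X, indMk φ S (b x) = p (ι x) := fun x =>
    congrArg Subtype.val ((LinearEquiv.ofInjective (toRes (indMk φ S)) hηS).apply_symm_apply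
      ⟨pR x, x.2.2⟩)
  have hX' : ∀ x', toRes (i.comp (indMk φ X')) x' ∈ X := fun x' => by
    refine ⟨?_, 0, ?_⟩
    · exact (hg (indMk φ X' x')).trans ((Submodule.Quotient.mk_eq_zero _).2 ⟨x', rfl⟩)
    · rw [map_zero]
      exact (hip.apply_apply_eq_zero _).symm
  let a : X' →ₗ[B] X := (toRes (i.comp (indMk φ X'))).codRestrict X hX'
  have ha : ∀ x', ι (a x') = i (indMk φ X' x') := fun x' => rfl
  have hker : ∀ x, b x = 0 → ∃ x', a x' = x := fun x hx => by
    have h0 : p (ι x) = 0 := by rw [← hb, hx, map_zero]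
    obtain ⟨t, ht⟩ := (hip _).1 h0
    have h1 : g (resMap φ i t) = 0 := by
      rw [show resMap φ i t = (x : Res φ M) from ht]
      exact x.2.1
    obtain ⟨x', hx'⟩ := (Submodule.Quotient.mk_eq_zero _).1 ((hg t).symm.trans h1)
    refine ⟨x', Subtype.ext ?_⟩
    change i (indMk φ X' x') = _
    rw [show indMk φ X' x' = t from hx']
    exact ht
  have hab : Function.Exact a b := by
    intro x
    refine ⟨hker x, ?_⟩
    rintro ⟨x', rfl⟩
    apply D.unit_injective S
    rw [hb, ha, hip.apply_apply_eq_zero, map_zero]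
  have hainj : Function.Injective a := fun x y h => D.unit_injective X' (hi (by
    rw [← ha, ← ha, h]))
  have hbsurj : Function.Surjective b := by
    intro s
    obtain ⟨m, hm⟩ := hp (indMk φ S s)
    -- Correct the lift m of 1 ⊗ s by an element of A ⊗ X' with the same value under g; p does not
    -- see the correction.
    obtain ⟨t, ht⟩ := Submodule.mkQ_surjective _ (g (show Res φ M from m))
    have hpt : p (m - i (show IndMod φ X' from t)) = indMk φ S s := by
      rw [map_sub, hip.apply_apply_eq_zero, sub_zero, hm]
    refine ⟨⟨(show Res φ M from m) - resMap φ i t, ?_, s, hpt.symm⟩, ?_⟩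
    · change g _ = 0
      rw [map_sub, hg, ht, sub_self]
    · apply D.unit_injective S
      rw [hb]
      exact hpt
  have hfin : Module.Finite B X := by
    refine ⟨Submodule.fg_of_fg_map_of_fg_inf_ker b ?_ ?_⟩
    · rw [Submodule.map_top, LinearMap.range_eq_top.2 hbsurj]
      exact Module.Finite.fg_top
    · rw [top_inf_eq, LinearMap.exact_iff.1 hab, ← Submodule.map_top]
      exact Module.Finite.fg_top.map a
  refine ⟨X, inferInstance, inferInstance, hfin, ⟨LinearEquiv.ofBijective (indLift ι) ⟨?_, ?_⟩⟩⟩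
  · rw [← LinearMap.ker_eq_bot, LinearMap.ker_eq_bot']
    intro t ht
    have h1 : indMap φ b t = 0 := by
      rw [show indMap φ b t = p (indLift ι t) from LinearMap.congr_fun (f := indMap φ b)
        (g := p ∘ₗ indLift ι) (ind_hom_ext fun x => by
          rw [indMap_indMk, hb, LinearMap.comp_apply]
          exact congrArg p (indLift_indMk ι x).symm) t, ht, map_zero]
    obtain ⟨t', rfl⟩ := (D.map_exact a b hainj hab t).1 h1
    have h2 : indLift ι (indMap φ a t') = i t' := LinearMap.congr_fun
      (f := indLift ι ∘ₗ indMap φ a) (g := i) (ind_hom_ext fun x => by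
        rw [LinearMap.comp_apply, indMap_indMk, indLift_indMk, ha]) t'
    rw [h2] at ht
    rw [hi (ht.trans (map_zero i).symm), map_zero]
  · intro m
    obtain ⟨t, ht⟩ := indMap_surjective (φ := φ) hbsurj (p m)
    have h1 : p (indLift ι t) = p m := by
      rw [← ht]
      exact (LinearMap.congr_fun (f := indMap φ b)
        (g := p ∘ₗ indLift ι) (ind_hom_ext fun x => by
          rw [indMap_indMk, hb, LinearMap.comp_apply]
          exact congrArg p (indLift_indMk ι x).symm) t).symm
    obtain ⟨t', ht'⟩ := (hip (m - indLift ι t)).1 (by rw [map_sub, h1, sub_self])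
    have h2 : indLift ι (indMap φ a t') = i t' := LinearMap.congr_fun
      (f := indLift ι ∘ₗ indMap φ a) (g := i) (ind_hom_ext fun x => by
        rw [LinearMap.comp_apply, indMap_indMk, indLift_indMk, ha]) t'
    exact ⟨indMap φ a t' + t, by rw [map_add, h2, ht', sub_add_cancel]⟩

omit he in
/-- Every module with a filtration by the modules `A ⊗_B S(j)` is induced. -/
theorem exists_ind_equiv_of_hasFiltration {M : ModuleCat.{u} A} (hM : HasFiltration Θ J M) :
    ∃ (X : Type u) (_ : AddCommGroup X) (_ : Module B X), Module.Finite B X ∧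
      Nonempty (IndMod φ X ≃ₗ[A] M) := by
  refine hM.induction (P := fun M => ∃ (X : Type u) (_ : AddCommGroup X) (_ : Module B X),
    Module.Finite B X ∧ Nonempty (IndMod φ X ≃ₗ[A] M)) (fun M _ => ?_) (fun M N j hj hN ih => ?_)
  · exact ⟨PUnit, inferInstance, inferInstance, inferInstance,
      ⟨LinearEquiv.ofBijective (0 : IndMod φ PUnit.{u + 1} →ₗ[A] M)
        ⟨fun _ _ _ => Subsingleton.elim _ _, fun m => ⟨0, Subsingleton.elim _ _⟩⟩⟩⟩
  · obtain ⟨X', _, _, _, ⟨E⟩⟩ := ih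
    obtain ⟨E₁⟩ := hN
    obtain ⟨E₂⟩ := hΘ j
    let i : IndMod φ X' →ₗ[A] M := N.subtype ∘ₗ E.toLinearMap
    let p : M →ₗ[A] IndMod φ (simpleMod e j) := (E₁.trans E₂).toLinearMap ∘ₗ N.mkQ
    have : Module.Finite B (simpleMod e j) :=
      inferInstanceAs (Module.Finite B (projMod e j ⧸ Module.jacobson B (projMod e j)))
    refine D.exists_ind_equiv_of_exact i p (N.injective_subtype.comp E.injective) ?_
      ((E₁.trans E₂).surjective.comp N.mkQ_surjective)
    intro m
    constructor
    · intro h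
      have : N.mkQ m = 0 := (E₁.trans E₂).map_eq_zero_iff.1 h
      obtain ⟨t, ht⟩ := E.surjective ⟨m, (Submodule.Quotient.mk_eq_zero N).1 this⟩
      exact ⟨t, congrArg Subtype.val ht⟩
    · rintro ⟨t, rfl⟩
      have : N.mkQ (E t : N) = 0 := (Submodule.Quotient.mk_eq_zero N).2 (E t : N).2
      exact (congrArg (E₁.trans E₂) this).trans (map_zero _)

end IsDirectedExtension

end InducedFiltrations

/-! ### Ext along an exact left adjoint whose unit has injective cokernels -/

section ExtComparison

open Limits Abelian

universe w w' v₁ v₂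

variable {C : Type u₁} [Category.{v₁} C] [Abelian C] {D : Type u₂} [Category.{v₂} D] [Abelian D]
  {F : C ⥤ D} {U : D ⥤ C} (adj : F ⊣ U) [F.Additive]

include adj

/-- Pass to the adjoint map X ⟶ U F Y. Its image in the injective cokernel of the unit extends to P,
and the extension lifts to U F Y because P is projective. After subtracting this lift, the map lands
in Y. -/
theorem exists_map_add_of_injective_cokernel {Y : C} [Mono (adj.unit.app Y)]
    [Injective (cokernel (adj.unit.app Y))] {X P : C} [Projective P] (f : X ⟶ P) [Mono f]
    (h : F.obj X ⟶ F.obj Y) :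
    ∃ (k : X ⟶ Y) (l : F.obj P ⟶ F.obj Y), h = F.map k + F.map f ≫ l := by
  let η : Y ⟶ U.obj (F.obj Y) := adj.unit.app Y
  let h' : X ⟶ U.obj (F.obj Y) := adj.homEquiv _ _ h
  let l' : P ⟶ U.obj (F.obj Y) :=
    Projective.factorThru (Injective.factorThru (h' ≫ cokernel.π η) f) (cokernel.π η)
  have hl : f ≫ l' ≫ cokernel.π η = h' ≫ cokernel.π η := by
    rw [Projective.factorThru_comp, Injective.comp_factorThru]
  let k : X ⟶ Y := Abelian.monoLift η (h' - f ≫ l') (by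
    rw [Preadditive.sub_comp, Category.assoc, hl, sub_self])
  have hk : k ≫ η = h' - f ≫ l' := Abelian.monoLift_comp _ _ _
  refine ⟨k, (adj.homEquiv _ _).symm l', ?_⟩
  have h1 : h = (adj.homEquiv _ _).symm (k ≫ η + f ≫ l') := by
    rw [hk, sub_add_cancel, Equiv.symm_apply_apply]
  rw [h1, Adjunction.homEquiv_counit, Adjunction.homEquiv_counit, F.map_add, Preadditive.add_comp,
    F.map_comp, F.map_comp, Category.assoc, Category.assoc]
  congr 1
  rw [adj.left_triangle_components, Category.comp_id]

variable [PreservesFiniteLimits F] [PreservesFiniteColimits F] [HasExt.{w} C] [HasExt.{w'} D]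
  [EnoughProjectives C] [U.PreservesEpimorphisms]

omit adj [Abelian C] [F.Additive] [PreservesFiniteLimits F] [PreservesFiniteColimits F]
  [HasExt.{w} C] [EnoughProjectives C] [U.PreservesEpimorphisms] in
theorem extClass_comp_mk₀_comp {T : ShortComplex D} (hT : T.ShortExact) {Z : D} (l : T.X₂ ⟶ Z) :
    hT.extClass.comp (Ext.mk₀ (T.f ≫ l)) (add_zero 1) = 0 := by
  rw [← Ext.mk₀_comp_mk₀]
  exact hT.extClass_comp_assoc _

omit [Abelian C] [F.Additive] [PreservesFiniteLimits F] [PreservesFiniteColimits F] [HasExt.{w} C]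
  [EnoughProjectives C] in
-- F preserves projectives, because its right adjoint preserves epimorphisms.
theorem ext_obj_eq_zero_of_projective {P : C} [Projective P] {Y : D} {k : ℕ} (hk : 1 ≤ k)
    (x : Ext (F.obj P) Y k) : x = 0 := by
  obtain ⟨k, rfl⟩ := Nat.exists_eq_add_of_le' hk
  have : Projective (F.obj P) := adj.map_projective P inferInstance
  exact Ext.eq_zero_of_projective x

omit [U.PreservesEpimorphisms] in
-- Represent x by a map h from a syzygy to Y. If F x = 0, then h followed by the unit extends over
-- the projective cover term, so x dies in Ext¹(X, U F Y) and is the connecting image of some g from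
-- X to the cokernel of the unit. Here the embedding of X into P enters: g extends to P by
-- injectivity and then lifts to U F Y, so its connecting image is zero.
theorem mapExactFunctor_one_injective {Y : C} [Mono (adj.unit.app Y)]
    [Injective (cokernel (adj.unit.app Y))] {X P : C} [Projective P] (f : X ⟶ P) [Mono f]
    (x : Ext X Y 1) (hx : x.mapExactFunctor F = 0) : x = 0 := by
  let η : Y ⟶ U.obj (F.obj Y) := adj.unit.app Y
  let p : ProjectivePresentation X := Classical.arbitrary _
  have := p.projective
  let S := ShortComplex.mk _ _ (kernel.condition p.f)
  have hS : S.ShortExact := { exact := ShortComplex.exact_kernel p.f }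
  obtain ⟨y, rfl⟩ := Ext.contravariant_sequence_exact₃ hS Y x (Ext.eq_zero_of_projective _)
    (add_zero 1)
  obtain ⟨h, rfl⟩ := (Ext.mk₀_bijective _ _).2 y
  rw [Ext.mapExactFunctor_comp, Ext.mapExactFunctor_extClass, Ext.mapExactFunctor_mk₀] at hx
  obtain ⟨z, hz⟩ := Ext.contravariant_sequence_exact₁ (hS.map_of_exact F) _ _ _ hx
  obtain ⟨l, rfl⟩ := (Ext.mk₀_bijective _ _).2 z
  rw [Ext.mk₀_comp_mk₀] at hz
  have hl : F.map (kernel.ι p.f) ≫ l = F.map h := (Ext.mk₀_bijective _ _).1 hz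
  have hη : h ≫ η = kernel.ι p.f ≫ adj.homEquiv _ _ l := by
    refine Eq.trans ?_ ((congrArg (adj.homEquiv _ _) hl).symm.trans
      (adj.homEquiv_naturality_left (kernel.ι p.f) l))
    rw [Adjunction.homEquiv_unit]
    exact adj.unit.naturality h
  let T := ShortComplex.mk η (cokernel.π η) (cokernel.condition η)
  have hT : T.ShortExact := { exact := ShortComplex.exact_cokernel η, mono_f := ‹_› }
  obtain ⟨g, hg⟩ := Ext.covariant_sequence_exact₁ X hT (hS.extClass.comp (Ext.mk₀ h) (add_zero 1))
    (by
      rw [Ext.comp_assoc_of_third_deg_zero, Ext.mk₀_comp_mk₀]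
      change hS.extClass.comp (Ext.mk₀ (h ≫ η)) _ = 0
      rw [hη, ← Ext.mk₀_comp_mk₀]
      exact hS.extClass_comp_assoc _) (zero_add 1)
  rw [← hg]
  obtain ⟨g, rfl⟩ := (Ext.mk₀_bijective _ _).2 g
  have hgf : g = f ≫ Projective.factorThru (Injective.factorThru g f) (cokernel.π η) ≫
      cokernel.π η := by
    rw [Projective.factorThru_comp, Injective.comp_factorThru]
  rw [hgf, ← Category.assoc, ← Ext.mk₀_comp_mk₀, Ext.comp_assoc _ _ _ (add_zero 0) (zero_add 1) (zero_add 1)]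
  change Ext.comp _ ((Ext.mk₀ T.g).comp hT.extClass _) _ = 0
  rw [hT.comp_extClass, Ext.comp_zero]

variable [∀ Y, Mono (adj.unit.app Y)] [∀ Y, Injective (cokernel (adj.unit.app Y))]

/-- In degree one a class is given by a map out of F of a syzygy. By
`exists_map_add_of_injective_cokernel` this is F of a map up to one extending over a projective,
which contributes nothing to Ext¹. Higher degrees follow by dimension shift. -/
theorem mapExtAddHom_surjective_of_injective_cokernel {k : ℕ} (hk : 1 ≤ k) (X Y : C) :
    Function.Surjective (F.mapExtAddHom X Y k) := by
  induction k, hk using Nat.le_induction generalizing X with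
  | base =>
    intro x
    let p : ProjectivePresentation X := Classical.arbitrary _
    have := p.projective
    let S := ShortComplex.mk _ _ (kernel.condition p.f)
    have hS : S.ShortExact := { exact := ShortComplex.exact_kernel p.f }
    obtain ⟨y, rfl⟩ := Ext.contravariant_sequence_exact₃ (hS.map_of_exact F) _ x
      (ext_obj_eq_zero_of_projective adj (P := p.p) le_rfl _) (add_zero 1)
    obtain ⟨h, rfl⟩ := (Ext.mk₀_bijective _ _).2 y
    obtain ⟨k, l, hkl⟩ := exists_map_add_of_injective_cokernel adj (kernel.ι p.f) h
    refine ⟨hS.extClass.comp (Ext.mk₀ k) (add_zero 1), ?_⟩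
    rw [Functor.mapExtAddHom_apply, Ext.mapExactFunctor_comp, Ext.mapExactFunctor_extClass,
      Ext.mapExactFunctor_mk₀]
    have h₀ := extClass_comp_mk₀_comp (hS.map_of_exact F) (Z := F.obj Y) l
    refine Eq.symm ((congrArg (fun y => (hS.map_of_exact F).extClass.comp y (add_zero 1))
      ((congrArg Ext.mk₀ hkl).trans (Ext.mk₀_add _ _))).trans ?_)
    exact (Ext.comp_add _ _ _ _).trans ((congrArg _ h₀).trans (add_zero _))
  | succ k hk ih =>
    intro x
    let p : ProjectivePresentation X := Classical.arbitrary _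
    have := p.projective
    let S := ShortComplex.mk _ _ (kernel.condition p.f)
    have hS : S.ShortExact := { exact := ShortComplex.exact_kernel p.f }
    obtain ⟨y, rfl⟩ := Ext.contravariant_sequence_exact₃ (hS.map_of_exact F) _ x
      (ext_obj_eq_zero_of_projective adj (P := p.p) (Nat.le_add_left 1 k) _) (add_comm 1 k)
    obtain ⟨y, rfl⟩ := ih _ y
    refine ⟨hS.extClass.comp y (add_comm 1 k), ?_⟩
    rw [Functor.mapExtAddHom_apply, Ext.mapExactFunctor_comp, Ext.mapExactFunctor_extClass]
    rfl

/-- One dimension shift replaces X by a syzygy, which embeds into a projective as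
`mapExactFunctor_one_injective` requires. This is why the range starts at 2. -/
theorem mapExtAddHom_injective_of_injective_cokernel {k : ℕ} (hk : 2 ≤ k) (X Y : C) :
    Function.Injective (F.mapExtAddHom X Y k) := by
  suffices ∀ x : Ext X Y k, x.mapExactFunctor F = 0 → x = 0 from
    (injective_iff_map_eq_zero _).2 this
  have key : ∀ (k : ℕ) (X : C), 1 ≤ k → (∀ (P X₁ : C) (_ : Projective P) (f : X₁ ⟶ P) (_ : Mono f)
      (y : Ext X₁ Y k), y.mapExactFunctor F = 0 → y = 0) →
      ∀ x : Ext X Y (k + 1), x.mapExactFunctor F = 0 → x = 0 := by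
    intro k X hk ih x hx
    let p : ProjectivePresentation X := Classical.arbitrary _
    have := p.projective
    let S := ShortComplex.mk _ _ (kernel.condition p.f)
    have hS : S.ShortExact := { exact := ShortComplex.exact_kernel p.f }
    obtain ⟨y, rfl⟩ := Ext.contravariant_sequence_exact₃ hS Y x (Ext.eq_zero_of_projective _)
      (add_comm 1 k)
    rw [Ext.mapExactFunctor_comp, Ext.mapExactFunctor_extClass] at hx
    obtain ⟨z, hz⟩ := Ext.contravariant_sequence_exact₁ (hS.map_of_exact F) _ _ _ hx
    obtain rfl : z = 0 := ext_obj_eq_zero_of_projective adj (P := p.p) hk z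
    rw [Ext.comp_zero] at hz
    rw [ih p.p _ p.projective (kernel.ι p.f) inferInstance y hz.symm, Ext.comp_zero]
  induction k, hk using Nat.le_induction generalizing X with
  | base => exact key 1 X le_rfl fun P X₁ _ f _ y hy => mapExactFunctor_one_injective adj f y hy
  | succ k hk ih => exact key k X (by omega) fun _ X₁ _ _ _ y hy => ih X₁ y hy

end ExtComparison

/-! ### The Burt–Butler algebra: R ⊗_B X as Hom_𝓑(B, X) -/

namespace BTensor

variable {B : Type u₁} [Ring B] {M : Type u₂} [AddCommGroup M] [Module B M] [Module Bᵐᵒᵖ M]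
  [SMulCommClass B Bᵐᵒᵖ M]

variable (B M) in
/-- The isomorphism `M ⊗_B B ≃ M` of left modules. -/
def ridEquiv : BTensor B M B ≃ₗ[B] M where
  toFun := rid B M
  map_add' := map_add _
  map_smul' b t := by
    induction t using BTensor.induction with
    | zero => simp
    | tmul m x => exact (smul_comm b (op x) m).symm
    | add s t hs ht => rw [smul_add, map_add, hs, ht, map_add, smul_add]
  invFun m := tmul B m 1
  left_inv t := by
    change tmul B (rid B M t) 1 = t
    induction t using BTensor.induction with
    | zero =>
      rw [map_zero]
      exact add_eq_left.1 ((add_tmul (0 : M) 0 (1 : B)).symm.trans (by rw [add_zero]))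
    | tmul m x => rw [rid_tmul, op_smul_tmul, smul_eq_mul, mul_one]
    | add s t hs ht => rw [map_add, add_tmul, hs, ht]
  right_inv m := by rw [rid_tmul, op_one, one_smul]

theorem ridEquiv_symm_apply (m : M) : (ridEquiv B M).symm m = tmul B m 1 := rfl

omit [Module B M] [SMulCommClass B Bᵐᵒᵖ M] in
theorem tmul_eq_op_smul_tmul_one (m : M) (b : B) : tmul B m b = tmul B (op b • m) 1 := by
  rw [op_smul_tmul, smul_eq_mul, mul_one]

end BTensor

namespace Bocs

variable {K : Type v} [Field K] {B : Type u} [Ring B] [Algebra K B] {W : Type u}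
  [AddCommGroup W] [Module K W] [Module B W] [Module Bᵐᵒᵖ W] [SMulCommClass B Bᵐᵒᵖ W]
  [IsScalarTower K B W] [IsScalarTower K Bᵐᵒᵖ W] (𝓑 : Bocs K B W)

/-- The canonical embedding of `B` into `R`, as a ring homomorphism. -/
abbrev burtButlerHom : B →+* 𝓑.RightBurtButler := 𝓑.toRightBurtButler

variable {X : Type u} [AddCommGroup X] [Module B X] {Y : Type u} [AddCommGroup Y] [Module B Y]
  {Z : Type u} [AddCommGroup Z] [Module B Z]

theorem compHom_comp_unitHom (f : BTensor B W X →ₗ[B] Y) (g : Y →ₗ[B] Z) :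
    𝓑.compHom f (g ∘ₗ 𝓑.unitHom Y) = g ∘ₗ f :=
  LinearMap.ext fun t => congrArg g (LinearMap.congr_fun (𝓑.compHom_unitHom f) t)

theorem comp_unitHom_compHom (f : X →ₗ[B] Y) (g : BTensor B W Y →ₗ[B] Z) :
    𝓑.compHom (f ∘ₗ 𝓑.unitHom X) g = g ∘ₗ BTensor.lmap B W f := by
  rw [← 𝓑.unitHom_compHom (g ∘ₗ BTensor.lmap B W f)]
  refine LinearMap.ext fun t => congrArg g ?_
  generalize (BTensor.assoc _ : BTensor B W (BTensor B W X)) = s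
  induction s using BTensor.induction with
  | zero => simp only [map_zero]
  | tmul m n => rfl
  | add s t hs ht => rw [map_add, hs, ht, map_add, map_add]

/-- The left `R`-module structure on `Hom_𝓑(B, X)`. -/
instance : Module 𝓑.RightBurtButler (BTensor B W B →ₗ[B] X) where
  smul r h := 𝓑.compHom (MulOpposite.unop r) h
  one_smul h := 𝓑.unitHom_compHom h
  mul_smul _ _ h := 𝓑.compHom_assoc _ _ h
  smul_zero _ := rfl
  smul_add _ _ _ := rfl
  add_smul _ _ h := 𝓑.add_compHom _ _ h
  zero_smul h := add_eq_left.1 ((𝓑.add_compHom 0 0 h).symm.trans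
    (congrArg (𝓑.compHom · h) (add_zero 0)))

theorem burtButlerHom_smul (b : B) (h : BTensor B W B →ₗ[B] X) :
    𝓑.burtButlerHom b • h = h ∘ₗ BTensor.lmap B W (LinearMap.toSpanSingleton B B b) :=
  𝓑.comp_unitHom_compHom _ h

theorem burtButlerHom_smul_tmul (b : B) (h : BTensor B W B →ₗ[B] X) (w : W) (b' : B) :
    (𝓑.burtButlerHom b • h) (BTensor.tmul B w b') = h (BTensor.tmul B w (b' * b)) := by
  rw [burtButlerHom_smul]; rfl

variable (X) in
/-- An element `x` of `X`, as the morphism `w ⊗ b ↦ ε(w) b x` from `B` to `X` in `mod 𝓑`. -/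
def elemHom : X →ₛₗ[𝓑.burtButlerHom] (BTensor B W B →ₗ[B] X) where
  toFun x := LinearMap.toSpanSingleton B X x ∘ₗ 𝓑.unitHom B
  map_add' x y := by
    ext t
    exact smul_add _ x y
  map_smul' b x := by
    rw [burtButlerHom_smul]
    refine BTensor.linearMap_ext fun w b' => ?_
    change (𝓑.counit w * b') • b • x = (𝓑.counit w * (b' * b)) • x
    rw [← mul_smul, mul_assoc]

theorem elemHom_tmul (x : X) (w : W) (b : B) :
    𝓑.elemHom X x (BTensor.tmul B w b) = (𝓑.counit w * b) • x := rfl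

theorem smul_elemHom (r : 𝓑.RightBurtButler) (x : X) :
    r • 𝓑.elemHom X x = LinearMap.toSpanSingleton B X x ∘ₗ
      (MulOpposite.unop r : BTensor B W B →ₗ[B] B) :=
  𝓑.compHom_comp_unitHom _ _

theorem elemHom_injective : Function.Injective (𝓑.elemHom X) := by
  refine (injective_iff_map_eq_zero _).2 fun x hx => ?_
  obtain ⟨w, hw⟩ := 𝓑.counit_surjective 1
  have := LinearMap.congr_fun hx (BTensor.tmul B w 1)
  rwa [elemHom_tmul, hw, mul_one, one_smul] at this

variable (X) in
/-- The natural map `R ⊗_B X → Hom_𝓑(B, X)`. -/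
def indToHom : IndMod 𝓑.burtButlerHom X →ₗ[𝓑.RightBurtButler] (BTensor B W B →ₗ[B] X) :=
  indLift (𝓑.elemHom X)

theorem indToHom_indMk (x : X) :
    𝓑.indToHom X (indMk 𝓑.burtButlerHom X x) = 𝓑.elemHom X x :=
  indLift_indMk _ _

theorem indToHom_indMap (f : X →ₗ[B] Y) (t : IndMod 𝓑.burtButlerHom X) :
    𝓑.indToHom Y (indMap 𝓑.burtButlerHom f t) = f ∘ₗ 𝓑.indToHom X t := by
  induction t using ind_induction with
  | zero => simp
  | smul a x =>
    rw [map_smul, map_smul, indMap_indMk, indToHom_indMk, map_smul, indToHom_indMk]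
    refine (𝓑.smul_elemHom _ _).trans (Eq.trans ?_ (congrArg _ (𝓑.smul_elemHom a x)).symm)
    ext t
    exact (map_smul f _ x).symm
  | add s t hs ht => rw [map_add, map_add, hs, ht, map_add, LinearMap.comp_add]

/-- With W ⊗_B B ≅ W this is the standard isomorphism Hom_B(W, B) ⊗_B X ≅ Hom_B(W, X) for a finitely
generated projective module W. -/
theorem indToHom_bijective [Module.Finite B W] [Module.Projective B W] :
    Function.Bijective (𝓑.indToHom X) := by
  have : Module.Finite B (BTensor B W B) := .equiv (BTensor.ridEquiv B W).symm
  have : Module.Projective B (BTensor B W B) := .of_equiv (BTensor.ridEquiv B W).symm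
  obtain ⟨m, p, s, -, -, hps⟩ := Module.Finite.exists_comp_eq_id_of_projective B (BTensor B W B)
  -- The functionals c and the vectors v form a dual basis of W ⊗_B B; the c k, read as elements of
  -- R, give the inverse h ↦ ∑ c_k ⊗ h(v_k).
  let c : Fin m → BTensor B W B →ₗ[B] B := fun k => LinearMap.proj k ∘ₗ s
  let v : Fin m → BTensor B W B := fun k => p (Pi.single k 1)
  have hv : ∀ t, ∑ k, c k t • v k = t := fun t => by
    conv_rhs => rw [← LinearMap.id_apply (R := B) t, ← hps, LinearMap.comp_apply,
      ← LinearMap.sum_single_apply (fun _ : Fin m => B) (s t), map_sum]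
    refine Finset.sum_congr rfl fun k _ => ?_
    rw [← map_smul]
    congr 1
    ext j
    simp [c, Pi.single_apply]
  let r : Fin m → 𝓑.RightBurtButler := fun k => op (c k : BocsMod.regular 𝓑 ⟶ BocsMod.regular 𝓑)
  let inv : (BTensor B W B →ₗ[B] X) →+ IndMod 𝓑.burtButlerHom X :=
    AddMonoidHom.mk' (fun h => ∑ k, r k • indMk 𝓑.burtButlerHom X (h (v k))) fun h h' => by
      simp only [LinearMap.add_apply, map_add, smul_add, Finset.sum_add_distrib]
  refine Function.bijective_iff_has_inverse.2 ⟨inv, fun t => ?_, fun h => ?_⟩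
  · induction t using ind_induction with
    | zero => rw [map_zero, map_zero]
    | smul a x =>
      rw [map_smul, indToHom_indMk, smul_elemHom]
      change ∑ k, r k • indMk 𝓑.burtButlerHom X
        ((MulOpposite.unop a : BTensor B W B →ₗ[B] B) (v k) • x) = _
      simp only [map_smulₛₗ, ← mul_smul, ← Finset.sum_smul]
      congr 1
      refine MulOpposite.unop_injective (LinearMap.ext fun t => ?_)
      let ev : 𝓑.RightBurtButler →+ B :=
        AddMonoidHom.mk' (fun r => (MulOpposite.unop r : BTensor B W B →ₗ[B] B) t) fun _ _ => rfl
      refine (map_sum ev _ _).trans ?_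
      conv_rhs => rw [← hv t]
      refine Eq.trans ?_ (map_sum (MulOpposite.unop a : BTensor B W B →ₗ[B] B) _ _).symm
      refine Finset.sum_congr rfl fun k _ => ?_
      refine Eq.trans ?_ (map_smul (MulOpposite.unop a : BTensor B W B →ₗ[B] B) _ _).symm
      exact LinearMap.congr_fun (𝓑.compHom_comp_unitHom (c k) (LinearMap.toSpanSingleton B B _)) t
    | add s t hs ht => rw [map_add, map_add, hs, ht]
  · change 𝓑.indToHom X (∑ k, r k • indMk 𝓑.burtButlerHom X (h (v k))) = h
    simp only [map_sum, map_smul, indToHom_indMk, smul_elemHom]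
    refine LinearMap.ext fun t => ?_
    conv_rhs => rw [← hv t, map_sum]
    refine (LinearMap.sum_apply _ _ _).trans (Finset.sum_congr rfl fun k _ => ?_)
    rw [map_smul]
    rfl

end Bocs

/-! ### The kernel of the counit, and R as a directed extension of B -/

theorem projective_leftIdeal {A : Type u} [Ring A] {a : A} (ha : IsIdempotentElem a) :
    Module.Projective A (leftIdeal a) := by
  refine .of_split (leftIdeal a).subtype (LinearMap.toSpanSingleton A _ (leftIdealGen a)) ?_
  ext b
  exact (mem_leftIdeal_iff ha).1 b.2

theorem projective_pi {R : Type u₁} [Ring R] {ι : Type u₂} [Finite ι] {M : ι → Type u₃}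
    [∀ i, AddCommGroup (M i)] [∀ i, Module R (M i)] [∀ i, Module.Projective R (M i)] :
    Module.Projective R (∀ i, M i) := by
  classical
  have := Fintype.ofFinite ι
  exact .of_equiv (DFinsupp.linearEquivFunOnFintype (R := R) (M := M))

theorem exists_inclusions_projections_of_equiv {R : Type u₁} [Ring R] {M : Type u₂}
    [AddCommGroup M] [Module R M] {P : Type u₃} {l : P → Type u₄} {V : P → Type u₅}
    [∀ p, AddCommGroup (V p)] [∀ p, Module R (V p)] (θ : M ≃ₗ[R] ∀ p, l p → V p) :
    ∃ (π : ∀ q : Σ p, l p, M →ₗ[R] V q.1) (ι : ∀ q : Σ p, l p, V q.1 →ₗ[R] M),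
      (∀ q m, π q m = θ m q.1 q.2) ∧ (∀ m m', (∀ q, π q m = π q m') → m = m') ∧
      (∀ q x, π q (ι q x) = x) ∧ (∀ q q' x, q' ≠ q → π q' (ι q x) = 0) := by
  classical
  refine ⟨fun q => LinearMap.proj q.2 ∘ₗ LinearMap.proj q.1 ∘ₗ θ.toLinearMap,
    fun q => θ.symm.toLinearMap ∘ₗ LinearMap.single R _ q.1 ∘ₗ LinearMap.single R (fun _ => V q.1) q.2,
    fun _ _ => rfl, fun m m' h => θ.injective (funext fun p => funext fun k => h ⟨p, k⟩),
    fun q x => by simp, ?_⟩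
  rintro ⟨p, k⟩ ⟨p', k'⟩ x hq
  by_cases hp : p' = p
  · subst hp
    have hk : k' ≠ k := fun h => hq (by rw [h])
    simp [hk]
  · simp [hp]

namespace Bocs

variable {K : Type v} [Field K] {B : Type u} [Ring B] [Algebra K B] {W : Type u}
  [AddCommGroup W] [Module K W] [Module B W] [Module Bᵐᵒᵖ W] [SMulCommClass B Bᵐᵒᵖ W]
  [IsScalarTower K B W] [IsScalarTower K Bᵐᵒᵖ W] (𝓑 : Bocs K B W)

theorem mem_kernel_iff {w : W} : w ∈ 𝓑.kernel ↔ 𝓑.counit w = 0 := Iff.rfl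

/-- An element of `W` of counit one. -/
def counitOne : W := (𝓑.counit_surjective 1).choose

theorem counit_counitOne : 𝓑.counit 𝓑.counitOne = 1 := (𝓑.counit_surjective 1).choose_spec

/-- A splitting of the inclusion of `W̄` into `W`, as left modules. -/
def kernelProj : W →ₗ[B] 𝓑.kernel where
  toFun w := ⟨w - 𝓑.counit w • 𝓑.counitOne, by
    rw [mem_kernel_iff, map_sub, counit_smul, counit_counitOne, mul_one, sub_self]⟩
  map_add' w w' := by
    ext
    simp only [map_add, add_smul, Submodule.coe_add]
    abel
  map_smul' b w := by
    ext
    simp only [counit_smul, mul_smul, ← smul_sub, RingHom.id_apply, Submodule.coe_smul]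

theorem coe_kernelProj (w : W) :
    (𝓑.kernelProj w : W) = w - 𝓑.counit w • 𝓑.counitOne := rfl

theorem kernelProj_coe (w : 𝓑.kernel) : 𝓑.kernelProj w = w := by
  ext
  rw [coe_kernelProj, 𝓑.mem_kernel_iff.1 w.2, zero_smul, sub_zero]

theorem projective_of_projective_kernel [Module.Projective B 𝓑.kernel] : Module.Projective B W := by
  let ε : W →ₗ[B] B :=
    { toFun := 𝓑.counit
      map_add' := map_add _
      map_smul' := 𝓑.counit_smul }
  refine .of_split (M := 𝓑.kernel × B) (𝓑.kernelProj.prod ε)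
    (𝓑.kernel.subtype.coprod (LinearMap.toSpanSingleton B W 𝓑.counitOne)) ?_
  ext w
  exact sub_add_cancel w _

section

variable {X : Type u} [AddCommGroup X] [Module B X]

/-- As a left module W is spanned by its counit kernel and one element of counit one, so a morphism
vanishing on the kernel factors through the counit. -/
theorem eq_elemHom_of_kernel (h : BTensor B W B →ₗ[B] X)
    (hh : ∀ w : 𝓑.kernel, h (BTensor.tmul B (w : W) 1) = 0) :
    h = 𝓑.elemHom X (h (BTensor.tmul B 𝓑.counitOne 1)) := by
  refine BTensor.linearMap_ext fun w b => ?_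
  have := hh (𝓑.kernelProj (op b • w))
  rw [coe_kernelProj, ← BTensor.ridEquiv_symm_apply, map_sub, map_sub, sub_eq_zero,
    (BTensor.ridEquiv B W).symm.map_smul (𝓑.counit _), h.map_smul (𝓑.counit _),
    BTensor.ridEquiv_symm_apply, BTensor.ridEquiv_symm_apply] at this
  rw [BTensor.tmul_eq_op_smul_tmul_one, this, elemHom_tmul, counit_op_smul, mul_one]

theorem elemHom_tmul_kernel (x : X) (w : 𝓑.kernel) (b : B) :
    𝓑.elemHom X x (BTensor.tmul B (w : W) b) = 0 := by
  rw [elemHom_tmul, 𝓑.mem_kernel_iff.1 w.2, zero_mul, zero_smul]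

variable (X) in
/-- The `B`-module `Hom_B(W̄, X)`. -/
def KernelHom : Type u := 𝓑.kernel →ₗ[B] X

instance : AddCommGroup (𝓑.KernelHom X) := inferInstanceAs (AddCommGroup (𝓑.kernel →ₗ[B] X))

instance : FunLike (𝓑.KernelHom X) 𝓑.kernel X :=
  inferInstanceAs (FunLike (𝓑.kernel →ₗ[B] X) 𝓑.kernel X)

instance : LinearMapClass (𝓑.KernelHom X) B 𝓑.kernel X :=
  inferInstanceAs (LinearMapClass (𝓑.kernel →ₗ[B] X) B 𝓑.kernel X)

/-- Right multiplication on `W̄`, as an endomorphism of the left module. -/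
def kernelRightMulHom (b : B) : 𝓑.kernel →ₗ[B] 𝓑.kernel where
  toFun := 𝓑.kernelRightMul b
  map_add' w w' := Subtype.ext (smul_add (op b) (w : W) w')
  map_smul' c w := Subtype.ext (smul_comm c (op b) (w : W)).symm

instance : Module B (𝓑.KernelHom X) where
  smul b g := LinearMap.comp (σ₁₂ := RingHom.id B) (g : 𝓑.kernel →ₗ[B] X) (𝓑.kernelRightMulHom b)
  one_smul g := LinearMap.ext fun w => congrArg g (Subtype.ext (one_smul Bᵐᵒᵖ (w : W)))
  mul_smul b c g := LinearMap.ext fun w => congrArg g (Subtype.ext (mul_smul (op c) (op b) (w : W)))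
  smul_zero _ := rfl
  smul_add _ _ _ := rfl
  add_smul b c g := LinearMap.ext fun w =>
    (congrArg g (Subtype.ext (add_smul (op b) (op c) (w : W)))).trans (map_add g _ _)
  zero_smul g := LinearMap.ext fun w =>
    (congrArg g (Subtype.ext (zero_smul Bᵐᵒᵖ (w : W)))).trans (map_zero g)

theorem kernelHom_smul_apply (b : B) (g : 𝓑.KernelHom X) (w : 𝓑.kernel) :
    (b • g) w = g (𝓑.kernelRightMul b w) := rfl

theorem kernelHom_add_apply (g h : 𝓑.KernelHom X) (w : 𝓑.kernel) :
    (g + h) w = g w + h w := rfl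

variable (X) in
/-- The projection of `R ⊗_B X` onto `Hom_B(W̄, X)`. -/
def indToKernelHom : Res 𝓑.burtButlerHom (IndMod 𝓑.burtButlerHom X) →ₗ[B] 𝓑.KernelHom X where
  toFun t := 𝓑.indToHom X (resId _ _ t) ∘ₗ (BTensor.ridEquiv B W).symm.toLinearMap ∘ₗ
    𝓑.kernel.subtype
  map_add' s t := LinearMap.ext fun w => by
    rw [map_add, map_add]; rfl
  map_smul' b t := LinearMap.ext fun w => by
    rw [map_smulₛₗ, map_smul]
    refine (𝓑.burtButlerHom_smul_tmul b _ (w : W) 1).trans ?_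
    rw [one_mul, BTensor.tmul_eq_op_smul_tmul_one]
    rfl

variable [Module.Finite B W] [Module.Projective B W]

theorem indToKernelHom_surjective : Function.Surjective (𝓑.indToKernelHom X) := by
  intro g
  obtain ⟨t, ht⟩ := (𝓑.indToHom_bijective (X := X)).2
    (LinearMap.comp (σ₁₂ := RingHom.id B) (g : 𝓑.kernel →ₗ[B] X)
      (𝓑.kernelProj ∘ₗ (BTensor.ridEquiv B W).toLinearMap))
  refine ⟨t, DFunLike.ext _ _ fun w => ?_⟩
  refine (LinearMap.congr_fun ht _).trans (congrArg g ?_)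
  change 𝓑.kernelProj (op (1 : B) • (w : W)) = w
  rw [op_one, one_smul, kernelProj_coe]

theorem ker_indToKernelHom : LinearMap.ker (𝓑.indToKernelHom X) =
    LinearMap.range (toRes (indMk 𝓑.burtButlerHom X)) := by
  ext t
  constructor
  · intro ht
    have := 𝓑.eq_elemHom_of_kernel (𝓑.indToHom X (resId _ _ t)) fun w =>
      DFunLike.congr_fun (LinearMap.mem_ker.1 ht) w
    rw [← indToHom_indMk] at this
    exact ⟨_, (𝓑.indToHom_bijective.1 this).symm⟩
  · rintro ⟨x, rfl⟩
    refine DFunLike.ext _ _ fun w => ?_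
    refine (LinearMap.congr_fun (𝓑.indToHom_indMk x) _).trans (𝓑.elemHom_tmul_kernel x w 1)

/-- The cokernel of X → R ⊗ X is Hom_B(W̄, X): restriction to W̄ is onto since W̄ splits off W on
the left, and the morphisms vanishing on W̄ are those given by elements of X. -/
theorem injective_coker_of_injective_kernelHom (h : Module.Injective B (𝓑.KernelHom X)) :
    Module.Injective B (Res 𝓑.burtButlerHom (IndMod 𝓑.burtButlerHom X) ⧸
      LinearMap.range (toRes (indMk 𝓑.burtButlerHom X))) := by
  let E : (Res 𝓑.burtButlerHom (IndMod 𝓑.burtButlerHom X) ⧸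
      LinearMap.range (toRes (indMk 𝓑.burtButlerHom X))) ≃ₗ[B] 𝓑.KernelHom X :=
    (Submodule.quotEquivOfEq _ _ 𝓑.ker_indToKernelHom.symm).trans
      ((𝓑.indToKernelHom X).quotKerEquivOfSurjective 𝓑.indToKernelHom_surjective)
  refine ⟨fun Y Z _ _ _ _ f hf g => ?_⟩
  obtain ⟨g', hg'⟩ := h.out f hf (E.toLinearMap ∘ₗ g)
  exact ⟨E.symm.toLinearMap ∘ₗ g', fun y => E.symm_apply_eq.2 (hg' y)⟩

end

section Directed

variable {n : ℕ} {e : Fin n → B} (h𝓑 : 𝓑.IsOneCyclicDirected e)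
include h𝓑

theorem IsOneCyclicDirected.projective_kernel : Module.Projective B 𝓑.kernel := by
  obtain ⟨d, θ, -⟩ := h𝓑.kernel_iso
  have := fun i => projective_leftIdeal (h𝓑.isBasicSystem.orthogonal.idem i)
  have (p : {p : Fin n × Fin n // p.2 < p.1}) : Module.Projective B
    (Fin (d p.1.1 p.1.2) → (leftIdeal (e p.1.1) ⊗[K] rightIdeal (e p.1.2))) := projective_pi
  have : Module.Projective B ((p : {p : Fin n × Fin n // p.2 < p.1}) → Fin (d p.1.1 p.1.2) →
      (leftIdeal (e p.1.1) ⊗[K] rightIdeal (e p.1.2))) := projective_pi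
  exact .of_equiv θ.symm

omit [IsScalarTower K Bᵐᵒᵖ W] h𝓑 in
theorem mul_eq_of_mem_rightIdeal {a : B} (ha : IsIdempotentElem a) {b : B}
    (hb : b ∈ rightIdeal a) : a * b = b := by
  obtain ⟨c, rfl⟩ := Submodule.mem_span_singleton.1 hb
  change a * (a * c.unop) = a * c.unop
  rw [← mul_assoc, ha]

/-- On a summand B e_i ⊗ e_j B with i > j, directedness makes e_k B e_i vanish unless k ≥ i and e_j
B e_c vanish unless j ≥ c. A non-zero component would force k ≥ i > j ≥ c. -/
theorem IsOneCyclicDirected.smul_kernelRightMul_eq_zero [FiniteDimensional K B]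
    (hdir : ∀ {i j : Fin n}, i < j → ∀ b, e i * b * e j = 0) {c k : Fin n} (hk : k ≤ c)
    (w : 𝓑.kernel) : e k • 𝓑.kernelRightMul (e c) w = 0 := by
  obtain ⟨d, θ, hθ⟩ := h𝓑.kernel_iso
  refine θ.map_eq_zero_iff.1 ?_
  rw [map_smul]
  funext p l
  change e k • θ (𝓑.kernelRightMul (e c) w) p l = 0
  rw [hθ]
  generalize θ w p l = t
  induction t using TensorProduct.induction_on with
  | zero => rw [map_zero, smul_zero]
  | tmul a r =>
    rw [LinearMap.lTensor_tmul, TensorProduct.smul_tmul']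
    have ha := (mem_leftIdeal_iff (h𝓑.isBasicSystem.orthogonal.idem p.1.1)).1 a.2
    have hr := mul_eq_of_mem_rightIdeal (h𝓑.isBasicSystem.orthogonal.idem p.1.2) r.2
    by_cases h : k < p.1.1
    · have : e k • a = 0 := Subtype.ext (by
        change e k * (a : B) = 0
        rw [← ha, ← mul_assoc, hdir h])
      rw [this, TensorProduct.zero_tmul]
    · have : op (e c) • r = 0 := Subtype.ext (by
        change (r : B) * e c = 0
        rw [← hr, hdir (p.2.trans_le ((not_lt.1 h).trans hk))])
      rw [DistribSMul.toLinearMap_apply, this, TensorProduct.tmul_zero]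
  | add s t hs ht => rw [map_add, smul_add, hs, ht, add_zero]

omit h𝓑 in
theorem kernelRightMul_algebraMap (k : K) (w : 𝓑.kernel) :
    𝓑.kernelRightMul (algebraMap K B k) w = algebraMap K B k • w :=
  Subtype.ext (by
    change algebraMap K Bᵐᵒᵖ k • (w : W) = algebraMap K B k • (w : W)
    rw [algebraMap_smul, algebraMap_smul])

omit [IsScalarTower K Bᵐᵒᵖ W] h𝓑 in
variable (K) in
/-- Right multiplication by `b` on the bimodule `B a ⊗ c B`. -/
abbrev tensorRightMul (a c b : B) :
    leftIdeal a ⊗[K] rightIdeal c →ₗ[K] leftIdeal a ⊗[K] rightIdeal c :=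
  LinearMap.lTensor (leftIdeal a) (DistribSMul.toLinearMap K (rightIdeal c) (op b))

/-- The decomposition of `W̄` into bimodules `B eᵢ ⊗ eⱼ B`, in terms of inclusions and
projections. -/
theorem IsOneCyclicDirected.exists_inclusions_projections :
    ∃ (I : Type) (_ : Fintype I) (s t : I → Fin n)
      (π : ∀ q, 𝓑.kernel →ₗ[B] leftIdeal (e (s q)) ⊗[K] rightIdeal (e (t q)))
      (ι : ∀ q, (leftIdeal (e (s q)) ⊗[K] rightIdeal (e (t q))) →ₗ[B] 𝓑.kernel),
      (∀ w, ∑ q, ι q (π q w) = w) ∧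
      (∀ q b w, π q (𝓑.kernelRightMul b w) = tensorRightMul K _ _ b (π q w)) ∧
      (∀ q b x, ι q (tensorRightMul K _ _ b x) = 𝓑.kernelRightMul b (ι q x)) := by
  obtain ⟨d, θ, hθ⟩ := h𝓑.kernel_iso
  obtain ⟨π, ι, hπθ, hext, hπι, hπι_ne⟩ := exists_inclusions_projections_of_equiv θ
  have hπ : ∀ q b w, π q (𝓑.kernelRightMul b w) = tensorRightMul K _ _ b (π q w) :=
    fun q b w => (hπθ _ _).trans ((hθ b w q.1 q.2).trans (congrArg _ (hπθ _ _).symm))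
  have h₁ : ∀ w, ∑ q, ι q (π q w) = w := fun w => hext _ _ fun q => by
    rw [map_sum, Finset.sum_eq_single q, hπι]
    · exact fun q' _ hq => hπι_ne q' q _ hq.symm
    · exact fun h => absurd (Finset.mem_univ q) h
  have h₂ : ∀ q b x, ι q (tensorRightMul K _ _ b x) = 𝓑.kernelRightMul b (ι q x) :=
    fun q b x => hext _ _ fun q' => by
      rw [hπ]
      by_cases hq : q' = q
      · subst hq
        rw [hπι, hπι]
      · rw [hπι_ne _ _ _ hq, hπι_ne _ _ _ hq, map_zero]
  refine ⟨(Σ p : {p : Fin n × Fin n // p.2 < p.1}, Fin (d p.1.1 p.1.2)), inferInstance,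
    fun q => q.1.1.1, fun q => q.1.1.2, π, ι, ?_⟩
  exact ⟨h₁, hπ, h₂⟩

/-- Hom_B(B e_i ⊗_K e_j B, X) is Hom_K(e_j B, e_i X), so maps into it are controlled by K-linear
data. A K-linear retraction s of f, which exists over a field, is therefore enough to extend g. -/
theorem IsOneCyclicDirected.injective_kernelHom (X : Type u) [AddCommGroup X] [Module B X] :
    Module.Injective B (𝓑.KernelHom X) := by
  obtain ⟨I, _, i, j, π, ι, hιπ, hπ, hι⟩ := h𝓑.exists_inclusions_projections
  refine ⟨fun Y Z _ _ _ _ f hf g => ?_⟩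
  let _ : Module K X := Module.compHom X (algebraMap K B)
  let _ : Module K Y := Module.compHom Y (algebraMap K B)
  let _ : Module K Z := Module.compHom Z (algebraMap K B)
  have : IsScalarTower K B X := .of_algebraMap_smul fun _ _ => rfl
  have : IsScalarTower K B Y := .of_algebraMap_smul fun _ _ => rfl
  have : IsScalarTower K B Z := .of_algebraMap_smul fun _ _ => rfl
  obtain ⟨s, hs⟩ := (f.restrictScalars K).exists_leftInverse_of_injective
    (LinearMap.ker_eq_bot.2 hf)
  replace hs : ∀ y, s (f y) = y := LinearMap.congr_fun hs
  let u : I → 𝓑.kernel := fun q => ι q (leftIdealGen (e (i q)) ⊗ₜ[K]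
    (⟨e (j q), Submodule.mem_span_singleton_self _⟩ : rightIdeal (e (j q))))
  have hu : ∀ q (a : leftIdeal (e (i q))) (r : rightIdeal (e (j q))),
      (a : B) • 𝓑.kernelRightMul (r : B) (u q) = ι q (a ⊗ₜ[K] r) := by
    intro q a r
    rw [← hι, ← map_smul, LinearMap.lTensor_tmul, TensorProduct.smul_tmul']
    congr 2
    · exact Subtype.ext ((mem_leftIdeal_iff (h𝓑.isBasicSystem.orthogonal.idem _)).1 a.2)
    · exact Subtype.ext (mul_eq_of_mem_rightIdeal (h𝓑.isBasicSystem.orthogonal.idem _) r.2)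
  -- On one summand, with generator u = e_i ⊗ e_j, the map g y takes a ⊗ r to a · g(r y)(u).
  -- Replacing r y by s(r z) defines the extension, and it is B-linear in z because r varies over
  -- all of e_j B.
  let N : ∀ q, Z → rightIdeal (e (j q)) →ₗ[K] X := fun q z =>
    { toFun := fun r => g (s ((r : B) • z)) (u q)
      map_add' := fun r r' => by
        rw [Submodule.coe_add, add_smul, map_add, map_add, kernelHom_add_apply]
      map_smul' := fun k r => by
        rw [Submodule.coe_smul_of_tower, smul_assoc, map_smul, ← algebraMap_smul B k (s _),
          map_smul, kernelHom_smul_apply, kernelRightMul_algebraMap, map_smul, algebraMap_smul,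
          RingHom.id_apply] }
  let T : ∀ q, Z → (leftIdeal (e (i q)) ⊗[K] rightIdeal (e (j q))) →ₗ[B] X := fun q z =>
    TensorProduct.AlgebraTensorModule.lift
      ((LinearMap.toSpanSingleton B _ (N q z)) ∘ₗ (leftIdeal (e (i q))).subtype)
  have hT : ∀ q z a r, T q z (a ⊗ₜ r) = (a : B) • g (s ((r : B) • z)) (u q) :=
    fun _ _ _ _ => rfl
  have hT_add : ∀ q z z' t, T q (z + z') t = T q z t + T q z' t := by
    intro q z z' t
    induction t using TensorProduct.induction_on with
    | zero => simp only [map_zero, add_zero]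
    | tmul a r => simp only [hT, smul_add, map_add, kernelHom_add_apply]
    | add t t' h h' => rw [map_add, h, h', map_add, map_add]; abel
  have hT_smul : ∀ q (b : B) z t, T q (b • z) t = T q z (tensorRightMul K _ _ b t) := by
    intro q b z t
    induction t using TensorProduct.induction_on with
    | zero => simp only [map_zero]
    | tmul a r =>
      rw [LinearMap.lTensor_tmul, hT, hT, ← mul_smul]
      rfl
    | add t t' h h' => rw [map_add, h, h', map_add, map_add]
  have hT_ext : ∀ q y t, T q (f y) t = g y (ι q t) := by
    intro q y t
    induction t using TensorProduct.induction_on with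
    | zero => simp only [map_zero]
    | tmul a r =>
      rw [hT, ← map_smul f, hs, map_smul, kernelHom_smul_apply, ← map_smul, hu]
    | add t t' h h' => rw [map_add, h, h', map_add, map_add]
  let G : Z → 𝓑.kernel →ₗ[B] X := fun z => ∑ q, T q z ∘ₗ π q
  have hG : ∀ z w, G z w = ∑ q, T q z (π q w) := fun z w => LinearMap.sum_apply _ _ _
  refine ⟨{ toFun := G, map_add' := fun z z' => LinearMap.ext fun w => ?_,
            map_smul' := fun b z => LinearMap.ext fun w => ?_ }, fun y => LinearMap.ext fun w => ?_⟩
  · refine Eq.trans ?_ (LinearMap.add_apply (G z) (G z') w).symm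
    simp only [hG, hT_add, Finset.sum_add_distrib]
  · change G (b • z) w = G z (𝓑.kernelRightMul b w)
    simp only [hG, hT_smul, hπ]
  · change G (f y) w = g y w
    simp only [hG, hT_ext, ← map_sum, hιπ]

theorem IsOneCyclicDirected.mul_mul_eq_zero [FiniteDimensional K B] {i j : Fin n} (h : i < j)
    (b : B) : e i * b * e j = 0 :=
  h𝓑.isBasicSystem.mul_mul_eq_zero K h𝓑.oneCyclic h b

/-- Everything is read off from R ⊗ X ≅ Hom_B(W ⊗ B, X): left exactness is that of Hom, the unit is
injective because the counit is onto, and the cokernel is Hom_B(W̄, X). -/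
theorem IsOneCyclicDirected.isDirectedExtension [FiniteDimensional K B] [FiniteDimensional K W] :
    IsDirectedExtension 𝓑.burtButlerHom e := by
  have : Module.Finite B W := .of_restrictScalars_finite K B W
  have := h𝓑.projective_kernel
  have := 𝓑.projective_of_projective_kernel
  refine ⟨h𝓑.isBasicSystem.orthogonal, h𝓑.sum_eq_one, fun h b => h𝓑.mul_mul_eq_zero 𝓑 h b,
    fun {X Y} _ _ _ _ f hf => ?_, fun {X Y Z} _ _ _ _ _ _ f g hf hfg => ?_, fun X _ _ x y hxy => ?_,
    fun X _ _ => 𝓑.injective_coker_of_injective_kernelHom (h𝓑.injective_kernelHom 𝓑 X),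
    fun X _ _ c hc t => ?_⟩
  · refine (injective_iff_map_eq_zero _).2 fun t ht => ?_
    have := 𝓑.indToHom_indMap f t
    rw [ht, map_zero] at this
    refine 𝓑.indToHom_bijective.1 ((LinearMap.ext fun v => hf ?_).trans (map_zero _).symm)
    rw [LinearMap.zero_apply, map_zero]
    exact (LinearMap.congr_fun this v).symm
  · intro t
    constructor
    · intro ht
      have h0 := 𝓑.indToHom_indMap g t
      rw [ht, map_zero] at h0
      have h1 : ∀ v, ∃ x, f x = 𝓑.indToHom Y t v := fun v =>
        (hfg _).1 (LinearMap.congr_fun h0 v).symm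
      let fi := LinearEquiv.ofInjective f hf
      obtain ⟨s, hs⟩ := 𝓑.indToHom_bijective.2
        (fi.symm.toLinearMap ∘ₗ (𝓑.indToHom Y t).codRestrict (LinearMap.range f) h1)
      refine ⟨s, 𝓑.indToHom_bijective.1 ?_⟩
      rw [indToHom_indMap, hs]
      ext v
      exact congrArg Subtype.val (fi.apply_symm_apply ⟨_, h1 v⟩)
    · rintro ⟨s, rfl⟩
      refine 𝓑.indToHom_bijective.1 ?_
      rw [indToHom_indMap, indToHom_indMap, ← LinearMap.comp_assoc, map_zero,
        show g ∘ₗ f = 0 from LinearMap.ext hfg.apply_apply_eq_zero, LinearMap.zero_comp]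
  · have := congrArg (𝓑.indToHom X) hxy
    rw [indToHom_indMk, indToHom_indMk] at this
    exact 𝓑.elemHom_injective this
  · let h := 𝓑.indToHom X t
    have hsum : ∀ x : X, ∑ k, e k • x = x := fun x => by
      rw [← Finset.sum_smul, h𝓑.sum_eq_one, one_smul]
    -- It suffices that h kills W̄ e_c. Components of its values above c vanish by the support of X,
    -- the others because e_k W̄ e_c = 0 for k ≤ c.
    have := 𝓑.eq_elemHom_of_kernel (𝓑.burtButlerHom (e c) • h) fun w => by
      rw [burtButlerHom_smul_tmul, one_mul, BTensor.tmul_eq_op_smul_tmul_one,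
        ← hsum (h _)]
      refine Finset.sum_eq_zero fun k _ => ?_
      by_cases hk : c < k
      · exact hc k hk _
      · rw [← map_smul, BTensor.smul_tmul]
        have h0 := congrArg Subtype.val
          (h𝓑.smul_kernelRightMul_eq_zero 𝓑 (fun h b => h𝓑.mul_mul_eq_zero 𝓑 h b) (not_lt.1 hk) w)
        change e k • op (e c) • (w : W) = 0 at h0
        rw [h0, ← BTensor.ridEquiv_symm_apply, map_zero, map_zero]
    rw [← indToHom_indMk] at this
    exact ⟨_, 𝓑.indToHom_bijective.1 ((map_smul _ _ _).trans this)⟩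

omit h𝓑 in
-- An element of R is determined by its values on the tensors w ⊗ 1, so R embeds into Hom_K(W, B).
instance [FiniteDimensional K B] [FiniteDimensional K W] :
    FiniteDimensional K 𝓑.RightBurtButler := by
  let E : 𝓑.RightBurtButler →ₗ[K] (W →ₗ[K] B) :=
    { toFun := fun r =>
        { toFun := fun w => (MulOpposite.unop r : BTensor B W B →ₗ[B] B) (BTensor.tmul B w 1)
          map_add' := fun w w' => by rw [BTensor.add_tmul, map_add]
          map_smul' := fun k w => by
            rw [← algebraMap_smul B k w, ← BTensor.smul_tmul, map_smul, algebraMap_smul]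
            rfl }
      map_add' := fun r s => rfl
      map_smul' := fun k r => LinearMap.ext fun w => algebraMap_smul B k _ }
  refine FiniteDimensional.of_injective E fun r s h => MulOpposite.unop_injective ?_
  refine BTensor.linearMap_ext fun w (b : B) => ?_
  have hr : ∀ f : BTensor B W B →ₗ[B] B, f (BTensor.tmul B w b) =
      f (BTensor.tmul B (op b • w) 1) := fun f =>
    congrArg f (BTensor.tmul_eq_op_smul_tmul_one w b)
  exact (hr _).trans ((LinearMap.congr_fun h (op b • w)).trans (hr _).symm)

omit h𝓑 in
theorem burtButlerHom_injective : Function.Injective 𝓑.burtButlerHom := by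
  intro b c h
  have h' : 𝓑.rightMulHom b = 𝓑.rightMulHom c := congrArg MulOpposite.unop h
  have := LinearMap.congr_fun h' (BTensor.tmul B 𝓑.counitOne 1)
  rwa [rightMulHom_tmul, rightMulHom_tmul, counit_counitOne, one_mul, one_mul, one_mul] at this

end Directed

end Bocs

/-! ### Induction as an exact left adjoint -/

section InductionFunctor

variable {B A : Type u} [Ring B] [Ring A]

/-- The map `A ⊗_B X → M` corresponding to a `B`-linear map `X → M`. -/
def indDesc {φ : B →+* A} {X : ModuleCat.{u} B} {M : ModuleCat.{u} A}
    (g : X ⟶ (ModuleCat.restrictScalars φ).obj M) : IndMod φ X →ₗ[A] M :=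
  indLift
    { toFun := fun x => g.hom x
      map_add' := fun x y => map_add g.hom x y
      map_smul' := fun b x => map_smul g.hom b x }

theorem indDesc_indMk {φ : B →+* A} {X : ModuleCat.{u} B} {M : ModuleCat.{u} A}
    (g : X ⟶ (ModuleCat.restrictScalars φ).obj M) (x : X) : indDesc g (indMk φ X x) = g.hom x :=
  indLift_indMk _ x

/-- Induction along `φ` is left adjoint to restriction along `φ`. -/
def inductionAdjunction (φ : B →+* A) : inductionFunctor φ ⊣ ModuleCat.restrictScalars.{u} φ :=
  Adjunction.mkOfHomEquiv
    { homEquiv := fun X M =>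
        { toFun := fun f => ModuleCat.ofHom (Y := (ModuleCat.restrictScalars φ).obj M)
            { toFun := fun x => f.hom (indMk φ X x)
              map_add' := fun x y =>
                (congrArg f.hom (map_add (indMk φ X) x y)).trans (map_add f.hom _ _)
              map_smul' := fun b x =>
                (congrArg f.hom (map_smulₛₗ (indMk φ X) b x)).trans (map_smul f.hom _ _) }
          invFun := fun g => ModuleCat.ofHom (X := IndMod φ X) (indDesc g)
          left_inv := fun _ => ModuleCat.hom_ext (ind_hom_ext fun x => indDesc_indMk _ x)
          right_inv := fun _ => ModuleCat.hom_ext (LinearMap.ext fun x => indDesc_indMk _ x) }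
      homEquiv_naturality_left_symm := fun f g =>
        ModuleCat.hom_ext (ind_hom_ext fun x => (indDesc_indMk _ x).trans
          (indDesc_indMk g (f.hom x)).symm)
      homEquiv_naturality_right := fun _ _ => rfl }

instance (φ : B →+* A) : (ModuleCat.restrictScalars.{u} φ).PreservesEpimorphisms :=
  ⟨fun f hf => (ModuleCat.epi_iff_surjective _).2 ((ModuleCat.epi_iff_surjective f).1 hf)⟩

namespace IsDirectedExtension

variable {n : ℕ} {φ : B →+* A} {e : Fin n → B} (D : IsDirectedExtension φ e)
include D

theorem preservesFiniteLimits_and_colimits :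
    Limits.PreservesFiniteLimits (inductionFunctor φ) ∧
      Limits.PreservesFiniteColimits (inductionFunctor φ) := by
  refine ((Functor.exact_tfae (inductionFunctor φ)).out 0 3).1 fun S hS => ?_
  have hf := (ModuleCat.mono_iff_injective S.f).1 hS.mono_f
  have hg := (ModuleCat.epi_iff_surjective S.g).1 hS.epi_g
  have hfg := (ShortComplex.ShortExact.moduleCat_exact_iff_function_exact S).1 hS.exact
  exact
    { exact := (ShortComplex.ShortExact.moduleCat_exact_iff_function_exact _).2
        (D.map_exact S.f.hom S.g.hom hf hfg)
      mono_f := (ModuleCat.mono_iff_injective _).2 (D.map_injective S.f.hom hf)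
      epi_g := (ModuleCat.epi_iff_surjective _).2 (indMap_surjective hg) }

theorem mono_unit (X : ModuleCat.{u} B) : Mono ((inductionAdjunction φ).unit.app X) :=
  (ModuleCat.mono_iff_injective _).2 (D.unit_injective X)

theorem injective_cokernel_unit (X : ModuleCat.{u} B) :
    Injective (Limits.cokernel ((inductionAdjunction φ).unit.app X)) := by
  have := Module.injective_object_of_injective_module (inj := D.injective_coker X)
  exact Injective.of_iso (ModuleCat.cokernelIsoRangeQuotient _).symm this

omit D in
theorem isHomological {K : Type v} [Field K] [Algebra K B] [Algebra K A] {φ : B →ₐ[K] A}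
    (D : IsDirectedExtension (φ : B →+* A) e) : IsHomological φ := by
  obtain ⟨h₁, h₂⟩ := D.preservesFiniteLimits_and_colimits
  have := D.mono_unit
  have := D.injective_cokernel_unit
  have hs := fun (X Y : ModuleCat.{u} B) k (hk : 1 ≤ k) =>
    mapExtAddHom_surjective_of_injective_cokernel (inductionAdjunction (φ : B →+* A)) hk X Y
  refine ⟨h₁, h₂, fun X Y _ _ => ⟨hs X Y, fun k hk => ⟨?_, hs X Y k (by omega)⟩⟩⟩
  exact mapExtAddHom_injective_of_injective_cokernel (inductionAdjunction (φ : B →+* A)) hk X Y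

end IsDirectedExtension

end InductionFunctor

/-! ### Proper Borel subalgebra and filtered projectives -/

namespace IsDirectedExtension

variable {K : Type v} [Field K] [IsAlgClosed K] {B A : Type u} [Ring B] [Ring A] [Algebra K B]
  [Algebra K A] [FiniteDimensional K B] [FiniteDimensional K A] {n : ℕ} {φ : B →ₐ[K] A}
  {e : Fin n → B} (he : IsBasicSystem e) (D : IsDirectedExtension (φ : B →+* A) e)
  {f : Fin n → A} (hf : IsVertexLift (φ : B →+* A) e f)
include he D hf

theorem isProperBorel (hinj : Function.Injective φ) (hcyc : IsOneCyclicAlgebra e) :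
    IsProperBorel e f φ where
  injective := hinj
  oneCyclic := hcyc
  leftExact := D.preservesFiniteLimits_and_colimits.1
  rightExact := D.preservesFiniteLimits_and_colimits.2
  properStandard i :=
    (D.nonempty_properStandardMod_equiv φ.commutes he hf i).map LinearEquiv.toModuleIso

theorem isProperlyFiltered : IsProperlyFiltered K f where
  finiteDimensional := inferInstance
  isBasicSystem := D.isBasicSystem he hf K
  filtration i := by
    let r₀ : leftIdeal (e i) →ₛₗ[(φ : B →+* A)] leftIdeal (f i) :=
      { toFun := fun b => (φ b : A) • leftIdealGen (f i)
        map_add' := fun b c => by rw [← add_smul, ← map_add]; rfl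
        map_smul' := fun b c => by
          rw [RingHom.coe_coe, ← mul_smul, ← map_mul]; rfl }
    -- A f_i is a direct summand of A φ(e_i), that is, of A ⊗ B e_i. Directedness confines B e_i to
    -- vertices j ≥ i, which gives the range of the factors; the support bound n is no restriction.
    refine D.hasFiltration_of_retract he
      (fun j => D.nonempty_properStandardMod_equiv φ.commutes he hf j) K n
      (fun k hk => absurd k.2 (not_lt.2 hk)) (fun j hj x => ?_)
      (leftIdealLift (f i) (f i • indMk (φ : B →+* A) (leftIdeal (e i)) (leftIdealGen (e i))))
      (indLift r₀) fun x => ?_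
    · exact Subtype.ext (D.smul_leftIdeal_eq_zero (not_le.1 hj) x.2)
    · rw [leftIdealLift_apply, map_smul, map_smul, indLift_indMk]
      change (x : A) • f i • (φ (e i) : A) • leftIdealGen (f i) = x
      have h : (φ (e i) : A) • leftIdealGen (f i) = leftIdealGen (f i) :=
        Subtype.ext (hf.map_mul i)
      have h' : f i • leftIdealGen (f i) = leftIdealGen (f i) :=
        smul_leftIdealGen (hf.primitive i).1 (leftIdealGen (f i))
      rw [h, h', smul_leftIdealGen (hf.primitive i).1 x]

end IsDirectedExtension

/-! ### The equivalence between mod 𝓑 and the filtered R-modules -/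

namespace Bocs

variable {K : Type v} [Field K] {B : Type u} [Ring B] [Algebra K B] {W : Type u}
  [AddCommGroup W] [Module K W] [Module B W] [Module Bᵐᵒᵖ W] [SMulCommClass B Bᵐᵒᵖ W]
  [IsScalarTower K B W] [IsScalarTower K Bᵐᵒᵖ W] (𝓑 : Bocs K B W)

/-- Scalars reach Hom_𝓑(B, X) both through R and through X; the two actions agree because K acts
centrally on W. This is what makes `homFunctor` K-linear. -/
theorem algebraMap_smul_hom {X : Type u} [AddCommGroup X] [Module B X] (k : K)
    (h : BTensor B W B →ₗ[B] X) (t : BTensor B W B) :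
    (algebraMap K 𝓑.RightBurtButler k • h) t = algebraMap K B k • h t := by
  rw [← 𝓑.toRightBurtButler.commutes]
  refine (LinearMap.congr_fun (𝓑.burtButlerHom_smul (algebraMap K B k) h) t).trans ?_
  refine (congrArg h ?_).trans (map_smul h _ t)
  induction t using BTensor.induction with
  | zero => rw [map_zero, smul_zero]
  | tmul w b =>
    change BTensor.tmul B w (b * algebraMap K B k) = BTensor.tmul B (algebraMap K B k • w) b
    rw [← Algebra.commutes, ← smul_eq_mul, ← BTensor.op_smul_tmul]
    congr 1
    change algebraMap K Bᵐᵒᵖ k • w = _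
    rw [algebraMap_smul, algebraMap_smul]
  | add s t hs ht => rw [map_add, hs, ht, smul_add]

/-- The functor `Hom_𝓑(B, -)` from `mod 𝓑` to the modules over `R`. -/
def homFunctor : BocsMod 𝓑 ⥤ ModuleCat.{u} 𝓑.RightBurtButler where
  obj X := ModuleCat.of _ (BTensor B W B →ₗ[B] X.obj)
  map g := ModuleCat.ofHom
    { toFun := fun h => 𝓑.compHom h g
      map_add' := fun h h' => 𝓑.add_compHom h h' g
      map_smul' := fun _ h => 𝓑.compHom_assoc _ h g }
  map_id _ := ModuleCat.hom_ext (LinearMap.ext fun h => 𝓑.compHom_unitHom h)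
  map_comp g g' := ModuleCat.hom_ext (LinearMap.ext fun h => (𝓑.compHom_assoc h g g').symm)

instance : 𝓑.homFunctor.Additive where
  map_add := rfl

instance : 𝓑.homFunctor.Linear K where
  map_smul g k := ModuleCat.hom_ext (LinearMap.ext fun h => LinearMap.ext fun t =>
    (𝓑.algebraMap_smul_hom k (𝓑.compHom h g) t).symm)

theorem compHom_elemHom_tmul {X Y : Type u} [AddCommGroup X] [Module B X] [AddCommGroup Y]
    [Module B Y] (g : BTensor B W X →ₗ[B] Y) (x : X) (w : W) (b : B) :
    𝓑.compHom (𝓑.elemHom X x) g (BTensor.tmul B w b) = g (BTensor.tmul B w (b • x)) :=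
  LinearMap.congr_fun (𝓑.comp_unitHom_compHom (LinearMap.toSpanSingleton B X x) g) _

instance : 𝓑.homFunctor.Faithful where
  map_injective {X Y} g g' h := BTensor.linearMap_ext fun w x => by
    have h₁ := 𝓑.compHom_elemHom_tmul (X := X.obj) (Y := Y.obj) g x w 1
    have h₂ := 𝓑.compHom_elemHom_tmul (X := X.obj) (Y := Y.obj) g' x w 1
    rw [one_smul] at h₁ h₂
    have h₃ : 𝓑.compHom (𝓑.elemHom X.obj x) (Z := Y.obj) g =
        𝓑.compHom (𝓑.elemHom X.obj x) (Z := Y.obj) g' :=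
      LinearMap.congr_fun (congrArg ModuleCat.Hom.hom h) (𝓑.elemHom X.obj x)
    exact h₁.symm.trans ((LinearMap.congr_fun h₃ _).trans h₂)

variable [Module.Finite B W] [Module.Projective B W]

theorem hom_ext_elemHom {X : Type u} [AddCommGroup X] [Module B X] {M : Type u₁} [AddCommGroup M]
    [Module 𝓑.RightBurtButler M] {F G : (BTensor B W B →ₗ[B] X) →ₗ[𝓑.RightBurtButler] M}
    (h : ∀ x, F (𝓑.elemHom X x) = G (𝓑.elemHom X x)) : F = G := by
  ext t
  obtain ⟨t, rfl⟩ := 𝓑.indToHom_bijective.2 t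
  refine LinearMap.congr_fun (f := F ∘ₗ 𝓑.indToHom X) (g := G ∘ₗ 𝓑.indToHom X)
    (ind_hom_ext fun x => ?_) t
  rw [LinearMap.comp_apply, LinearMap.comp_apply, indToHom_indMk, h]

instance : 𝓑.homFunctor.Full where
  map_surjective {X Y} F := by
    let F' : (BTensor B W B →ₗ[B] X.obj) →ₗ[𝓑.RightBurtButler] (BTensor B W B →ₗ[B] Y.obj) :=
      F.hom
    have hF' : ∀ (b : B) (x : X.obj) (w : W), F' (𝓑.elemHom X.obj (b • x)) (BTensor.tmul B w 1) =
        F' (𝓑.elemHom X.obj x) (BTensor.tmul B w b) := fun b x w => by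
      rw [map_smulₛₗ, map_smul, burtButlerHom_smul_tmul, one_mul]
    -- The only candidate for a preimage: g(w ⊗ x) is the value at w ⊗ 1 of the image of x under F.
    -- Linearity of F over B ⊆ R makes it balanced.
    let g₀ : BTensor B W X.obj →+ Y.obj := BTensor.lift
      (BTensor.biadd (fun w x => F' (𝓑.elemHom X.obj x) (BTensor.tmul B w 1))
        (fun w w' x => by rw [BTensor.add_tmul, map_add])
        (fun w x x' => by rw [map_add, map_add, LinearMap.add_apply]))
      (fun b w x => by
        rw [BTensor.biadd_apply, BTensor.biadd_apply, hF', BTensor.tmul_eq_op_smul_tmul_one w b])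
    let g : BTensor B W X.obj →ₗ[B] Y.obj :=
      { toFun := g₀
        map_add' := map_add g₀
        map_smul' := fun b t => by
          induction t using BTensor.induction with
          | zero => rw [smul_zero, map_zero, smul_zero]
          | tmul w x => 
            change F' (𝓑.elemHom X.obj x) (BTensor.tmul B (b • w) 1) =
              b • F' (𝓑.elemHom X.obj x) (BTensor.tmul B w 1)
            rw [← map_smul, BTensor.smul_tmul]
          | add s t hs ht => rw [smul_add, map_add, hs, ht, map_add, smul_add] }
    refine ⟨g, ModuleCat.hom_ext (𝓑.hom_ext_elemHom (G := F') fun x => ?_)⟩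
    refine BTensor.linearMap_ext fun w b => ?_
    exact (𝓑.compHom_elemHom_tmul g x w b).trans (hF' b x w)

end Bocs

namespace Bocs

variable {K : Type v} [Field K] {B : Type u} [Ring B] [Algebra K B] [FiniteDimensional K B]
  {W : Type u} [AddCommGroup W] [Module K W] [Module B W] [Module Bᵐᵒᵖ W] [SMulCommClass B Bᵐᵒᵖ W]
  [IsScalarTower K B W] [IsScalarTower K Bᵐᵒᵖ W] (𝓑 : Bocs K B W) [Module.Finite B W]
  [Module.Projective B W]

/-- The isomorphism `R ⊗_B X ≃ Hom_𝓑(B, X)`. -/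
def indEquivHom (X : Type u) [AddCommGroup X] [Module B X] :
    IndMod 𝓑.burtButlerHom X ≃ₗ[𝓑.RightBurtButler] (BTensor B W B →ₗ[B] X) :=
  .ofBijective (𝓑.indToHom X) 𝓑.indToHom_bijective

/-- The fully faithful functor Hom_𝓑(B, -) takes values R ⊗ X, which are filtered, and it is dense
in the filtered modules because each of these is induced from a finitely generated B-module. -/
theorem exists_filtCat_equivalence {n : ℕ} {e : Fin n → B} (he : IsBasicSystem e)
    (D : IsDirectedExtension 𝓑.burtButlerHom e) {f : Fin n → 𝓑.RightBurtButler}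
    (hf : ∀ j, Nonempty (properStandardMod f j ≃ₗ[𝓑.RightBurtButler]
      IndMod 𝓑.burtButlerHom (simpleMod e j))) :
    ∃ E : FiltCat f ≌ BocsMod 𝓑, E.functor.Additive ∧ E.functor.Linear K := by
  have hG : ∀ X : BocsMod 𝓑, Module.Finite 𝓑.RightBurtButler (𝓑.homFunctor.obj X) ∧
      HasFiltration (properStandardMod f) Set.univ (𝓑.homFunctor.obj X) := fun X => by
    have := X.finite
    refine ⟨.equiv (𝓑.indEquivHom X.obj), HasFiltration.of_equiv (X := ModuleCat.of _ (IndMod 𝓑.burtButlerHom X.obj)) ?_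
      (𝓑.indEquivHom X.obj)⟩
    exact D.hasFiltration_of_isFiniteLength he hf K (finite_isFiniteLength K X.obj)
      fun j hj => absurd (Set.mem_univ j) hj
  let G : BocsMod 𝓑 ⥤ FiltCat f := ObjectProperty.lift _ 𝓑.homFunctor hG
  have : G.EssSurj := ⟨fun M => by
    obtain ⟨X, _, _, _, ⟨E⟩⟩ := D.exists_ind_equiv_of_hasFiltration hf M.property.2
    exact ⟨⟨ModuleCat.of B X, ‹_›⟩, ⟨ObjectProperty.isoMk _
      ((𝓑.indEquivHom X).symm.trans E).toModuleIso⟩⟩⟩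
  have : G.IsEquivalence := {}
  have hadd : G.asEquivalence.functor.Additive :=
    ⟨ObjectProperty.hom_ext _ 𝓑.homFunctor.map_add⟩
  have hlin : G.asEquivalence.functor.Linear K :=
    ⟨fun g k => ObjectProperty.hom_ext _ (Functor.map_smul 𝓑.homFunctor k g)⟩
  exact ⟨G.asEquivalence.symm, G.asEquivalence.inverse_additive,
    G.asEquivalence.inverseLinear K⟩

end Bocs

theorem theorem6p5 {K : Type v} [Field K] [IsAlgClosed K]
    {B : Type u} [Ring B] [Algebra K B] [FiniteDimensional K B]
    {W : Type u} [AddCommGroup W] [Module K W] [Module B W] [Module Bᵐᵒᵖ W]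
    [SMulCommClass B Bᵐᵒᵖ W] [IsScalarTower K B W] [IsScalarTower K Bᵐᵒᵖ W]
    [FiniteDimensional K W] (𝓑 : Bocs K B W)
    {n : ℕ} (e : Fin n → B) (h𝓑 : 𝓑.IsOneCyclicDirected e) :
    ∃ f : Fin n → 𝓑.RightBurtButler,
      IsProperlyFiltered K f ∧
      IsProperBorel e f 𝓑.toRightBurtButler ∧
      IsHomological 𝓑.toRightBurtButler ∧
      ∃ E : FiltCat f ≌ BocsMod 𝓑, E.functor.Additive ∧ E.functor.Linear K := by
  have : Module.Finite B W := .of_restrictScalars_finite K B W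
  have := h𝓑.projective_kernel
  have := 𝓑.projective_of_projective_kernel
  have he := h𝓑.isBasicSystem
  have D := h𝓑.isDirectedExtension
  obtain ⟨f, hf⟩ := D.exists_isVertexLift 𝓑.toRightBurtButler.commutes he
  exact ⟨f, D.isProperlyFiltered he hf,
    D.isProperBorel he hf 𝓑.burtButlerHom_injective h𝓑.oneCyclic, D.isHomological,
    𝓑.exists_filtCat_equivalence he D
      (D.nonempty_properStandardMod_equiv 𝓑.toRightBurtButler.commutes he hf)⟩

end
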